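/- Let $\mathcal R$ be an oriented connected compact smooth surface, possibly with boundary, with a finite nonempty set $\mathbf w\subset\mathcal R$ of basepoints. Let $\Gamma=\Xi\sqcup\Theta$ be a finite set of properly embedded, mutually transverse smooth curves on $\mathcal R$ (circles in the interior, or arcs meeting $\partial\mathcal R$ exactly in their endpoints), $\Xi=\{\xi_1,\dots,\xi_n\}$. A relative domain is a linear combination, with rational coefficients (its local multiplicities), of the closures of the components of $\mathcal R-\Gamma$. It is a relative periodic domain if $\partial\mathcal D-\partial\mathcal R$ is a linear combination of curves in $\Gamma$ and $\mathcal D$ avoids $\mathbf w$ (the multiplicity of every region whose closure contains a basepoint is $0$). Let $\tau_1,\dots,\tau_n$ be smoothly embedded circles in the interior of $\mathcal R$ such that $\tau_i$ meets $\xi_i$ in exactly one point, transversely. Suppose there is a connected open set $\mathcal U\subset\mathcal R$ with $\mathbf w\subset\mathcal U$, $\tau_i\cap\xi_i\subset\mathcal U$ for all $i$, and $\theta\cap\mathcal U=\emptyset$ for all $\theta\in\Theta$. Let $V_i$ be any open neighbourhood of $\tau_i$. A winding map along $\tau_i$ is built as follows. Choose an annular neighbourhood $S^1\times(-1,1)\subset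 V_i$ of $\tau_i=S^1\times\{0\}$ in the interior of $\mathcal R$ (with $S^1=\mathbb R/\mathbb Z$), and smooth bump functions $b^{+},b^{-}$ of $t\in(-1,1)$ with disjoint compact supports, each nondecreasing up to a level at which it equals $1$ and nonincreasing afterwards, such that no basepoint lies in $S^1\times(\operatorname{supp} b^{+}\cup\operatorname{supp} b^{-})$. For $k,l\in\mathbb N$ let $W_i^{k,l}$ be the map $(\vartheta,t)\mapsto(\vartheta+k\,b^{+}(t)-l\,b^{-}(t),\,t)$ on the annulus, extended by the identity. It winds $k$ times along one parallel copy of $\tau_i$ and $l$ times along another one in the opposite direction. (1) The annuli and bump functions can be chosen, and there is an $N$, such that for all integers $k_i,l_i\ge N$ ($1\le i\le n$) the following holds with $\xi_i'=W_i^{k_i,l_i}(\xi_i)$ and $\Gamma'=\{\xi_1',\dots,\xi_n'\}\sqcup\Theta$. The curves in $\Gamma'$ are again properly embedded and mutually transverse, and every relative periodic domain $\mathcal D$ of $(\mathcal R,\Gamma',\mathbf w)$ whose boundary contains some $\xi_i'$ with nonzero coefficient has both positive and negative local multiplicities. Hence no nonnegative relative periodic domain has a boundary containing some $\xi_i'$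 nontrivially. (2) Suppose moreover that the algebraic intersection number of $\tau_i$ with $\xi_j$ is zero whenever $i\neq j$, and that the $\xi_i$ are mutually disjoint. Then the annuli, the bump functions and $N$ can be chosen such that, for all $k_i,l_i\ge N$, all conclusions of (1) hold with $\xi_j'=W_1^{k_1,l_1}\circ\dots\circ W_n^{k_n,l_n}(\xi_j)$ (all curves are wound simultaneously along every $\tau_i$), and in addition $\xi_1',\dots,\xi_n'$ are mutually disjoint. -/

import Mathlib

open Set Filter Topology Function
open scoped Manifold ContDiff

namespace Winding

/-- The parameter interval `[0,1]` of all curves. -/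
abbrev unitI : Set ℝ := Icc (0 : ℝ) 1

/-- Determinant of two plane vectors: positive iff `v` points to the left of `u`. -/
def cross (u v : EuclideanSpace ℝ (Fin 2)) : ℝ := u 0 * v 1 - u 1 * v 0

section Surface

variable {R : Type*} [TopologicalSpace R] [ChartedSpace (EuclideanHalfSpace 2) R]

/-! ### Orientations -/

/-- An orientation of a smooth surface with boundary: an oriented atlas, that is, a covering family
of smooth charts whose coordinate changes have positive Jacobian determinant. -/
structure SurfaceOrientation (R : Type*) [TopologicalSpace R]
    [ChartedSpace (EuclideanHalfSpace 2) R] where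
  charts : Set (OpenPartialHomeomorph R (EuclideanHalfSpace 2))
  charts_subset : charts ⊆ IsManifold.maximalAtlas (𝓡∂ 2) ∞ R
  cover : ∀ x : R, ∃ e ∈ charts, x ∈ e.source
  compat : ∀ e ∈ charts, ∀ e' ∈ charts, ∀ x ∈ e.source ∩ e'.source,
    0 < (fderivWithin ℝ (e'.extend (𝓡∂ 2) ∘ (e.extend (𝓡∂ 2)).symm) (range (𝓡∂ 2))
      (e.extend (𝓡∂ 2) x)).det

/-- A positively oriented coordinate system around `x`, with values in the plane. -/
noncomputable def SurfaceOrientation.coord (o : SurfaceOrientation R) (x : R) :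
    PartialEquiv R (EuclideanSpace ℝ (Fin 2)) :=
  (o.cover x).choose.extend (𝓡∂ 2)

/-! ### Curves

Circles and arcs are parametrized curves `γ : ℝ → R`. A circle is `1`-periodic; for an arc only
the restriction of `γ` to `[0,1]` matters. -/

/-- The point set of a curve (arc or circle). -/
def trace (γ : ℝ → R) : Set R := γ '' unitI

/-- Velocity of the curve `γ` at the parameter `s`, in the coordinate system `φ`. -/
noncomputable def velIn (φ : PartialEquiv R (EuclideanSpace ℝ (Fin 2))) (γ : ℝ → R) (s : ℝ) :
    EuclideanSpace ℝ (Fin 2) :=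
  derivWithin (φ ∘ γ) unitI s

/-- Nowhere vanishing velocity. -/
def IsImmersed (γ : ℝ → R) : Prop :=
  ∀ s ∈ unitI, velIn (extChartAt (𝓡∂ 2) (γ s)) γ s ≠ 0

/-- A smooth closed curve in the interior of the surface, possibly with self-intersections. -/
structure IsClosedCurve (γ : ℝ → R) : Prop where
  smooth : ContMDiff 𝓘(ℝ, ℝ) (𝓡∂ 2) ∞ γ
  periodic : ∀ s, γ (s + 1) = γ s
  interior : ∀ s, γ s ∈ (𝓡∂ 2).interior R

/-- A circle on the surface: a smoothly embedded closed curve in the interior. -/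
structure IsCircle (γ : ℝ → R) : Prop extends IsClosedCurve γ where
  injOn : InjOn γ (Ico 0 1)
  immersed : IsImmersed γ

/-- A properly embedded smooth arc: it meets the boundary exactly in its two endpoints. -/
structure IsProperArc (γ : ℝ → R) : Prop where
  smooth : ContMDiffOn 𝓘(ℝ, ℝ) (𝓡∂ 2) ∞ γ unitI
  injOn : InjOn γ unitI
  immersed : IsImmersed γ
  boundary_iff : ∀ s ∈ unitI, γ s ∈ (𝓡∂ 2).boundary R ↔ s = 0 ∨ s = 1

/-- A properly embedded curve: a circle in the interior or a properly embedded arc. -/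
def IsProperCurve (γ : ℝ → R) : Prop := IsCircle γ ∨ IsProperArc γ

/-- Two curves are transverse: wherever they meet, their velocities are linearly independent. -/
def Transverse (γ δ : ℝ → R) : Prop :=
  ∀ s ∈ unitI, ∀ t ∈ unitI, γ s = δ t →
    cross (velIn (extChartAt (𝓡∂ 2) (γ s)) γ s) (velIn (extChartAt (𝓡∂ 2) (γ s)) δ t) ≠ 0

/-- The two curves meet in a single point, transversely. -/
def MeetOnce (γ δ : ℝ → R) : Prop :=
  (∃ p, trace γ ∩ trace δ = {p}) ∧ Transverse γ δ

/-- A family of properly embedded, mutually transverse curves. -/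
structure IsCurveSystem {ι : Type*} (Γ : ι → ℝ → R) : Prop where
  proper : ∀ i, IsProperCurve (Γ i)
  transverse : ∀ i j, i ≠ j → Transverse (Γ i) (Γ j)

/-- The union of a family of curves. -/
def support {ι : Type*} (Γ : ι → ℝ → R) : Set R := ⋃ i, trace (Γ i)

/-! ### Algebraic intersection numbers -/

/-- The sign of an intersection `γ s = δ t` of two curves. -/
noncomputable def crossSign (o : SurfaceOrientation R) (γ δ : ℝ → R) (s t : ℝ) : ℤ :=
  (SignType.sign (cross (velIn (o.coord (γ s)) γ s) (velIn (o.coord (γ s)) δ t)) : ℤ)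

/-- The signed number of intersections of a closed curve `γ` with a transverse curve `δ`, each
intersection being counted as a pair of parameters. (The endpoint `δ 1` of an arc `δ` lies on the
boundary of the surface, hence not on `γ`.) -/
noncomputable def signedCount (o : SurfaceOrientation R) (γ δ : ℝ → R) : ℤ :=
  ∑ᶠ q ∈ {q : ℝ × ℝ | q.1 ∈ Ico (0 : ℝ) 1 ∧ q.2 ∈ Ico (0 : ℝ) 1 ∧ γ q.1 = δ q.2},
    crossSign o γ δ q.1 q.2

/-- Free homotopy of closed curves in the interior of the surface. -/
def FreelyHomotopic (γ γ' : ℝ → R) : Prop :=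
  ∃ H : ℝ → ℝ → R, Continuous (uncurry H) ∧ (∀ s, H 0 s = γ s) ∧ (∀ s, H 1 s = γ' s) ∧
    (∀ r s, H r (s + 1) = H r s) ∧ ∀ r s, H r s ∈ (𝓡∂ 2).interior R

/-- The algebraic intersection number of the closed curve `γ` with the properly embedded curve `δ`
is `k`: after moving `γ` by a homotopy into a closed curve transverse to `δ` (no motion is needed
if `γ` is transverse to `δ`), the signed number of intersections is `k`. -/
def HasIntersectionNumber (o : SurfaceOrientation R) (γ δ : ℝ → R) (k : ℤ) : Prop :=
  ∃ γ', IsClosedCurve γ' ∧ FreelyHomotopic γ γ' ∧ Transverse γ' δ ∧ signedCount o γ' δ = k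

/-! ### Relative periodic domains -/

/-- A relative domain of a family of curves with union `C`, given by its local multiplicities: a
function that is locally constant on the complement of `C`, that is, a linear combination of the
regions into which `C` divides the surface. Its values on `C` carry no information. Coefficients
are rational, which includes integral domains. -/
def IsRelativeDomain (C : Set R) (D : R → ℚ) : Prop :=
  ∀ x, x ∉ C → ∀ᶠ y in 𝓝 x, D y = D x

/-- The part of the boundary of `D` inside the surface is the linear combination `∑ c i • Γ i`:
at every interior point of `Γ i` which lies on no other curve of the family, the multiplicity on
the left of `Γ i` exceeds the multiplicity on the right by `c i`. -/
def HasBoundary {ι : Type*} (o : SurfaceOrientation R) (Γ : ι → ℝ → R) (D : R → ℚ)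
    (c : ι → ℚ) : Prop :=
  ∀ i, ∀ s ∈ unitI, Γ i s ∈ (𝓡∂ 2).interior R → (∀ j, j ≠ i → Γ i s ∉ trace (Γ j)) →
    ∀ u : EuclideanSpace ℝ (Fin 2), 0 < cross (velIn (o.coord (Γ i s)) (Γ i) s) u →
      ∀ᶠ r in 𝓝[>] (0 : ℝ),
        D ((o.coord (Γ i s)).symm (o.coord (Γ i s) (Γ i s) + r • u)) =
          D ((o.coord (Γ i s)).symm (o.coord (Γ i s) (Γ i s) - r • u)) + c i

/-- `D` avoids the basepoints `w`: the multiplicities of all regions near a basepoint vanish. -/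
def Avoids (C w : Set R) (D : R → ℚ) : Prop :=
  ∀ p ∈ w, ∀ᶠ y in 𝓝 p, y ∉ C → D y = 0

/-- `D` is a relative periodic domain of the family `Γ` with basepoints `w`, and
`∂D - ∂R = ∑ c i • Γ i`. -/
structure IsRelativePeriodicDomain {ι : Type*} (o : SurfaceOrientation R) (w : Set R)
    (Γ : ι → ℝ → R) (D : R → ℚ) (c : ι → ℚ) : Prop where
  domain : IsRelativeDomain (support Γ) D
  boundary : HasBoundary o Γ D c
  avoids : Avoids (support Γ) w D

/-- `D` has a positive and a negative local multiplicity. -/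
def HasBothSigns (C : Set R) (D : R → ℚ) : Prop :=
  (∃ x, x ∉ C ∧ 0 < D x) ∧ ∃ x, x ∉ C ∧ D x < 0

/-- All local multiplicities of `D` are nonnegative. -/
def IsNonnegative (C : Set R) (D : R → ℚ) : Prop := ∀ x, x ∉ C → 0 ≤ D x

/-! ### Winding -/

/-- A smooth bump of height one at level `a`, supported inside `(-1,1)`. -/
structure IsBump (b : ℝ → ℝ) (a : ℝ) : Prop where
  smooth : ContDiff ℝ ∞ b
  peak : b a = 1
  mono : MonotoneOn b (Iic a)
  anti : AntitoneOn b (Ici a)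
  tsupport_subset : tsupport b ⊆ Ioo (-1) 1

/-- An annular neighbourhood `S¹ × (-1,1)` of the circle `τ` inside `V`, in the interior of the
surface, with two disjoint closed subannuli, around the parallel copies of `τ` at the levels
`posLevel` and `negLevel`, which contain no point of `w`. Winding in the two directions will be
supported in these two subannuli. -/
structure WindingBand (τ : ℝ → R) (V w : Set R) where
  collar : ℝ → ℝ → R
  smooth : ContMDiffOn 𝓘(ℝ, ℝ × ℝ) (𝓡∂ 2) ∞ (uncurry collar) (univ ×ˢ Ioo (-1) 1)
  periodic : ∀ θ, ∀ t ∈ Ioo (-1 : ℝ) 1, collar (θ + 1) t = collar θ t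
  injOn : InjOn (uncurry collar) (Ico 0 1 ×ˢ Ioo (-1) 1)
  immersed : ∀ q : ℝ × ℝ, q.2 ∈ Ioo (-1 : ℝ) 1 →
    Injective (mfderiv 𝓘(ℝ, ℝ × ℝ) (𝓡∂ 2) (uncurry collar) q)
  core : ∀ θ, collar θ 0 = τ θ
  interior : ∀ θ, ∀ t ∈ Ioo (-1 : ℝ) 1, collar θ t ∈ (𝓡∂ 2).interior R
  subset : ∀ θ, ∀ t ∈ Ioo (-1 : ℝ) 1, collar θ t ∈ V
  posLevel : ℝ
  negLevel : ℝ
  posBump : ℝ → ℝ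
  negBump : ℝ → ℝ
  posBump_isBump : IsBump posBump posLevel
  negBump_isBump : IsBump negBump negLevel
  disjoint : Disjoint (tsupport posBump) (tsupport negBump)
  pos_avoids : ∀ θ, ∀ t ∈ tsupport posBump, collar θ t ∉ w
  neg_avoids : ∀ θ, ∀ t ∈ tsupport negBump, collar θ t ∉ w

open Classical in
/-- The self-map of the surface that rotates the circle at level `t` of an annulus by `ρ t` turns,
and fixes every point outside of the annulus. -/
noncomputable def rotate (collar : ℝ → ℝ → R) (ρ : ℝ → ℝ) (x : R) : R :=
  if h : ∃ q : ℝ × ℝ, q.2 ∈ Ioo (-1 : ℝ) 1 ∧ collar q.1 q.2 = x then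
    collar (h.choose.1 + ρ h.choose.2) h.choose.2
  else x

/-- Winding `k` times along one parallel copy of `τ` and `l` times along the other one in the
opposite direction. A curve `γ` is wound by passing to `B.wind k l ∘ γ`. -/
noncomputable def WindingBand.wind {τ : ℝ → R} {V w : Set R} (B : WindingBand τ V w) (k l : ℕ) :
    R → R :=
  rotate B.collar fun t => k * B.posBump t - l * B.negBump t

/-- Winding along several circles, one after the other. -/
noncomputable def windAll {n : ℕ} {τ : Fin n → ℝ → R} {V : Fin n → Set R} {w : Set R}
    (B : ∀ i, WindingBand (τ i) (V i) w) (k l : Fin n → ℕ) : R → R :=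
  (List.ofFn fun i => (B i).wind (k i) (l i)).foldr (· ∘ ·) id

end Surface

end Winding

/-! Every curve `γ` has a circle-valued dual: a real function `Φ` on the interior which is
continuous except for a unit jump across `γ`, and hence continuous modulo 1 (`exists_isPotential`).
Under `Φ` modulo 1 a closed curve goes around the circle as often as it crosses `γ` algebraically
(`hasTurn_signedCount`). So `τ i` turns `±1` times with respect to `ξ i`, and not at all with
respect to a curve with which it has intersection number zero. Along a path, the multiplicity of a
domain with boundary `∑ c i • Γ i` changes by the sum of `c i` times the jumps of `Φ i`. Each of
these jumps is the change of `Φ i` minus the change of a continuous lift of `Φ i` modulo 1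
(`domain_sub_eq`).

Fix a path in `U` from a point `y` near a basepoint, where domains vanish, to a point `q` on a
parallel copy of `τ i` at which the winding map rotates by `N` whole turns. The path misses the
curves `θ j`. A wound curve `W ∘ ξ j` has the potential `Φ j ∘ W⁻¹`, and `W⁻¹` fixes `y` and `q`.
The isotopy that undoes the winding drags `q` around the copy `N` times, so the lift along the path
changes by `N` times the number of turns of `τ i`. The result is `D q = ∑ c j * C j + N * (d i * c
i)` with `|d i| = 1`, where `C` depends neither on the domain nor on the amount of winding
(`exists_multiplicity_formula`). If `|c i|` is maximal and `|N|` exceeds `∑ |C j|`, the last term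
decides the sign. The two parallel copies have `N = k i` and `N = -l i` and produce opposite signs
(`exists_bound_hasBothSigns`). The comparison is homogeneous in `c`, so one bound serves all
domains.

Transversality is a matter of general position. The bumps are plateaus whose slopes have nonzero
derivative, so wherever the amount of winding is stationary the rotation is by whole turns and
changes neither points nor velocities. At the other levels tangencies are avoided by shifting the
bumps by a small `s`. The bad shifts form a null set by an argument in the style of Sard
(`volume_tangency`), and only countably many winding numbers and pairs of curves have to be
considered. The bands are chosen from the last index to the first, each generic with respect to
everything wound along later ones (`exists_windingBands`). The same bands serve both parts. In part
(2) all `ξ j` are moved by one diffeomorphism, so they remain transverse and disjoint, and general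
position is needed only against the `θ j`. -/

set_option linter.unusedSectionVars false

namespace Winding

/-! ### The plane -/

/-- The coordinate plane. -/
abbrev Plane := EuclideanSpace ℝ (Fin 2)

lemma cross_map (A : Plane →L[ℝ] Plane) (u v : Plane) :
    cross (A u) (A v) = A.det * cross u v := by
  have hd : A.det = LinearMap.det (A : Plane →ₗ[ℝ] Plane) := rfl
  set b := (EuclideanSpace.basisFun (Fin 2) ℝ).toBasis
  have hM : A.det = (LinearMap.toMatrix b b (A : Plane →ₗ[ℝ] Plane)).det := by
    rw [hd, LinearMap.det_toMatrix]
  have hu : ∀ w : Plane, w = w 0 • b 0 + w 1 • b 1 := by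
    intro w
    have := b.sum_repr w
    rw [Fin.sum_univ_two] at this
    rw [← this]
    simp [b]
  rw [hM, Matrix.det_fin_two]
  simp only [LinearMap.toMatrix_apply]
  have e0 : ∀ w : Plane, b.repr w 0 = w 0 := fun w => by simp [b]
  have e1 : ∀ w : Plane, b.repr w 1 = w 1 := fun w => by simp [b]
  simp only [e0, e1, ContinuousLinearMap.coe_coe]
  conv_lhs => rw [hu u, hu v]
  simp only [cross, map_add, map_smul, PiLp.add_apply, PiLp.smul_apply, smul_eq_mul]
  ring

lemma cross_add_right (u v w : Plane) : cross u (v + w) = cross u v + cross u w := by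
  simp [cross]; ring

lemma cross_add_left (u v w : Plane) : cross (u + v) w = cross u w + cross v w := by
  simp [cross]; ring

lemma cross_smul_right (u v : Plane) (a : ℝ) : cross u (a • v) = a * cross u v := by
  simp [cross]; ring

lemma cross_smul_left (u v : Plane) (a : ℝ) : cross (a • u) v = a * cross u v := by
  simp [cross]; ring

lemma cross_self (u : Plane) : cross u u = 0 := by unfold cross; ring

lemma cross_swap (u v : Plane) : cross u v = - cross v u := by unfold cross; ring

@[simp] lemma cross_zero_right (u : Plane) : cross u 0 = 0 := by simp [cross]

@[simp] lemma cross_zero_left (u : Plane) : cross 0 u = 0 := by simp [cross]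

lemma continuous_cross : Continuous fun p : Plane × Plane => cross p.1 p.2 := by
  unfold cross; fun_prop

/-- The rotation by a right angle. -/
noncomputable def rotLeft (u : Plane) : Plane := !₂[-u 1, u 0]

lemma cross_rotLeft_pos {u : Plane} (hu : u ≠ 0) : 0 < cross u (rotLeft u) := by
  have : u 0 ≠ 0 ∨ u 1 ≠ 0 := by
    by_contra! h
    exact hu (by ext i; fin_cases i <;> simp [h.1, h.2])
  simp only [cross, rotLeft]
  simp
  rcases this with h | h
  · nlinarith [mul_self_pos.2 h, mul_self_nonneg (u 1)]
  · nlinarith [mul_self_pos.2 h, mul_self_nonneg (u 0)]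

lemma eq_combination_of_cross {u v : Plane} (h : cross u v ≠ 0) (x : Plane) :
    x = (cross x v / cross u v) • u + (cross u x / cross u v) • v := by
  have h' : u 0 * v 1 - u 1 * v 0 ≠ 0 := h
  ext i
  fin_cases i
  · simp only [cross, PiLp.add_apply, PiLp.smul_apply, smul_eq_mul, Fin.zero_eta]
    rw [div_mul_eq_mul_div, div_mul_eq_mul_div, ← add_div, eq_div_iff h']
    ring
  · simp only [cross, PiLp.add_apply, PiLp.smul_apply, smul_eq_mul, Fin.mk_one]
    rw [div_mul_eq_mul_div, div_mul_eq_mul_div, ← add_div, eq_div_iff h']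
    ring

/-! ### Planar coordinates at interior points -/

section Coordinates

variable {R : Type*} [TopologicalSpace R] [ChartedSpace (EuclideanHalfSpace 2) R]

/-- `φ` is a smooth coordinate system around the interior point `x`. -/
def PlanarAt (φ : PartialEquiv R Plane) (x : R) : Prop :=
  ∃ e ∈ IsManifold.maximalAtlas (𝓡∂ 2) ∞ R, x ∈ e.source ∧ φ = e.extend (𝓡∂ 2) ∧
    x ∈ (𝓡∂ 2).interior R

/-- `φ` is a positively oriented coordinate system around the interior point `x`. -/
def OrientedAt (o : SurfaceOrientation R) (φ : PartialEquiv R Plane) (x : R) : Prop :=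
  ∃ e ∈ o.charts, x ∈ e.source ∧ φ = e.extend (𝓡∂ 2) ∧ x ∈ (𝓡∂ 2).interior R

lemma OrientedAt.planarAt {o : SurfaceOrientation R} {φ : PartialEquiv R Plane} {x : R}
    (h : OrientedAt o φ x) : PlanarAt φ x := by
  obtain ⟨e, he, h⟩ := h
  exact ⟨e, o.charts_subset he, h⟩

lemma orientedAt_coord (o : SurfaceOrientation R) {x : R} (hx : x ∈ (𝓡∂ 2).interior R) :
    OrientedAt o (o.coord x) x :=
  ⟨_, (o.cover x).choose_spec.1, (o.cover x).choose_spec.2, rfl, hx⟩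

namespace PlanarAt

variable {φ ψ : PartialEquiv R Plane} {x : R}

lemma interior (h : PlanarAt φ x) : x ∈ (𝓡∂ 2).interior R := h.choose_spec.2.2.2

lemma mem_source (h : PlanarAt φ x) : x ∈ φ.source := by
  obtain ⟨e, he, hx, rfl, hi⟩ := h
  simpa using hx

lemma isOpen_source (h : PlanarAt φ x) : IsOpen φ.source := by
  obtain ⟨e, he, hx, rfl, hi⟩ := h
  exact e.isOpen_extend_source

lemma source_mem_nhds (h : PlanarAt φ x) : φ.source ∈ 𝓝 x := h.isOpen_source.mem_nhds h.mem_source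

lemma left_inv (h : PlanarAt φ x) : φ.symm (φ x) = x := φ.left_inv h.mem_source

lemma contMDiffAt (h : PlanarAt φ x) : ContMDiffAt (𝓡∂ 2) 𝓘(ℝ, Plane) ∞ φ x := by
  obtain ⟨e, he, hx, rfl, hi⟩ := h
  exact e.contMDiffAt_extend he hx

lemma continuousAt (h : PlanarAt φ x) : ContinuousAt φ x := h.contMDiffAt.continuousAt

lemma contDiffAt_comp {F : Type*} [NormedAddCommGroup F] [NormedSpace ℝ F] {c : F → R} {p : F}
    {n : WithTop ℕ∞} (hn : n ≤ ∞)
    (h : PlanarAt φ (c p)) (hc : ContMDiffAt 𝓘(ℝ, F) (𝓡∂ 2) n c p) : ContDiffAt ℝ n (φ ∘ c) p := by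
  rw [← contMDiffAt_iff_contDiffAt]
  exact ContMDiffAt.comp _ (I' := 𝓡∂ 2) (h.contMDiffAt.of_le hn) hc

variable [IsManifold (𝓡∂ 2) ∞ R]

/-- Interior points are defined by the preferred chart. A coordinate change has invertible
derivative and values in the closed half-plane, so it cannot send an interior point to the boundary
line. This makes every chart of the maximal atlas usable as a planar chart. -/
lemma target_mem_nhds (h : PlanarAt φ x) : φ.target ∈ 𝓝 (φ x) := by
  obtain ⟨e, he, hx, rfl, hi⟩ := h
  suffices e.extend (𝓡∂ 2) x ∈ _root_.interior (e.extend (𝓡∂ 2)).target from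
    mem_interior_iff_mem_nhds.1 this
  let e0 := chartAt (EuclideanHalfSpace 2) x
  have he0 : e0 ∈ IsManifold.maximalAtlas (𝓡∂ 2) ∞ R := IsManifold.chart_mem_maximalAtlas x
  have hx0 : x ∈ e0.source := mem_chart_source _ x
  have hi0 : e0.extend (𝓡∂ 2) x ∈ _root_.interior (e0.extend (𝓡∂ 2)).target :=
    e0.mem_interior_extend_target (by simp [hx0]) hi
  let F := (𝓡∂ 2).extendCoordChange e0 e
  have hF : ContDiffOn ℝ ∞ F F.source := (𝓡∂ 2).contDiffOn_extendCoordChange he0 he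
  have hFx : F.source ∈ 𝓝 (e0.extend (𝓡∂ 2) x) := by
    simp_rw [F, ModelWithCorners.extendCoordChange, PartialEquiv.trans_source,
      PartialEquiv.symm_source, Filter.inter_mem_iff, mem_interior_iff_mem_nhds.1 hi0, true_and,
      e.extend_source]
    exact e0.extend_preimage_mem_nhds hx0 <| e.open_source.mem_nhds hx
  have hmem : e0.extend (𝓡∂ 2) x ∈ F.source := mem_of_mem_nhds hFx
  have hsurj := ((𝓡∂ 2).isInvertible_fderivWithin_extendCoordChange (by simp) he0 he
    hmem).surjective
  have hsurj' : Surjective (fderiv ℝ F (e0.extend (𝓡∂ 2) x)) := by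
    rw [← fderivWithin_of_mem_nhds hFx]
    exact hsurj
  refine e.mem_interior_extend_target (by simp [hx]) ?_
  have hd : DifferentiableAt ℝ F (e0.extend (𝓡∂ 2) x) :=
    (hF.differentiableOn (by simp)).differentiableAt hFx
  have := hd.mem_interior_convex_of_surjective_fderiv hFx (𝓡∂ 2).convex_range
    (𝓡∂ 2).isClosed_range (𝓡∂ 2).nonempty_interior
    (F.mapsTo.mono_right <| by simp [F, ModelWithCorners.extendCoordChange, inter_assoc]) hsurj'
  have hl : (e0.extend (𝓡∂ 2)).symm (e0.extend (𝓡∂ 2) x) = x := e0.extend_left_inv hx0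
  have hFe : F (e0.extend (𝓡∂ 2) x) = e.extend (𝓡∂ 2) x := by
    change e.extend (𝓡∂ 2) ((e0.extend (𝓡∂ 2)).symm (e0.extend (𝓡∂ 2) x)) = _
    rw [hl]
  rwa [hFe] at this

lemma eventually_planarAt (h : PlanarAt φ x) : ∀ᶠ y in 𝓝 x, PlanarAt φ y := by
  obtain ⟨e, he, hx, rfl, hi⟩ := h
  filter_upwards [e.open_source.mem_nhds hx,
    ((𝓡∂ 2).isOpen_interior (M := R) (n := ∞) (by simp)).mem_nhds hi] with y h1 h2
  exact ⟨e, he, h1, rfl, h2⟩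

lemma symm_contMDiffAt (h : PlanarAt φ x) : ContMDiffAt 𝓘(ℝ, Plane) (𝓡∂ 2) ∞ φ.symm (φ x) := by
  have ht := h.target_mem_nhds
  obtain ⟨e, he, hx, rfl, hi⟩ := h
  rw [e.extend_target'] at ht
  exact (contMDiffOn_extend_symm he).contMDiffAt ht

lemma symm_continuousAt (h : PlanarAt φ x) : ContinuousAt φ.symm (φ x) :=
  h.symm_contMDiffAt.continuousAt

lemma tendsto_symm (h : PlanarAt φ x) : Tendsto φ.symm (𝓝 (φ x)) (𝓝 x) := by
  have := h.symm_continuousAt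
  rwa [ContinuousAt, h.left_inv] at this

lemma eventually_symm (h : PlanarAt φ x) :
    ∀ᶠ p in 𝓝 (φ x), φ (φ.symm p) = p ∧ PlanarAt φ (φ.symm p) := by
  filter_upwards [h.target_mem_nhds, h.tendsto_symm.eventually h.eventually_planarAt] with p h1 h2
  exact ⟨φ.right_inv h1, h2⟩

/-- A smooth map, read in planar coordinates. -/
lemma contDiffAt_read {W : R → R} {n : WithTop ℕ∞} (hn : n ≤ ∞) (h : PlanarAt φ x)
    (h' : PlanarAt ψ (W x)) (hW : ContMDiffAt (𝓡∂ 2) (𝓡∂ 2) n W x) :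
    ContDiffAt ℝ n (ψ ∘ W ∘ φ.symm) (φ x) := by
  rw [← contMDiffAt_iff_contDiffAt]
  refine ContMDiffAt.comp _ (I' := 𝓡∂ 2) ?_ ?_
  · have := h'.contMDiffAt.of_le hn
    simpa [h.left_inv] using this
  · refine ContMDiffAt.comp _ (I' := 𝓡∂ 2) ?_ (h.symm_contMDiffAt.of_le hn)
    rwa [h.left_inv]

lemma contDiffAt_change (h : PlanarAt φ x) (h' : PlanarAt ψ x) :
    ContDiffAt ℝ ∞ (ψ ∘ φ.symm) (φ x) :=
  contDiffAt_read (W := id) le_rfl h h' contMDiffAt_id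

lemma fderiv_change_comp {φ₁ φ₂ φ₃ : PartialEquiv R Plane} {W₁ W₂ : R → R}
    (h1 : PlanarAt φ₁ x) (h2 : PlanarAt φ₂ (W₁ x)) (h3 : PlanarAt φ₃ (W₂ (W₁ x)))
    (hW₁ : ContMDiffAt (𝓡∂ 2) (𝓡∂ 2) ∞ W₁ x) (hW₂ : ContMDiffAt (𝓡∂ 2) (𝓡∂ 2) ∞ W₂ (W₁ x)) :
    fderiv ℝ (φ₃ ∘ (W₂ ∘ W₁) ∘ φ₁.symm) (φ₁ x) =
      (fderiv ℝ (φ₃ ∘ W₂ ∘ φ₂.symm) (φ₂ (W₁ x))).comp (fderiv ℝ (φ₂ ∘ W₁ ∘ φ₁.symm) (φ₁ x)) := by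
  have e1 : (φ₂ ∘ W₁ ∘ φ₁.symm) (φ₁ x) = φ₂ (W₁ x) := by simp [h1.left_inv]
  have d1 := (contDiffAt_read le_rfl h1 h2 hW₁).differentiableAt (by simp)
  have d2 := (contDiffAt_read le_rfl h2 h3 hW₂).differentiableAt (by simp)
  rw [← e1, ← fderiv_comp _ (by rw [e1]; exact d2) d1]
  apply Filter.EventuallyEq.fderiv_eq
  have : Tendsto (fun p => W₁ (φ₁.symm p)) (𝓝 (φ₁ x)) (𝓝 (W₁ x)) :=
    hW₁.continuousAt.tendsto.comp h1.tendsto_symm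
  filter_upwards [this h2.source_mem_nhds] with p hp
  have hp' : φ₂.symm (φ₂ (W₁ (φ₁.symm p))) = W₁ (φ₁.symm p) := φ₂.left_inv hp
  simp [hp']

lemma deriv_read {W : R → R} {γ : ℝ → R} {s : ℝ} (h : PlanarAt φ (γ s)) (h' : PlanarAt ψ (W (γ s)))
    (hW : ContMDiffAt (𝓡∂ 2) (𝓡∂ 2) ∞ W (γ s)) (hγ : ContMDiffAt 𝓘(ℝ, ℝ) (𝓡∂ 2) ∞ γ s) :
    deriv (ψ ∘ W ∘ γ) s = fderiv ℝ (ψ ∘ W ∘ φ.symm) (φ (γ s)) (deriv (φ ∘ γ) s) := by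
  have d1 := (contDiffAt_read le_rfl h h' hW).differentiableAt (by simp)
  have d2 := (h.contDiffAt_comp le_rfl hγ).differentiableAt (by simp)
  have := fderiv_comp_deriv s (f := φ ∘ γ) (l := ψ ∘ W ∘ φ.symm) d1 d2
  rw [show φ (γ s) = (φ ∘ γ) s from rfl, ← this]
  apply Filter.EventuallyEq.deriv_eq
  filter_upwards [hγ.continuousAt h.source_mem_nhds] with p hp
  have hp' : φ.symm (φ (γ p)) = γ p := φ.left_inv hp
  simp [hp']

lemma deriv_change {γ : ℝ → R} {s : ℝ} (h : PlanarAt φ (γ s)) (h' : PlanarAt ψ (γ s))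
    (hγ : ContMDiffAt 𝓘(ℝ, ℝ) (𝓡∂ 2) ∞ γ s) :
    deriv (ψ ∘ γ) s = fderiv ℝ (ψ ∘ φ.symm) (φ (γ s)) (deriv (φ ∘ γ) s) :=
  deriv_read (W := id) h h' contMDiffAt_id hγ

/-- The two coordinate changes are mutually inverse, so their determinants have product 1. -/
lemma det_change_ne_zero (h : PlanarAt φ x) (h' : PlanarAt ψ x) :
    (fderiv ℝ (ψ ∘ φ.symm) (φ x)).det ≠ 0 := by
  have := fderiv_change_comp (W₁ := id) (W₂ := id) h h' h contMDiffAt_id contMDiffAt_id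
  have h2 : fderiv ℝ (φ ∘ (id ∘ id) ∘ φ.symm) (φ x) = ContinuousLinearMap.id ℝ Plane := by
    rw [← fderiv_id (x := φ x)]
    apply Filter.EventuallyEq.fderiv_eq
    filter_upwards [h.target_mem_nhds] with p hp using φ.right_inv hp
  rw [h2] at this
  have h3 := congrArg ContinuousLinearMap.det this
  have h4 : ((fderiv ℝ (φ ∘ id ∘ ψ.symm) (ψ (id x))).comp
    (fderiv ℝ (ψ ∘ id ∘ φ.symm) (φ x))).det = (fderiv ℝ (φ ∘ id ∘ ψ.symm) (ψ (id x))).det *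
      (fderiv ℝ (ψ ∘ id ∘ φ.symm) (φ x)).det := LinearMap.det_comp _ _
  rw [h4] at h3
  have h5 : (ContinuousLinearMap.id ℝ Plane).det = 1 := LinearMap.det_id
  rw [h5] at h3
  intro h0
  change (fderiv ℝ (ψ ∘ id ∘ φ.symm) (φ x)).det = 0 at h0
  rw [h0] at h3
  simp at h3

end PlanarAt

lemma det_comp (A B : Plane →L[ℝ] Plane) : (A.comp B).det = A.det * B.det := LinearMap.det_comp _ _

/-! ### Oriented coordinate changes and orientation preserving maps. -/

variable [IsManifold (𝓡∂ 2) ∞ R]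

lemma planarAt_extChartAt {x : R} (hx : x ∈ (𝓡∂ 2).interior R) :
    PlanarAt (extChartAt (𝓡∂ 2) x) x :=
  ⟨chartAt _ x, IsManifold.chart_mem_maximalAtlas x, mem_chart_source _ x, rfl, hx⟩

lemma OrientedAt.eventually_orientedAt {o : SurfaceOrientation R} {φ : PartialEquiv R Plane} {x : R}
    (h : OrientedAt o φ x) : ∀ᶠ y in 𝓝 x, OrientedAt o φ y := by
  obtain ⟨e, he, hx, rfl, hi⟩ := h
  filter_upwards [e.open_source.mem_nhds hx,
    ((𝓡∂ 2).isOpen_interior (M := R) (n := ∞) (by simp)).mem_nhds hi] with y h1 h2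
  exact ⟨e, he, h1, rfl, h2⟩

lemma OrientedAt.det_change_pos {o : SurfaceOrientation R} {φ ψ : PartialEquiv R Plane} {x : R}
    (h : OrientedAt o φ x) (h' : OrientedAt o ψ x) :
    0 < (fderiv ℝ (ψ ∘ φ.symm) (φ x)).det := by
  have ht := h.planarAt.target_mem_nhds
  obtain ⟨e, he, hx, rfl, hi⟩ := h
  obtain ⟨e', he', hx', rfl, hi'⟩ := h'
  have := o.compat e he e' he' x ⟨hx, hx'⟩
  rwa [fderivWithin_of_mem_nhds] at this
  exact mem_of_superset ht e.extend_target_subset_range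

/-- The surface map `W` preserves the orientation at the interior point `x`. -/
def PreservesAt (o : SurfaceOrientation R) (W : R → R) (x : R) : Prop :=
  W x ∈ (𝓡∂ 2).interior R ∧ ContMDiffAt (𝓡∂ 2) (𝓡∂ 2) ∞ W x ∧
    ∀ φ ψ, OrientedAt o φ x → OrientedAt o ψ (W x) → 0 < (fderiv ℝ (ψ ∘ W ∘ φ.symm) (φ x)).det

/-- Another pair of oriented charts multiplies the Jacobian by two positive determinants, so one
pair suffices. -/
lemma PreservesAt.of_exists {o : SurfaceOrientation R} {W : R → R} {x : R}
    (hWx : W x ∈ (𝓡∂ 2).interior R) (hW : ContMDiffAt (𝓡∂ 2) (𝓡∂ 2) ∞ W x)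
    {φ ψ : PartialEquiv R Plane} (hφ : OrientedAt o φ x) (hψ : OrientedAt o ψ (W x))
    (h : 0 < (fderiv ℝ (ψ ∘ W ∘ φ.symm) (φ x)).det) : PreservesAt o W x := by
  refine ⟨hWx, hW, fun φ' ψ' hφ' hψ' => ?_⟩
  have e1 := PlanarAt.fderiv_change_comp (W₁ := id) (W₂ := W) hφ'.planarAt hφ.planarAt hψ.planarAt
    contMDiffAt_id hW
  have e2 := PlanarAt.fderiv_change_comp (W₁ := W ∘ id) (W₂ := id) hφ'.planarAt hψ.planarAt
    hψ'.planarAt hW contMDiffAt_id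
  have e3 := congrArg ContinuousLinearMap.det e2
  rw [e1, det_comp, det_comp] at e3
  change (fderiv ℝ (ψ' ∘ W ∘ φ'.symm) (φ' x)).det = _ at e3
  rw [e3]
  exact mul_pos (hψ.det_change_pos hψ') (mul_pos h (hφ'.det_change_pos hφ))

lemma preservesAt_id (o : SurfaceOrientation R) {x : R} (hx : x ∈ (𝓡∂ 2).interior R) :
    PreservesAt o id x :=
  ⟨hx, contMDiffAt_id, fun _ _ h h' => h.det_change_pos h'⟩

lemma PreservesAt.comp {o : SurfaceOrientation R} {W₁ W₂ : R → R} {x : R}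
    (h₂ : PreservesAt o W₂ (W₁ x)) (h₁ : PreservesAt o W₁ x) : PreservesAt o (W₂ ∘ W₁) x := by
  refine ⟨h₂.1, h₂.2.1.comp x h₁.2.1, fun φ ψ hφ hψ => ?_⟩
  have hm := orientedAt_coord o h₁.1
  rw [PlanarAt.fderiv_change_comp hφ.planarAt hm.planarAt hψ.planarAt h₁.2.1 h₂.2.1, det_comp]
  exact mul_pos (h₂.2.2 _ _ hm hψ) (h₁.2.2 _ _ hφ hm)

lemma PreservesAt.congr {o : SurfaceOrientation R} {W W' : R → R} {x : R}
    (h : PreservesAt o W x) (hW : W' =ᶠ[𝓝 x] W) (hx : x ∈ (𝓡∂ 2).interior R) :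
    PreservesAt o W' x := by
  have he : W' x = W x := hW.eq_of_nhds
  refine PreservesAt.of_exists (he ▸ h.1) (h.2.1.congr_of_eventuallyEq hW)
    (orientedAt_coord o hx) (he ▸ orientedAt_coord o h.1) ?_
  have := h.2.2 _ _ (orientedAt_coord o hx) (orientedAt_coord o h.1)
  convert this using 2
  apply Filter.EventuallyEq.fderiv_eq
  have hh := (orientedAt_coord o hx).planarAt
  filter_upwards [hh.tendsto_symm.eventually hW] with p hp
  simp [hp, he]

end Coordinates

end Winding

namespace Winding

/-! ### Lifting circle valued maps -/

lemma eq_of_continuous_of_int {A : Type*} [TopologicalSpace A] [PreconnectedSpace A] {f : A → ℝ}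
    (hf : Continuous f) (hi : ∀ a, ∃ n : ℤ, f a = n) (a b : A) : f a = f b := by
  have : IsLocallyConstant f := by
    rw [IsLocallyConstant.iff_eventually_eq]
    intro x
    have := hf.continuousAt.eventually (Metric.ball_mem_nhds (f x) one_pos)
    filter_upwards [this] with y hy
    obtain ⟨n, hn⟩ := hi y
    obtain ⟨m, hm⟩ := hi x
    rw [Real.dist_eq, abs_lt, hn, hm] at hy
    rw [hn, hm]
    have h1 : (n : ℝ) < m + 1 := by linarith [hy.2]
    have h2 : (m : ℝ) < n + 1 := by linarith [hy.1]
    have h3 : n < m + 1 := by exact_mod_cast h1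
    have h4 : m < n + 1 := by exact_mod_cast h2
    rw [show n = m by omega]
  exact this.apply_eq_of_isPreconnected isPreconnected_univ (mem_univ a) (mem_univ b)

lemma coe_addCircle_eq_iff {x y : ℝ} :
    (x : AddCircle (1 : ℝ)) = y ↔ ∃ n : ℤ, x - y = n := by
  rw [← sub_eq_zero, ← AddCircle.coe_sub, AddCircle.coe_eq_zero_iff]
  simp [eq_comm]

/-- The lifting criterion for the covering `ℝ → ℝ/ℤ`. It is needed for paths and for homotopies,
with `A = ℝ` and `A = ℝ × ℝ`. -/
lemma exists_lift {A : Type*} [TopologicalSpace A] [SimplyConnectedSpace A]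
    [LocallyPathConnectedSpace A] {f : A → AddCircle (1 : ℝ)} (hf : Continuous f) :
    ∃ L : A → ℝ, Continuous L ∧ ∀ a, (L a : AddCircle (1 : ℝ)) = f a := by
  obtain ⟨a₀⟩ : Nonempty A := inferInstance
  obtain ⟨e₀, he₀⟩ := QuotientAddGroup.mk_surjective (f a₀)
  obtain ⟨F, ⟨-, hF⟩, -⟩ := (AddCircle.isCoveringMap_coe (1 : ℝ)).existsUnique_continuousMap_lifts
    ⟨f, hf⟩ a₀ e₀ he₀
  exact ⟨F, F.continuous, fun a => congrFun hF a⟩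

/-- The difference of two lifts is continuous and integer-valued. -/
lemma lift_sub_eq {A : Type*} [TopologicalSpace A] [PreconnectedSpace A] {L L' : A → ℝ}
    (hL : Continuous L) (hL' : Continuous L')
    (h : ∀ a, (L a : AddCircle (1 : ℝ)) = L' a) (a b : A) : L a - L' a = L b - L' b :=
  eq_of_continuous_of_int (f := fun a => L a - L' a) (hL.sub hL')
    (fun a => coe_addCircle_eq_iff.1 (h a)) a b

/-- A continuous path in the circle makes `m` turns on `[0,1]`. -/
def HasTurn (f : ℝ → AddCircle (1 : ℝ)) (m : ℝ) : Prop :=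
  ∃ L : ℝ → ℝ, Continuous L ∧ (∀ s, (L s : AddCircle (1 : ℝ)) = f s) ∧ L 1 - L 0 = m

lemma exists_hasTurn {f : ℝ → AddCircle (1 : ℝ)} (hf : Continuous f) : ∃ m, HasTurn f m := by
  obtain ⟨L, h1, h2⟩ := exists_lift hf
  exact ⟨_, L, h1, h2, rfl⟩

lemma HasTurn.unique {f : ℝ → AddCircle (1 : ℝ)} {m m' : ℝ} (h : HasTurn f m) (h' : HasTurn f m') :
    m = m' := by
  obtain ⟨L, h1, h2, rfl⟩ := h
  obtain ⟨L', h1', h2', rfl⟩ := h'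
  have := lift_sub_eq h1 h1' (fun a => (h2 a).trans (h2' a).symm) 0 1
  linarith

lemma hasTurn_const (c : AddCircle (1 : ℝ)) : HasTurn (fun _ => c) 0 := by
  obtain ⟨e, he⟩ := QuotientAddGroup.mk_surjective c
  exact ⟨fun _ => e, continuous_const, fun _ => he, by simp⟩

/-- The turns along the two ways around a square agree. -/
lemma hasTurn_square {f : ℝ × ℝ → AddCircle (1 : ℝ)} (hf : Continuous f) {m₁ m₂ m₃ m₄ : ℝ}
    (h₁ : HasTurn (fun s => f (s, 0)) m₁) (h₂ : HasTurn (fun s => f (1, s)) m₂)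
    (h₃ : HasTurn (fun s => f (0, s)) m₃) (h₄ : HasTurn (fun s => f (s, 1)) m₄) :
    m₁ + m₂ = m₃ + m₄ := by
  obtain ⟨L, hL, hLf⟩ := exists_lift hf
  have e1 := h₁.unique ⟨fun s => L (s, 0), by fun_prop, fun s => hLf _, rfl⟩
  have e2 := h₂.unique ⟨fun s => L (1, s), by fun_prop, fun s => hLf _, rfl⟩
  have e3 := h₃.unique ⟨fun s => L (0, s), by fun_prop, fun s => hLf _, rfl⟩
  have e4 := h₄.unique ⟨fun s => L (s, 1), by fun_prop, fun s => hLf _, rfl⟩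
  linarith

/-- The number of turns of a loop is invariant under free homotopy. -/
lemma hasTurn_homotopy {f : ℝ × ℝ → AddCircle (1 : ℝ)} (hf : Continuous f)
    (hp : ∀ r s, f (r, s + 1) = f (r, s)) {m : ℝ} {r r' : ℝ} (h : HasTurn (fun s => f (r, s)) m) :
    HasTurn (fun s => f (r', s)) m := by
  obtain ⟨L, hL, hLf⟩ := exists_lift hf
  have e1 := h.unique ⟨fun s => L (r, s), by fun_prop, fun s => hLf _, rfl⟩
  refine ⟨fun s => L (r', s), by fun_prop, fun s => hLf _, ?_⟩
  rw [e1]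
  have := lift_sub_eq (A := ℝ) (L := fun x => L (x, 1)) (L' := fun x => L (x, 0)) (by fun_prop)
    (by fun_prop) (fun x => by
      rw [hLf, hLf]
      simpa using hp x 0) r' r
  exact this

/-- A lift of a loop satisfies `L (s + 1) = L s + m`. The path in question runs from `a` to `a + k`;
negative `k` reverses it. -/
lemma HasTurn.multiple {f : ℝ → AddCircle (1 : ℝ)} (hp : ∀ s, f (s + 1) = f s) {m : ℝ}
    (h : HasTurn f m) (a : ℝ) (k : ℤ) : HasTurn (fun s => f (a + k * s)) (k * m) := by
  obtain ⟨L, hL, hLf, rfl⟩ := h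
  have h1 : ∀ s, L (s + 1) = L s + (L 1 - L 0) := by
    intro s
    have := lift_sub_eq (A := ℝ) (L := fun x => L (x + 1)) (L' := fun x => L x) (by fun_prop)
      (by fun_prop) (fun x => by rw [hLf, hLf, hp]) s 0
    simp only [zero_add] at this
    linarith
  have h2 : ∀ k : ℤ, L (a + k) = L a + k * (L 1 - L 0) := by
    intro k
    induction k using Int.induction_on with
    | zero => simp
    | succ i ih =>
      push_cast at ih ⊢
      rw [← add_assoc, h1, ih]; ring
    | pred i ih =>
      have := h1 (a + ((-(i : ℤ) - 1 : ℤ) : ℝ))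
      rw [show a + ((-(i : ℤ) - 1 : ℤ) : ℝ) + 1 = a + ((-(i : ℤ) : ℤ) : ℝ) by push_cast; ring,
        ih] at this
      push_cast at this ⊢
      linarith
  refine ⟨fun s => L (a + k * s), by fun_prop, fun s => hLf _, ?_⟩
  simp only [mul_one, mul_zero, add_zero, h2]
  ring

end Winding

namespace Winding

variable {R : Type*} [TopologicalSpace R] [ChartedSpace (EuclideanHalfSpace 2) R]

/-! ### Parameters of curves -/

/-- A parameter of a properly embedded curve that belongs to an interior point. -/
def GoodParam (γ : ℝ → R) (s : ℝ) : Prop := IsCircle γ ∨ (IsProperArc γ ∧ s ∈ Ioo (0 : ℝ) 1)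

lemma unitI_uniqueDiff : UniqueDiffOn ℝ unitI := uniqueDiffOn_Icc one_pos

lemma IsCircle.exists_int {γ : ℝ → R} (h : IsCircle γ) {s t : ℝ} (hst : γ s = γ t) :
    ∃ n : ℤ, s - t = n := by
  have hp : Function.Periodic γ 1 := h.periodic
  have hf : ∀ x, γ (Int.fract x) = γ x := fun x => by
    rw [Int.fract]
    simpa using hp.sub_int_mul_eq ⌊x⌋ (x := x)
  have : Int.fract s = Int.fract t := h.injOn ⟨Int.fract_nonneg s, Int.fract_lt_one s⟩
    ⟨Int.fract_nonneg t, Int.fract_lt_one t⟩ (by rw [hf, hf, hst])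
  obtain ⟨n, hn⟩ := Int.fract_eq_fract.1 this
  exact ⟨n, hn⟩

lemma IsClosedCurve.add_int {γ : ℝ → R} (h : IsClosedCurve γ) (s : ℝ) (n : ℤ) :
    γ (s + n) = γ s := by
  have hp : Function.Periodic γ 1 := h.periodic
  simpa using hp.int_mul n s

lemma IsClosedCurve.mem_trace {γ : ℝ → R} (h : IsClosedCurve γ) (s : ℝ) : γ s ∈ trace γ := by
  refine ⟨Int.fract s, ⟨Int.fract_nonneg s, (Int.fract_lt_one s).le⟩, ?_⟩
  have := h.add_int (Int.fract s) ⌊s⌋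
  rwa [Int.fract_add_floor, eq_comm] at this

lemma IsClosedCurve.exists_mem {γ : ℝ → R} (h : IsClosedCurve γ) {y : R} (hy : y ∈ trace γ)
    (a : ℝ) : ∃ s ∈ Ico a (a + 1), γ s = y := by
  obtain ⟨s, -, rfl⟩ := hy
  have hp : Function.Periodic γ 1 := h.periodic
  obtain ⟨t, ht, hts⟩ := hp.exists_mem_Ico one_pos s a
  exact ⟨t, ht, hts.symm⟩

lemma isCompact_trace {γ : ℝ → R} (h : IsProperCurve γ) : IsCompact (trace γ) := by
  refine isCompact_Icc.image_of_continuousOn ?_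
  rcases h with h | h
  · exact h.smooth.continuous.continuousOn
  · exact h.smooth.continuousOn

lemma goodParam_of_mem {γ : ℝ → R} (h : IsProperCurve γ) {s : ℝ} (hs : s ∈ unitI)
    (hi : γ s ∈ (𝓡∂ 2).interior R) : GoodParam γ s := by
  rcases h with h | h
  · exact Or.inl h
  · refine Or.inr ⟨h, ?_⟩
    have h0 : ¬ (s = 0 ∨ s = 1) := by
      rw [← h.boundary_iff s hs, ← (𝓡∂ 2).compl_interior]
      exact fun h => h hi
    push Not at h0
    exact ⟨lt_of_le_of_ne hs.1 (Ne.symm h0.1), lt_of_le_of_ne hs.2 h0.2⟩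

lemma IsProperCurve.contMDiffOn {γ : ℝ → R} (h : IsProperCurve γ) :
    ContMDiffOn 𝓘(ℝ, ℝ) (𝓡∂ 2) ∞ γ unitI := by
  rcases h with h | h
  · exact h.smooth.contMDiffOn
  · exact h.smooth

lemma IsProperCurve.immersed {γ : ℝ → R} (h : IsProperCurve γ) : IsImmersed γ := by
  rcases h with h | h
  · exact h.immersed
  · exact h.immersed

namespace GoodParam

variable {γ : ℝ → R} {s : ℝ}

lemma proper (h : GoodParam γ s) : IsProperCurve γ := h.imp id fun h => h.1

lemma contMDiffAt (h : GoodParam γ s) : ContMDiffAt 𝓘(ℝ, ℝ) (𝓡∂ 2) ∞ γ s := by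
  rcases h with h | ⟨h, hs⟩
  · exact h.smooth s
  · exact h.smooth.contMDiffAt (Icc_mem_nhds hs.1 hs.2)

lemma mem_trace (h : GoodParam γ s) : γ s ∈ trace γ := by
  rcases h with h | ⟨h, hs⟩
  · exact h.mem_trace s
  · exact ⟨s, ⟨hs.1.le, hs.2.le⟩, rfl⟩

lemma interior (h : GoodParam γ s) : γ s ∈ (𝓡∂ 2).interior R := by
  rcases h with h | ⟨h, hs⟩
  · exact h.interior s
  · have := h.boundary_iff s ⟨hs.1.le, hs.2.le⟩
    rw [← (𝓡∂ 2).compl_boundary, mem_compl_iff, this]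
    rintro (h | h)
    · exact hs.1.ne' h
    · exact hs.2.ne h

lemma eventually_goodParam (h : GoodParam γ s) : ∀ᶠ t in 𝓝 s, GoodParam γ t := by
  rcases h with h | ⟨h, hs⟩
  · exact Eventually.of_forall fun _ => Or.inl h
  · filter_upwards [isOpen_Ioo.mem_nhds hs] with t ht using Or.inr ⟨h, ht⟩

lemma velIn_eq {φ : PartialEquiv R Plane} (hs : s ∈ unitI)
    (hγ : ContMDiffAt 𝓘(ℝ, ℝ) (𝓡∂ 2) ∞ γ s) (hφ : PlanarAt φ (γ s)) :
    velIn φ γ s = deriv (φ ∘ γ) s :=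
  ((hφ.contDiffAt_comp le_rfl hγ).differentiableAt (by simp)).derivWithin
    (unitI_uniqueDiff s hs)

/-- An embedded curve has one velocity at each of its points, since two parameters of the same point
coincide or differ by a period. -/
lemma deriv_eq (h : GoodParam γ s) {t : ℝ} (ht : GoodParam γ t) (hst : γ s = γ t)
    (φ : PartialEquiv R Plane) : deriv (φ ∘ γ) s = deriv (φ ∘ γ) t := by
  rcases h with h | ⟨h, hs⟩
  · obtain ⟨n, hn⟩ := h.exists_int hst
    have : s = t + n := by linarith
    have he : φ ∘ γ = fun x => (φ ∘ γ) (x + n) := by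
      ext1 x
      simp [h.add_int x n]
    rw [this]
    conv_rhs => rw [he]
    rw [deriv_comp_add_const]
  · rcases ht with ht | ⟨-, ht⟩
    · obtain ⟨n, hn⟩ := ht.exists_int hst
      have : s = t + n := by linarith
      have he : φ ∘ γ = fun x => (φ ∘ γ) (x + n) := by
        ext1 x
        simp [ht.add_int x n]
      rw [this]
      conv_rhs => rw [he]
      rw [deriv_comp_add_const]
    · rw [h.injOn ⟨hs.1.le, hs.2.le⟩ ⟨ht.1.le, ht.2.le⟩ hst]

variable [IsManifold (𝓡∂ 2) ∞ R]

/-- `IsImmersed` only concerns parameters in `[0,1]` and preferred charts. The point has a parameter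
there with the same velocity, and a coordinate change would carry a zero velocity to zero. -/
lemma deriv_ne_zero (h : GoodParam γ s) {φ : PartialEquiv R Plane} (hφ : PlanarAt φ (γ s)) :
    deriv (φ ∘ γ) s ≠ 0 := by
  obtain ⟨t, ht, hts⟩ := h.mem_trace
  have h' : GoodParam γ t := goodParam_of_mem h.proper ht (hts ▸ h.interior)
  rw [h.deriv_eq h' hts.symm]
  rw [← hts] at hφ
  have h0 := h.proper.immersed t ht
  rw [velIn_eq ht h'.contMDiffAt (planarAt_extChartAt h'.interior),
    PlanarAt.deriv_change hφ (planarAt_extChartAt h'.interior) h'.contMDiffAt] at h0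
  intro hz
  simp [hz] at h0

/-- Parameters away from `s` trace out a compact set, which misses `γ s` because the curve is
embedded. Hence the curve does not return to `γ s` from elsewhere. -/
lemma eventually_mem_trace [T2Space R] (h : GoodParam γ s) {δ : ℝ} (hδ : 0 < δ) :
    ∀ᶠ y in 𝓝 (γ s), y ∈ trace γ → ∃ t ∈ Metric.ball s δ, γ t = y := by
  rcases h with h | ⟨h, hs⟩
  -- A period centred at `s`: no other parameter in it has the same image as `s`.
  · have hK : IsCompact (γ '' (Icc (s - 1 / 2) (s + 1 / 2) \ Metric.ball s δ)) :=
      (isCompact_Icc.diff Metric.isOpen_ball).image h.smooth.continuous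
    have hs : γ s ∉ γ '' (Icc (s - 1 / 2) (s + 1 / 2) \ Metric.ball s δ) := by
      rintro ⟨t, ⟨ht, htb⟩, hts⟩
      obtain ⟨n, hn⟩ := h.exists_int hts
      have h1 : |(n : ℝ)| < 1 := by
        rw [← hn, abs_lt]; constructor <;> linarith [ht.1, ht.2]
      have h2 : n = 0 := by
        have : |n| < 1 := by exact_mod_cast h1
        exact Int.abs_lt_one_iff.1 this
      rw [h2] at hn
      apply htb
      rw [show t = s by simpa [sub_eq_zero] using hn]
      exact Metric.mem_ball_self hδ
    filter_upwards [hK.isClosed.isOpen_compl.mem_nhds hs] with y hy hyt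
    obtain ⟨t, ht, rfl⟩ := h.exists_mem hyt (s - 1 / 2)
    refine ⟨t, ?_, rfl⟩
    by_contra hb
    exact hy ⟨t, ⟨⟨ht.1, by linarith [ht.2]⟩, hb⟩, rfl⟩
  · have hK : IsCompact (γ '' (unitI \ Metric.ball s δ)) :=
      (isCompact_Icc.diff Metric.isOpen_ball).image_of_continuousOn
        (h.smooth.continuousOn.mono sdiff_subset)
    have hs : γ s ∉ γ '' (unitI \ Metric.ball s δ) := by
      rintro ⟨t, ⟨ht, htb⟩, hts⟩
      rw [h.injOn ht ⟨hs.1.le, hs.2.le⟩ hts] at htb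
      exact htb (Metric.mem_ball_self hδ)
    filter_upwards [hK.isClosed.isOpen_compl.mem_nhds hs] with y hy
    rintro ⟨t, ht, rfl⟩
    refine ⟨t, ?_, rfl⟩
    by_contra hb
    exact hy ⟨t, ⟨ht, hb⟩, rfl⟩

end GoodParam

/-! ### Defining functions -/

/-- A local defining function of `γ` at the point `γ s`, positive on the left of the curve. -/
structure DefinesAt (o : SurfaceOrientation R) (γ : ℝ → R) (s : ℝ) (g : R → ℝ) : Prop where
  smooth : ContMDiffAt (𝓡∂ 2) 𝓘(ℝ, ℝ) 1 g (γ s)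
  zero : ∀ᶠ y in 𝓝 (γ s), y ∈ trace γ → g y = 0
  pos : ∀ φ, OrientedAt o φ (γ s) → ∀ u, 0 < cross (deriv (φ ∘ γ) s) u →
    0 < fderiv ℝ (g ∘ φ.symm) (φ (γ s)) u

variable [IsManifold (𝓡∂ 2) ∞ R]

lemma PlanarAt.contDiffAt_comp_symm {φ : PartialEquiv R Plane} {x : R} (hφ : PlanarAt φ x)
    {F : Type*} [NormedAddCommGroup F] [NormedSpace ℝ F]
    {g : R → F} {n : WithTop ℕ∞} (hn : n ≤ ∞) (hg : ContMDiffAt (𝓡∂ 2) 𝓘(ℝ, F) n g x) :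
    ContDiffAt ℝ n (g ∘ φ.symm) (φ x) := by
  rw [← contMDiffAt_iff_contDiffAt]
  refine ContMDiffAt.comp _ (I' := 𝓡∂ 2) ?_ (hφ.symm_contMDiffAt.of_le hn)
  rwa [hφ.left_inv]

lemma PlanarAt.fderiv_comp_symm {φ ψ : PartialEquiv R Plane} {x : R} {W : R → R}
    (hφ : PlanarAt φ x) (hψ : PlanarAt ψ (W x)) (hW : ContMDiffAt (𝓡∂ 2) (𝓡∂ 2) ∞ W x)
    {g : R → ℝ} (hg : ContMDiffAt (𝓡∂ 2) 𝓘(ℝ, ℝ) 1 g (W x)) (u : Plane) :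
    fderiv ℝ ((g ∘ W) ∘ φ.symm) (φ x) u =
      fderiv ℝ (g ∘ ψ.symm) (ψ (W x)) (fderiv ℝ (ψ ∘ W ∘ φ.symm) (φ x) u) := by
  have d1 := (hψ.contDiffAt_comp_symm (by simp) hg).differentiableAt (by simp)
  have d2 := (hφ.contDiffAt_read le_rfl hψ hW).differentiableAt (by simp)
  have e1 : (ψ ∘ W ∘ φ.symm) (φ x) = ψ (W x) := by simp [hφ.left_inv]
  rw [← e1] at d1
  have := fderiv_comp (φ x) d1 d2
  rw [e1] at this
  rw [← ContinuousLinearMap.comp_apply, ← this]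
  congr 1
  apply Filter.EventuallyEq.fderiv_eq
  have ht : Tendsto (fun p => W (φ.symm p)) (𝓝 (φ x)) (𝓝 (W x)) :=
    hW.continuousAt.tendsto.comp hφ.tendsto_symm
  filter_upwards [ht hψ.source_mem_nhds] with p hp
  have hp' : ψ.symm (ψ (W (φ.symm p))) = W (φ.symm p) := ψ.left_inv hp
  simp [hp']

lemma PlanarAt.deriv_comp_symm {φ : PartialEquiv R Plane} {c : ℝ → R} {s : ℝ}
    (hφ : PlanarAt φ (c s)) (hc : ContMDiffAt 𝓘(ℝ, ℝ) (𝓡∂ 2) ∞ c s)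
    {g : R → ℝ} (hg : ContMDiffAt (𝓡∂ 2) 𝓘(ℝ, ℝ) 1 g (c s)) :
    HasDerivAt (g ∘ c) (fderiv ℝ (g ∘ φ.symm) (φ (c s)) (deriv (φ ∘ c) s)) s := by
  have d1 := (hφ.contDiffAt_comp_symm (by simp) hg).differentiableAt (by simp)
  have d2 := (hφ.contDiffAt_comp le_rfl hc).differentiableAt (by simp)
  have := d1.hasFDerivAt.comp_hasDerivAt s (f := φ ∘ c) d2.hasDerivAt
  refine this.congr_of_eventuallyEq ?_
  filter_upwards [hc.continuousAt hφ.source_mem_nhds] with p hp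
  have hp' : φ.symm (φ (c p)) = c p := φ.left_inv hp
  simp [hp']

namespace DefinesAt

variable {o : SurfaceOrientation R} {γ : ℝ → R} {s : ℝ} {g : R → ℝ}

/-- Oriented coordinate changes multiply `cross` by a positive determinant, so the sign condition
need only be checked in one chart. -/
lemma of_exists (hγ : GoodParam γ s) (smooth : ContMDiffAt (𝓡∂ 2) 𝓘(ℝ, ℝ) 1 g (γ s))
    (zero : ∀ᶠ y in 𝓝 (γ s), y ∈ trace γ → g y = 0) {φ : PartialEquiv R Plane}
    (hφ : OrientedAt o φ (γ s)) (pos : ∀ u, 0 < cross (deriv (φ ∘ γ) s) u →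
      0 < fderiv ℝ (g ∘ φ.symm) (φ (γ s)) u) : DefinesAt o γ s g := by
  refine ⟨smooth, zero, fun ψ hψ u hu => ?_⟩
  have := PlanarAt.fderiv_comp_symm (W := id) hψ.planarAt hφ.planarAt contMDiffAt_id smooth u
  change fderiv ℝ (g ∘ ψ.symm) (ψ (γ s)) u = _ at this
  rw [this]
  apply pos
  rw [PlanarAt.deriv_change hψ.planarAt hφ.planarAt hγ.contMDiffAt]
  change 0 < cross _ (fderiv ℝ (φ ∘ ψ.symm) (ψ (γ s)) u)
  rw [cross_map]
  exact mul_pos (hψ.det_change_pos hφ) hu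

lemma apply_eq_zero (h : DefinesAt o γ s g) (hγ : GoodParam γ s) : g (γ s) = 0 :=
  h.zero.self_of_nhds hγ.mem_trace

lemma fderiv_tangent (h : DefinesAt o γ s g) (hγ : GoodParam γ s) {φ : PartialEquiv R Plane}
    (hφ : PlanarAt φ (γ s)) : fderiv ℝ (g ∘ φ.symm) (φ (γ s)) (deriv (φ ∘ γ) s) = 0 := by
  have h1 := hφ.deriv_comp_symm hγ.contMDiffAt h.smooth
  have h2 : g ∘ γ =ᶠ[𝓝 s] fun _ => 0 := by
    filter_upwards [hγ.contMDiffAt.continuousAt.eventually h.zero, hγ.eventually_goodParam]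
      with t ht ht'
    exact ht ht'.mem_trace
  have h3 := (hasDerivAt_const s (0 : ℝ)).congr_of_eventuallyEq h2
  exact h1.unique h3

/-- The differential kills the tangent and is therefore a multiple of the determinant with the
tangent; positivity on the left gives the sign of the factor. -/
lemma fderiv_apply (h : DefinesAt o γ s g) (hγ : GoodParam γ s) {φ : PartialEquiv R Plane}
    (hφ : OrientedAt o φ (γ s)) : ∃ κ : ℝ, 0 < κ ∧ ∀ u,
      fderiv ℝ (g ∘ φ.symm) (φ (γ s)) u = κ * cross (deriv (φ ∘ γ) s) u := by
  have hv := hγ.deriv_ne_zero hφ.planarAt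
  set v := deriv (φ ∘ γ) s
  have hp := cross_rotLeft_pos hv
  have hq := h.pos φ hφ _ hp
  refine ⟨_, div_pos hq hp, fun u => ?_⟩
  have h0 : fderiv ℝ (g ∘ φ.symm) (φ (γ s)) v = 0 := h.fderiv_tangent hγ hφ.planarAt
  have hu := eq_combination_of_cross hp.ne' u
  conv_lhs => rw [hu]
  rw [map_add, map_smul, map_smul, h0]
  simp only [smul_eq_mul, mul_zero, zero_add]
  ring

/-- The defining function along a path through the curve. -/
lemma exists_hasDerivAt (h : DefinesAt o γ s g) (hγ : GoodParam γ s) {φ : PartialEquiv R Plane}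
    (hφ : OrientedAt o φ (γ s)) {c : ℝ → R} {t : ℝ} (hct : c t = γ s)
    (hc : ContMDiffAt 𝓘(ℝ, ℝ) (𝓡∂ 2) ∞ c t) :
    ∃ κ : ℝ, 0 < κ ∧ HasDerivAt (g ∘ c) (κ * cross (deriv (φ ∘ γ) s) (deriv (φ ∘ c) t)) t := by
  obtain ⟨κ, hκ, hu⟩ := h.fderiv_apply hγ hφ
  refine ⟨κ, hκ, ?_⟩
  rw [← hu, ← hct]
  exact PlanarAt.deriv_comp_symm (hct ▸ hφ.planarAt) hc (hct ▸ h.smooth)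

/-- This links `HasBoundary`, which compares the two ends of short segments across the curve, with
the signs of a defining function: `g` has positive derivative along the segment. -/
lemma eventually_ray (h : DefinesAt o γ s g) (hγ : GoodParam γ s) {φ : PartialEquiv R Plane}
    (hφ : OrientedAt o φ (γ s)) {u : Plane} (hu : 0 < cross (deriv (φ ∘ γ) s) u) :
    ∀ᶠ r in 𝓝[>] (0 : ℝ), 0 < g (φ.symm (φ (γ s) + r • u)) ∧
      g (φ.symm (φ (γ s) - r • u)) < 0 := by
  have d1 := (hφ.planarAt.contDiffAt_comp_symm (by simp) h.smooth).differentiableAt (by simp)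
  have d2 : HasDerivAt (fun r : ℝ => φ (γ s) + r • u) u 0 := by
    simpa using ((hasDerivAt_id (0 : ℝ)).smul_const u).const_add (φ (γ s))
  have e : φ (γ s) + (0 : ℝ) • u = φ (γ s) := by simp
  have d3 : HasDerivAt (fun r : ℝ => g (φ.symm (φ (γ s) + r • u)))
      (fderiv ℝ (g ∘ φ.symm) (φ (γ s)) u) 0 := by
    have := HasFDerivAt.comp_hasDerivAt (0 : ℝ) (l := g ∘ φ.symm)
      (f := fun r : ℝ => φ (γ s) + r • u) (by rw [e]; exact d1.hasFDerivAt) d2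
    exact this
  have hp := h.pos φ hφ u hu
  have g0 : g (φ.symm (φ (γ s) + (0 : ℝ) • u)) = 0 := by
    rw [e, hφ.planarAt.left_inv, h.apply_eq_zero hγ]
  have key : ∀ᶠ r in 𝓝[≠] (0 : ℝ),
      0 < r⁻¹ * g (φ.symm (φ (γ s) + r • u)) := by
    have := d3.tendsto_slope.eventually (lt_mem_nhds hp)
    filter_upwards [this] with r hr
    simpa only [slope_def_field, sub_zero, g0, div_eq_inv_mul, e, hφ.planarAt.left_inv, zero_smul, add_zero, h.apply_eq_zero hγ] using hr
  have k1 : ∀ᶠ r in 𝓝[>] (0 : ℝ), 0 < r⁻¹ * g (φ.symm (φ (γ s) + r • u)) :=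
    key.filter_mono (nhdsWithin_mono _ fun x (hx : 0 < x) => hx.ne')
  have k2 : ∀ᶠ r in 𝓝[>] (0 : ℝ), 0 < (-r)⁻¹ * g (φ.symm (φ (γ s) + (-r) • u)) := by
    have ht : Tendsto (fun r : ℝ => -r) (𝓝[>] 0) (𝓝[≠] 0) := by
      refine tendsto_nhdsWithin_iff.2 ⟨?_, ?_⟩
      · have : Tendsto (fun r : ℝ => -r) (𝓝 0) (𝓝 (-0)) := continuous_neg.tendsto 0
        rw [neg_zero] at this
        exact this.mono_left nhdsWithin_le_nhds
      · filter_upwards [self_mem_nhdsWithin] with r hr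
        exact neg_ne_zero.2 (ne_of_gt hr)
    exact ht.eventually key
  filter_upwards [k1, k2, self_mem_nhdsWithin] with r h1 h2 h3
  have h3' : 0 < r := h3
  refine ⟨(pos_iff_pos_of_mul_pos h1).1 (inv_pos.2 h3'), ?_⟩
  have h4 : (-r)⁻¹ < 0 := inv_lt_zero.2 (by linarith)
  rw [sub_eq_add_neg, ← neg_smul]
  exact (neg_iff_neg_of_mul_pos h2).1 h4

/-- Defining functions are carried along by orientation preserving maps. -/
lemma transport [T2Space R] (h : DefinesAt o γ s g) (hγ : GoodParam γ s) {W S : R → R}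
    (hSW : ∀ x, S (W x) = x) (hWS : ∀ x, W (S x) = x) (hW : PreservesAt o W (γ s))
    (hS : ContMDiffAt (𝓡∂ 2) (𝓡∂ 2) ∞ S (W (γ s))) (hWγ : GoodParam (W ∘ γ) s) :
    DefinesAt o (W ∘ γ) s (g ∘ S) := by
  have hS0 : S (W (γ s)) = γ s := hSW _
  have hg : ContMDiffAt (𝓡∂ 2) 𝓘(ℝ, ℝ) 1 g (S (W (γ s))) := by rw [hS0]; exact h.smooth
  have hφ := orientedAt_coord o hγ.interior
  have hψ := orientedAt_coord o hW.1
  refine of_exists hWγ (hg.comp _ (hS.of_le (by simp))) ?_ hψ ?_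
  · have : Tendsto S (𝓝 (W (γ s))) (𝓝 (γ s)) := by
      have := hS.continuousAt.tendsto
      rwa [hS0] at this
    filter_upwards [this.eventually h.zero] with y hy
    rintro ⟨t, ht, rfl⟩
    exact hy ⟨t, ht, (hSW _).symm⟩
  · intro u hu
    have hφ' : PlanarAt (o.coord (γ s)) (S (W (γ s))) := by rw [hS0]; exact hφ.planarAt
    have e1 := PlanarAt.fderiv_comp_symm hψ.planarAt hφ' hS hg u
    change 0 < fderiv ℝ ((g ∘ S) ∘ (o.coord (W (γ s))).symm) (o.coord (W (γ s)) (W (γ s))) u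
    rw [e1, hS0]
    apply h.pos _ hφ
    -- `A` and `B` are the derivatives of `W` and of its inverse. As `A` has positive determinant,
    -- `B u` lies on the same side of the old tangent as `u` of the new one.
    set B := fderiv ℝ (o.coord (γ s) ∘ S ∘ (o.coord (W (γ s))).symm) (o.coord (W (γ s)) (W (γ s)))
    set A := fderiv ℝ (o.coord (W (γ s)) ∘ W ∘ (o.coord (γ s)).symm) (o.coord (γ s) (γ s)) with hA
    have hAB : A (B u) = u := by
      have hWW : ContMDiffAt (𝓡∂ 2) (𝓡∂ 2) ∞ W (S (W (γ s))) := by rw [hS0]; exact hW.2.1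
      have hψ' : PlanarAt (o.coord (W (γ s))) (W (S (W (γ s)))) := by rw [hS0]; exact hψ.planarAt
      have := PlanarAt.fderiv_change_comp (W₁ := S) (W₂ := W) hψ.planarAt hφ' hψ' hS hWW
      rw [hS0] at this
      have hid : W ∘ S = id := funext hWS
      rw [hid] at this
      have h2 : fderiv ℝ (o.coord (W (γ s)) ∘ id ∘ (o.coord (W (γ s))).symm)
          (o.coord (W (γ s)) (W (γ s))) = ContinuousLinearMap.id ℝ Plane := by
        rw [← fderiv_id (x := o.coord (W (γ s)) (W (γ s)))]
        apply Filter.EventuallyEq.fderiv_eq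
        filter_upwards [hψ.planarAt.target_mem_nhds] with p hp
          using (o.coord (W (γ s))).right_inv hp
      rw [h2] at this
      exact (congrArg (fun L : Plane →L[ℝ] Plane => L u) this).symm
    have e2 : deriv (o.coord (W (γ s)) ∘ W ∘ γ) s = A (deriv (o.coord (γ s) ∘ γ) s) :=
      PlanarAt.deriv_read hφ.planarAt hψ.planarAt hW.2.1 hγ.contMDiffAt
    change 0 < cross (deriv (o.coord (W (γ s)) ∘ W ∘ γ) s) u at hu
    rw [e2, ← hAB, cross_map] at hu
    exact (pos_iff_pos_of_mul_pos hu).1 (hW.2.2 _ _ hφ hψ)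

end DefinesAt

end Winding

namespace Winding

/-! ### Local inverses in the plane -/

lemma exists_equiv_of_cross {u v : Plane} (h : cross u v ≠ 0) :
    ∃ A : (ℝ × ℝ) ≃L[ℝ] Plane, ∀ p, A p = p.1 • u + p.2 • v := by
  let f : (ℝ × ℝ) →ₗ[ℝ] Plane :=
    (LinearMap.fst ℝ ℝ ℝ).smulRight u + (LinearMap.snd ℝ ℝ ℝ).smulRight v
  have hf : ∀ p, f p = p.1 • u + p.2 • v := fun p => rfl
  have hinj : Injective f := by
    rw [← LinearMap.ker_eq_bot, LinearMap.ker_eq_bot']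
    intro p hp
    rw [hf] at hp
    have h1 : cross u (p.1 • u + p.2 • v) = 0 := by rw [hp, cross_zero_right]
    have h2 : cross (p.1 • u + p.2 • v) v = 0 := by rw [hp, cross_zero_left]
    rw [cross_add_right, cross_smul_right, cross_smul_right, cross_self] at h1
    rw [cross_add_left, cross_smul_left, cross_smul_left, cross_self] at h2
    ext
    · simpa [h] using h2
    · simpa [h] using h1
  have hsurj : Surjective f := fun x => ⟨(_, _), (eq_combination_of_cross h x).symm⟩
  exact ⟨(LinearEquiv.ofBijective f ⟨hinj, hsurj⟩).toContinuousLinearEquiv, fun p => rfl⟩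

lemma exists_local_inverse {F : ℝ × ℝ → Plane} {p : ℝ × ℝ} (hF : ContDiffAt ℝ ∞ F p)
    (h : cross (fderiv ℝ F p (1, 0)) (fderiv ℝ F p (0, 1)) ≠ 0) :
    ∃ G : Plane → ℝ × ℝ, ContDiffAt ℝ ∞ G (F p) ∧ G (F p) = p ∧ (∀ᶠ q in 𝓝 p, G (F q) = q) ∧
      ∀ᶠ z in 𝓝 (F p), F (G z) = z := by
  obtain ⟨A, hA⟩ := exists_equiv_of_cross h
  have hd : HasFDerivAt F (A : ℝ × ℝ →L[ℝ] Plane) p := by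
    refine (hF.differentiableAt (by simp)).hasFDerivAt.congr_fderiv
      (ContinuousLinearMap.ext fun q => ?_)
    rw [ContinuousLinearEquiv.coe_coe, hA, ← map_smul, ← map_smul, ← map_add]
    simp
  have hn : (∞ : WithTop ℕ∞) ≠ 0 := by simp
  let P := hF.toOpenPartialHomeomorph F hd hn
  have hP : ⇑P = F := hF.toOpenPartialHomeomorph_coe hd hn
  have hs : p ∈ P.source := hF.mem_toOpenPartialHomeomorph_source hd hn
  refine ⟨P.symm, hF.to_localInverse hd hn, ?_, ?_, ?_⟩
  · rw [← hP]; exact P.left_inv hs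
  · filter_upwards [P.open_source.mem_nhds hs] with q hq
    rw [← hP]; exact P.left_inv hq
  · have := P.open_target.mem_nhds (P.map_source hs)
    rw [hP] at this
    filter_upwards [this] with q hq
    have := P.right_inv hq
    rwa [hP] at this

/-! ### Locally constant functions -/

lemma constant_of_locally {X Y : Type*} [TopologicalSpace X] {S : Set X} (hS : IsPreconnected S)
    {f : X → Y} (h : ∀ x ∈ S, ∀ᶠ y in 𝓝[S] x, f y = f x) {x y : X} (hx : x ∈ S) (hy : y ∈ S) :
    f x = f y := by
  let _ : TopologicalSpace Y := ⊥
  have _ : DiscreteTopology Y := ⟨rfl⟩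
  refine hS.constant (f := f) (fun z hz => ?_) hx hy
  exact tendsto_nhds_of_eventually_eq (h z hz)

/-- The local values `v` continue `f` across `C`. Near points of `S` the complement of `C` is dense,
so neighbouring local values are compared at a common point off `C`, and `v` is locally constant on
`S`. -/
lemma constant_off {X Y : Type*} [TopologicalSpace X] {S C : Set X} (hS : IsPreconnected S)
    (hC : ∀ x ∈ S, ∃ᶠ y in 𝓝 x, y ∉ C) {f : X → Y}
    (h : ∀ x ∈ S, ∃ v, ∀ᶠ y in 𝓝 x, y ∉ C → f y = v) {x y : X} (hx : x ∈ S) (hy : y ∈ S)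
    (hx' : x ∉ C) (hy' : y ∉ C) : f x = f y := by
  classical
  let v : X → Y := fun z => if hz : z ∈ S then (h z hz).choose else f z
  have hv : ∀ z ∈ S, ∀ᶠ y in 𝓝 z, y ∉ C → f y = v z := by
    intro z hz
    simp only [v, hz, dite_true]
    exact (h z hz).choose_spec
  have key := constant_of_locally hS (f := v) (fun z hz => by
    filter_upwards [(hv z hz).eventually_nhds.filter_mono nhdsWithin_le_nhds,
      self_mem_nhdsWithin] with y hy hyS
    obtain ⟨t, ht1, ht2, ht3⟩ := ((hC y hyS).and_eventually (hy.and (hv y hyS))).exists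
    rw [← ht3 ht1, ← ht2 ht1]) hx hy
  rw [(hv x hx).self_of_nhds hx', (hv y hy).self_of_nhds hy', key]

variable {R : Type*} [TopologicalSpace R] [ChartedSpace (EuclideanHalfSpace 2) R]
  [IsManifold (𝓡∂ 2) ∞ R]

lemma isOpen_int : IsOpen ((𝓡∂ 2).interior R) := (𝓡∂ 2).isOpen_interior (n := ∞) (by simp)

lemma rank_plane : 1 < Module.rank ℝ Plane := by
  rw [← Module.finrank_eq_rank, finrank_euclideanSpace]
  simp

/-- A coordinate disc without its centre is the image of `(0, r) × S¹` under polar coordinates. -/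
lemma exists_punctured {x : R} (hx : x ∈ (𝓡∂ 2).interior R) {N : Set R} (hN : N ∈ 𝓝 x) :
    ∃ N' ∈ 𝓝 x, N' ⊆ N ∧ IsPreconnected (N' \ {x}) := by
  have hφ := planarAt_extChartAt hx
  set φ := extChartAt (𝓡∂ 2) x
  have h1 := hφ.eventually_symm.and (hφ.tendsto_symm.eventually hN)
  obtain ⟨r, hr, hb⟩ := Metric.eventually_nhds_iff_ball.1 h1
  refine ⟨φ.symm '' Metric.ball (φ x) r, ?_, ?_, ?_⟩
  · filter_upwards [hφ.continuousAt (Metric.ball_mem_nhds _ hr), hφ.source_mem_nhds] with y hy hy'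
    exact ⟨φ y, hy, φ.left_inv hy'⟩
  · rintro _ ⟨p, hp, rfl⟩
    exact (hb p hp).2
  · have e : φ.symm '' Metric.ball (φ x) r \ {x} =
        (fun q : ℝ × Plane => φ.symm (φ x + q.1 • q.2)) ''
          (Ioo 0 r ×ˢ Metric.sphere (0 : Plane) 1) := by
      ext y
      constructor
      · rintro ⟨⟨p, hp, rfl⟩, hne⟩
        have hpx : p - φ x ≠ 0 := by
          intro h0
          apply hne
          rw [sub_eq_zero.1 h0, hφ.left_inv]
          rfl
        have hn : 0 < ‖p - φ x‖ := norm_pos_iff.2 hpx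
        refine ⟨(‖p - φ x‖, ‖p - φ x‖⁻¹ • (p - φ x)), ⟨⟨hn, ?_⟩, ?_⟩, ?_⟩
        · simpa [dist_eq_norm] using hp
        · simp [norm_smul, hn.ne']
        · simp only
          rw [smul_smul, mul_inv_cancel₀ hn.ne', one_smul]
          congr 1
          abel
      · rintro ⟨⟨t, u⟩, ⟨ht, hu⟩, rfl⟩
        have hu' : ‖u‖ = 1 := by simpa using hu
        have hmem : φ x + t • u ∈ Metric.ball (φ x) r := by
          rw [mem_ball_iff_norm]
          simp only [add_sub_cancel_left, norm_smul, hu', mul_one, Real.norm_eq_abs]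
          rw [abs_of_pos ht.1]
          exact ht.2
        refine ⟨⟨_, hmem, rfl⟩, ?_⟩
        intro h0
        have h0' : φ.symm (φ x + t • u) = x := h0
        have := (hb _ hmem).1.1
        rw [h0'] at this
        have h3 : t • u = 0 := by simpa using this.symm
        rcases smul_eq_zero.1 h3 with h | h
        · exact ht.1.ne' h
        · simp [h] at hu'
    rw [e]
    refine ((isPreconnected_Ioo).prod (isPreconnected_sphere rank_plane 0 1)).image _ ?_
    intro q hq
    have hu' : ‖q.2‖ = 1 := by simpa using hq.2
    have hmem : φ x + q.1 • q.2 ∈ Metric.ball (φ x) r := by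
      rw [mem_ball_iff_norm]
      simp only [add_sub_cancel_left, norm_smul, hu', mul_one, Real.norm_eq_abs]
      rw [abs_of_pos hq.1.1]
      exact hq.1.2
    have h2 := (hb _ hmem).1
    have h3 : ContinuousAt φ.symm (φ x + q.1 • q.2) := by
      have := h2.2.symm_continuousAt
      rwa [h2.1] at this
    refine ContinuousAt.continuousWithinAt ?_
    exact ContinuousAt.comp (f := fun q : ℝ × Plane => φ x + q.1 • q.2) h3 (by fun_prop)

/-! ### The sides of a curve -/

variable {o : SurfaceOrientation R} {γ : ℝ → R} {s : ℝ}

/-- The map `(t, r) ↦ φ (γ t) + r • u`, with `u` on the left of the curve, straightens the curve;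
`g` is the coordinate `r`, and the two sides are images of half-discs. For the comparison with
another defining function `g'`, the increment of `g'` from `(t, 0)` to `(t, r)` is `r` times a
positive derivative up to a small error. The base point `(t, 0)` varies, so strict differentiability
is needed. -/
theorem exists_definesAt [T2Space R] (o : SurfaceOrientation R) (hγ : GoodParam γ s) :
    ∃ g, DefinesAt o γ s g ∧ (∀ᶠ y in 𝓝 (γ s), g y = 0 ↔ y ∈ trace γ) ∧
      (∀ N ∈ 𝓝 (γ s), ∃ N' ∈ 𝓝 (γ s), N' ⊆ N ∧ IsPreconnected {y ∈ N' | 0 < g y} ∧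
        IsPreconnected {y ∈ N' | g y < 0}) ∧
      ∀ g', DefinesAt o γ s g' → ∀ᶠ y in 𝓝 (γ s), (0 < g' y ↔ 0 < g y) := by
  have hφo := orientedAt_coord o hγ.interior
  set φ := o.coord (γ s)
  have hφ := hφo.planarAt
  have hγs := hφ.contDiffAt_comp le_rfl hγ.contMDiffAt
  have hv := hγ.deriv_ne_zero hφ
  set v := deriv (φ ∘ γ) s with hv_def
  have hp := cross_rotLeft_pos hv
  set u := rotLeft v
  let F : ℝ × ℝ → Plane := fun q => φ (γ q.1) + q.2 • u
  have hF : ContDiffAt ℝ ∞ F (s, 0) := by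
    refine ContDiffAt.add ?_ (by fun_prop)
    exact ContDiffAt.comp (s, (0 : ℝ)) (f := fun q : ℝ × ℝ => q.1) (g := φ ∘ γ) hγs contDiffAt_fst
  have hFs : F (s, 0) = φ (γ s) := by simp [F]
  have hF' : HasFDerivAt F ((ContinuousLinearMap.fst ℝ ℝ ℝ).smulRight v +
      (ContinuousLinearMap.snd ℝ ℝ ℝ).smulRight u) (s, 0) := by
    have h1 : HasFDerivAt (fun q : ℝ × ℝ => (φ ∘ γ) q.1)
        ((ContinuousLinearMap.fst ℝ ℝ ℝ).smulRight v) (s, 0) := by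
      have := (hγs.differentiableAt (by simp)).hasDerivAt.hasFDerivAt.comp (s, (0 : ℝ))
        (hasFDerivAt_fst (𝕜 := ℝ) (E := ℝ) (F := ℝ))
      exact this.congr_fderiv (ContinuousLinearMap.ext fun q => by simp [hv_def])
    have h2 : HasFDerivAt (fun q : ℝ × ℝ => q.2 • u)
        ((ContinuousLinearMap.snd ℝ ℝ ℝ).smulRight u) (s, 0) :=
      (hasFDerivAt_snd (𝕜 := ℝ) (E := ℝ) (F := ℝ)).smul_const u
    exact h1.add h2
  have hF1 : fderiv ℝ F (s, 0) (1, 0) = v := by simp [hF'.fderiv]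
  have hF2 : fderiv ℝ F (s, 0) (0, 1) = u := by simp [hF'.fderiv]
  obtain ⟨G, hG, hGs, hGF, hFG⟩ := exists_local_inverse hF (by rw [hF1, hF2]; exact hp.ne')
  rw [hFs] at hG hGs hFG
  let g : R → ℝ := fun y => (G (φ y)).2
  have hGt : Tendsto (fun y => G (φ y)) (𝓝 (γ s)) (𝓝 (s, 0)) := by
    have h1 := hG.continuousAt.tendsto.comp hφ.continuousAt.tendsto
    rw [hGs] at h1
    exact h1
  have hFt : Tendsto F (𝓝 (s, 0)) (𝓝 (φ (γ s))) := by
    have := hF.continuousAt.tendsto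
    rwa [hFs] at this
  have hFG' : ∀ᶠ y in 𝓝 (γ s), F (G (φ y)) = φ y := hφ.continuousAt.eventually hFG
  have hzero : ∀ᶠ y in 𝓝 (γ s), g y = 0 ↔ y ∈ trace γ := by
    obtain ⟨δ, hδ, hball⟩ := Metric.eventually_nhds_iff_ball.1
      ((hGF.and (hFt.eventually hφ.eventually_symm)))
    have c1 : ∀ᶠ q : ℝ × ℝ in 𝓝 (s, 0), γ q.1 ∈ φ.source ∧ GoodParam γ q.1 := by
      have : Tendsto (fun q : ℝ × ℝ => q.1) (𝓝 (s, 0)) (𝓝 s) := continuous_fst.tendsto (s, (0 : ℝ))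
      exact this.eventually ((hγ.contMDiffAt.continuousAt.eventually hφ.source_mem_nhds).and
        hγ.eventually_goodParam)
    filter_upwards [hGt.eventually c1, hFG', hφ.source_mem_nhds, hγ.eventually_mem_trace hδ]
      with y h1 h2 h3 h4
    constructor
    · intro h0
      have h5 : F (G (φ y)) = φ (γ (G (φ y)).1) := by
        have : (G (φ y)).2 = 0 := h0
        simp [F, this]
      rw [h2] at h5
      rw [φ.injOn h3 h1.1 h5]
      exact h1.2.mem_trace
    · intro hy
      obtain ⟨t, ht, rfl⟩ := h4 hy
      have h5 : (t, (0 : ℝ)) ∈ Metric.ball (s, (0 : ℝ)) δ := by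
        simpa [Prod.dist_eq, hδ] using ht
      have h6 := (hball _ h5).1
      have h7 : F (t, 0) = φ (γ t) := by simp [F]
      rw [h7] at h6
      change (G (φ (γ t))).2 = 0
      rw [h6]
  refine ⟨g, ?_, hzero, ?_, ?_⟩
  · refine DefinesAt.of_exists hγ ?_ (hzero.mono fun y h => h.2) hφo ?_
    · have h1 : ContMDiffAt 𝓘(ℝ, Plane) 𝓘(ℝ, ℝ) 1 (fun p => (G p).2) (φ (γ s)) :=
        contMDiffAt_iff_contDiffAt.2 ((hG.snd).of_le (by simp))
      exact ContMDiffAt.comp (γ s) (g := fun p => (G p).2) (f := φ) h1 (hφ.contMDiffAt.of_le (by simp))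
    · intro u' hu'
      have d1 : fderiv ℝ (g ∘ φ.symm) (φ (γ s)) u' = (fderiv ℝ G (φ (γ s)) u').2 := by
        have e1 : fderiv ℝ (g ∘ φ.symm) (φ (γ s)) = fderiv ℝ (fun p => (G p).2) (φ (γ s)) := by
          apply Filter.EventuallyEq.fderiv_eq
          filter_upwards [hφ.target_mem_nhds] with p hp
          change (G (φ (φ.symm p))).2 = _
          rw [φ.right_inv hp]
        rw [e1, fderiv.snd (hG.differentiableAt (by simp))]
        rfl
      have d2 : fderiv ℝ F (s, 0) (fderiv ℝ G (φ (γ s)) u') = u' := by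
        have h1 := hF.differentiableAt (by simp)
        rw [← hGs] at h1
        have h2 := fderiv_comp (φ (γ s)) h1 (hG.differentiableAt (by simp))
        have h3 : fderiv ℝ (F ∘ G) (φ (γ s)) = ContinuousLinearMap.id ℝ Plane := by
          rw [← fderiv_id (x := φ (γ s))]
          exact Filter.EventuallyEq.fderiv_eq (by filter_upwards [hFG] with p hp using hp)
        rw [h3, hGs] at h2
        exact (congrArg (fun L : Plane →L[ℝ] Plane => L u') h2).symm
      rw [hF'.fderiv] at d2
      simp only [_root_.add_apply, ContinuousLinearMap.smulRight_apply,
        ContinuousLinearMap.coe_fst', ContinuousLinearMap.coe_snd'] at d2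
      rw [d1]
      rw [← d2, cross_add_right, cross_smul_right, cross_smul_right, cross_self, mul_zero,
        zero_add] at hu'
      exact (pos_iff_pos_of_mul_pos hu').2 hp
  · intro N hN
    have hFc : ∀ᶠ q in 𝓝 (s, (0 : ℝ)), ContinuousAt F q :=
      ((hF.of_le (m := 1) (by simp)).eventually (by simp)).mono fun q hq => hq.continuousAt
    obtain ⟨δ, hδ, hball⟩ := Metric.eventually_nhds_iff_ball.1
      (((hGF.and (hFt.eventually hφ.eventually_symm)).and
        ((hφ.tendsto_symm.comp hFt).eventually hN)).and hFc)
    have hc : ContinuousOn (fun q => φ.symm (F q)) (Metric.ball (s, (0:ℝ)) δ) := by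
      intro q hq
      have hq' := hball q hq
      have h1 := hq'.1.1.2.2.symm_continuousAt
      rw [hq'.1.1.2.1] at h1
      exact (ContinuousAt.comp (g := φ.symm) h1 hq'.2).continuousWithinAt
    have hgQ : ∀ q ∈ Metric.ball (s, (0 : ℝ)) δ, g (φ.symm (F q)) = q.2 := by
      intro q hq
      have := (hball q hq).1.1
      change (G (φ (φ.symm (F q)))).2 = _
      rw [this.2.1, this.1]
    have hset : ∀ P : ℝ → Prop, {y ∈ (fun q => φ.symm (F q)) '' Metric.ball (s, (0:ℝ)) δ | P (g y)} =
        (fun q => φ.symm (F q)) '' (Metric.ball (s, (0:ℝ)) δ ∩ {q | P q.2}) := by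
      intro P
      ext y
      constructor
      · rintro ⟨⟨q, hq, rfl⟩, hy⟩
        refine ⟨q, ⟨hq, ?_⟩, rfl⟩
        simp only [hgQ q hq] at hy
        exact hy
      · rintro ⟨q, ⟨hq, hy⟩, rfl⟩
        refine ⟨⟨q, hq, rfl⟩, ?_⟩
        simp only [hgQ q hq]
        exact hy
    refine ⟨(fun q => φ.symm (F q)) '' Metric.ball (s, (0:ℝ)) δ, ?_, ?_, ?_, ?_⟩
    · filter_upwards [hGt.eventually (Metric.ball_mem_nhds _ hδ), hFG', hφ.source_mem_nhds]
        with y h1 h2 h3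
      refine ⟨_, h1, ?_⟩
      simp only [h2]
      exact φ.left_inv h3
    · rintro _ ⟨q, hq, rfl⟩
      exact (hball q hq).1.2
    · rw [hset (fun x => 0 < x)]
      refine IsPreconnected.image ?_ _ (hc.mono inter_subset_left)
      refine Convex.isPreconnected ((convex_ball _ _).inter ?_)
      exact (convex_Ioi (0 : ℝ)).linear_preimage (LinearMap.snd ℝ ℝ ℝ)
    · rw [hset (fun x => x < 0)]
      refine IsPreconnected.image ?_ _ (hc.mono inter_subset_left)
      refine Convex.isPreconnected ((convex_ball _ _).inter ?_)
      exact (convex_Iio (0 : ℝ)).linear_preimage (LinearMap.snd ℝ ℝ ℝ)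
  · intro g' hg'
    have hh : ContDiffAt ℝ 1 ((g' ∘ φ.symm) ∘ F) (s, 0) := by
      refine ContDiffAt.comp _ ?_ (hF.of_le (by simp))
      rw [hFs]
      exact hφ.contDiffAt_comp_symm (by simp) hg'.smooth
    have hst := hh.hasStrictFDerivAt (by simp)
    have hval : fderiv ℝ ((g' ∘ φ.symm) ∘ F) (s, 0) (0, 1) = fderiv ℝ (g' ∘ φ.symm) (φ (γ s)) u := by
      have h1 := (hφ.contDiffAt_comp_symm (by simp) hg'.smooth).differentiableAt (by simp)
      rw [← hFs] at h1
      rw [fderiv_comp _ h1 (hF.differentiableAt (by simp)), ContinuousLinearMap.comp_apply, hF2, hFs]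
    set h' := fderiv ℝ ((g' ∘ φ.symm) ∘ F) (s, 0) with hh'
    have hpos : 0 < h' (0, 1) := by rw [hval]; exact hg'.pos φ hφo u hp
    -- An error of half the derivative leaves the sign of the increment intact.
    have hlo := (hasStrictFDerivAt_iff_isLittleO.1 hst).bound (half_pos hpos)
    have c1 : ∀ᶠ q : ℝ × ℝ in 𝓝 (s, 0), GoodParam γ q.1 ∧ (γ q.1 ∈ trace γ → g' (γ q.1) = 0)
        ∧ γ q.1 ∈ φ.source := by
      have : Tendsto (fun q : ℝ × ℝ => q.1) (𝓝 (s, 0)) (𝓝 s) := continuous_fst.tendsto (s, (0 : ℝ))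
      exact this.eventually (hγ.eventually_goodParam.and
        ((hγ.contMDiffAt.continuousAt.eventually hg'.zero).and
          (hγ.contMDiffAt.continuousAt.eventually hφ.source_mem_nhds)))
    have c2 : Tendsto (fun q : ℝ × ℝ => (q, (q.1, (0 : ℝ)))) (𝓝 (s, 0)) (𝓝 ((s, 0), (s, 0))) := by
      have : Continuous (fun q : ℝ × ℝ => (q, (q.1, (0 : ℝ)))) := by fun_prop
      exact this.tendsto (s, 0)
    have c3 := c2.eventually hlo
    filter_upwards [hGt.eventually c1, hGt.eventually c3, hFG', hφ.source_mem_nhds]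
      with y h1 h2 h3 h4
    have e1 : ((g' ∘ φ.symm) ∘ F) (G (φ y)) = g' y := by
      simp only [comp_apply, h3, φ.left_inv h4]
    have e2 : ((g' ∘ φ.symm) ∘ F) ((G (φ y)).1, 0) = 0 := by
      have : F ((G (φ y)).1, 0) = φ (γ (G (φ y)).1) := by simp [F]
      simp only [comp_apply, this, φ.left_inv h1.2.2]
      exact h1.2.1 h1.1.mem_trace
    have e3 : G (φ y) - ((G (φ y)).1, 0) = (g y) • ((0 : ℝ), (1 : ℝ)) := by
      ext <;> simp [g]
    simp only [e1, e2, e3, sub_zero, map_smul, smul_eq_mul] at h2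
    have e4 : ‖g y • ((0 : ℝ), (1 : ℝ))‖ = |g y| := by simp
    rw [e4, Real.norm_eq_abs, abs_le] at h2
    constructor
    · intro hy
      by_contra hn
      push Not at hn
      rw [abs_of_nonpos hn] at h2
      nlinarith [h2.2]
    · intro hy
      rw [abs_of_pos hy] at h2
      nlinarith [h2.1]

end Winding

/-! ### Defining functions along a curve, isolated intersections, and jumps across a curve. -/

namespace Winding

variable {R : Type*} [TopologicalSpace R] [ChartedSpace (EuclideanHalfSpace 2) R]
  [IsManifold (𝓡∂ 2) ∞ R] {o : SurfaceOrientation R} {γ δ : ℝ → R} {s t : ℝ} {g g' : R → ℝ}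

lemma DefinesAt.of_eq (h : DefinesAt o γ s g) (hs : GoodParam γ s) (ht : GoodParam γ t)
    (hst : γ s = γ t) : DefinesAt o γ t g := by
  refine ⟨hst ▸ h.smooth, hst ▸ h.zero, fun φ hφ u hu => ?_⟩
  rw [← hst]
  rw [← hs.deriv_eq ht hst] at hu
  exact h.pos φ (hst ▸ hφ) u hu

/-- For one fixed vector `u`, both positivity conditions persist at nearby parameters. There the
differential of `g` kills the tangent, so its value at `u` determines its sign everywhere. The class
`C^1` in `DefinesAt` matters: differentiability of finite order at a point passes to nearby points.
-/
lemma DefinesAt.eventually_definesAt (h : DefinesAt o γ s g) (hs : GoodParam γ s) :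
    ∀ᶠ t in 𝓝 s, DefinesAt o γ t g := by
  have hφ := orientedAt_coord o hs.interior
  set φ := o.coord (γ s)
  have hγs := hφ.planarAt.contDiffAt_comp le_rfl hs.contMDiffAt
  have hgs := hφ.planarAt.contDiffAt_comp_symm (by simp) h.smooth
  have hv := hs.deriv_ne_zero hφ.planarAt
  set v := deriv (φ ∘ γ) s
  have hp := cross_rotLeft_pos hv
  set u := rotLeft v
  have hq := h.pos φ hφ u hp
  have c1 : ContinuousAt (fun t => deriv (φ ∘ γ) t) s := by
    have h1 : ContinuousAt (fderiv ℝ (φ ∘ γ)) s := hγs.continuousAt_fderiv (by simp)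
    exact h1.clm_apply continuousAt_const
  have c2 : ContinuousAt (fun t => cross (deriv (φ ∘ γ) t) u) s :=
    ContinuousAt.comp (f := fun t => (deriv (φ ∘ γ) t, u)) continuous_cross.continuousAt
      (c1.prodMk continuousAt_const)
  have c3 : ContinuousAt (fun t => fderiv ℝ (g ∘ φ.symm) (φ (γ t)) u) s := by
    have h1 : ContinuousAt (fderiv ℝ (g ∘ φ.symm)) (φ (γ s)) := hgs.continuousAt_fderiv (by simp)
    have h2 : ContinuousAt (fun t => fderiv ℝ (g ∘ φ.symm) (φ (γ t))) s :=
      ContinuousAt.comp (f := fun t => φ (γ t)) h1 hγs.continuousAt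
    exact h2.clm_apply continuousAt_const
  have hz : ∀ᶠ t in 𝓝 s, g (γ t) = 0 := by
    filter_upwards [hs.contMDiffAt.continuousAt.eventually h.zero, hs.eventually_goodParam]
      with t ht ht' using ht ht'.mem_trace
  filter_upwards [c2.eventually (lt_mem_nhds hp), c3.eventually (lt_mem_nhds hq),
    hs.eventually_goodParam, hs.contMDiffAt.continuousAt.eventually hφ.eventually_orientedAt,
    hs.contMDiffAt.continuousAt.eventually ((contMDiffAt_iff_contMDiffAt_nhds (by simp)).1 h.smooth),
    hs.contMDiffAt.continuousAt.eventually h.zero.eventually_nhds, hz.eventually_nhds]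
    with t h1 h2 h3 h4 h5 h6 h7
  refine DefinesAt.of_exists h3 h5 h6 h4 fun u' hu' => ?_
  have htan : fderiv ℝ (g ∘ φ.symm) (φ (γ t)) (deriv (φ ∘ γ) t) = 0 := by
    have e1 := h4.planarAt.deriv_comp_symm h3.contMDiffAt h5
    exact e1.unique ((hasDerivAt_const t (0 : ℝ)).congr_of_eventuallyEq h7)
  have e2 := eq_combination_of_cross h1.ne' u'
  rw [e2, map_add, map_smul, map_smul, htan]
  simp only [smul_eq_mul, mul_zero, zero_add]
  exact mul_pos (div_pos hu' h1) h2

lemma DefinesAt.sign_eq [T2Space R] (h : DefinesAt o γ s g) (h' : DefinesAt o γ s g')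
    (hs : GoodParam γ s) : ∀ᶠ y in 𝓝 (γ s), (0 < g y ↔ 0 < g' y) := by
  obtain ⟨g₀, -, -, -, hg₀⟩ := exists_definesAt o hs
  filter_upwards [hg₀ g h, hg₀ g' h'] with y h1 h2
  rw [h1, h2]

/-- Transverse curves meet in isolated points. -/
lemma eventually_eq_of_transverse [T2Space R] (hs : GoodParam γ s) (ht : GoodParam δ t)
    (hst : γ s = δ t) {φ : PartialEquiv R Plane} (hφ : OrientedAt o φ (γ s))
    (hc : cross (deriv (φ ∘ γ) s) (deriv (φ ∘ δ) t) ≠ 0) :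
    ∀ᶠ y in 𝓝 (γ s), y ∈ trace γ → y ∈ trace δ → y = γ s := by
  obtain ⟨g, hg, -, -, -⟩ := exists_definesAt o hs
  obtain ⟨κ, hκ, hd⟩ := hg.exists_hasDerivAt hs hφ hst.symm ht.contMDiffAt
  -- The defining function vanishes on all of `γ`, but `g ∘ δ` has nonzero derivative at `t` and so
  -- has no other zero nearby.
  have h1 := hd.eventually_ne (c := 0) (mul_ne_zero hκ.ne' hc)
  rw [eventually_nhdsWithin_iff] at h1
  obtain ⟨ε, hε, hb⟩ := Metric.eventually_nhds_iff_ball.1 h1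
  have h2 := ht.eventually_mem_trace hε
  rw [← hst] at h2
  filter_upwards [h2, hg.zero] with y h3 h4 hy1 hy2
  obtain ⟨t', ht', rfl⟩ := h3 hy2
  by_cases he : t' = t
  · rw [he, hst]
  · exact absurd (h4 hy1) (hb t' ht' he)

/-- A curve is closed and has no inner points in the interior of the surface, because a defining
function becomes positive along a transverse ray. -/
lemma exists_open_disjoint_trace [T2Space R] (o : SurfaceOrientation R) (hγ : IsProperCurve γ)
    {O : Set R} (hO : IsOpen O)
    (hne : O.Nonempty) (hi : O ⊆ (𝓡∂ 2).interior R) :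
    ∃ O' ⊆ O, IsOpen O' ∧ O'.Nonempty ∧ Disjoint O' (trace γ) := by
  refine ⟨O \ trace γ, sdiff_subset, hO.sdiff (isCompact_trace hγ).isClosed, ?_,
    disjoint_sdiff_left⟩
  by_cases hd : ∃ z ∈ O, z ∈ trace γ
  · obtain ⟨z, hz, s, hs, rfl⟩ := hd
    have hg := goodParam_of_mem hγ hs (hi hz)
    obtain ⟨g, h1, h2, -⟩ := exists_definesAt o hg
    have hφ := orientedAt_coord o hg.interior
    have hp := cross_rotLeft_pos (hg.deriv_ne_zero hφ.planarAt)
    have hr := h1.eventually_ray hg hφ hp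
    set u := rotLeft (deriv (o.coord (γ s) ∘ γ) s)
    have ht : Tendsto (fun r : ℝ => (o.coord (γ s)).symm (o.coord (γ s) (γ s) + r • u))
        (𝓝[>] 0) (𝓝 (γ s)) := by
      refine hφ.planarAt.tendsto_symm.comp ?_
      have : Tendsto (fun r : ℝ => o.coord (γ s) (γ s) + r • u) (𝓝 0)
          (𝓝 (o.coord (γ s) (γ s) + (0 : ℝ) • u)) := by
        apply Continuous.tendsto; fun_prop
      rw [zero_smul, add_zero] at this
      exact this.mono_left nhdsWithin_le_nhds
    obtain ⟨r, h3, h4, h5⟩ := (hr.and ((ht.eventually h2).and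
      (ht.eventually (hO.mem_nhds hz)))).exists
    exact ⟨_, h5, fun h6 => h3.1.ne' (h4.2 h6)⟩
  · obtain ⟨z, hz⟩ := hne
    exact ⟨z, hz, fun h => hd ⟨z, hz, h⟩⟩

/-- The complement of finitely many curves is dense near interior points. -/
lemma frequently_notMem_support [T2Space R] (o : SurfaceOrientation R) {ι : Type*} [Finite ι]
    {Γ : ι → ℝ → R} (hΓ : ∀ i, IsProperCurve (Γ i))
    {x : R} (hx : x ∈ (𝓡∂ 2).interior R) : ∃ᶠ y in 𝓝 x, y ∉ support Γ := by
  rw [frequently_iff]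
  intro U hU
  obtain ⟨O, hOU, hO, hxO⟩ := mem_nhds_iff.1 hU
  cases nonempty_fintype ι
  classical
  suffices h : ∀ F : Finset ι, ∃ O' ⊆ O ∩ (𝓡∂ 2).interior R, IsOpen O' ∧ O'.Nonempty ∧
      ∀ i ∈ F, Disjoint O' (trace (Γ i)) by
    obtain ⟨O', h1, h2, ⟨y, hy⟩, h3⟩ := h Finset.univ
    refine ⟨y, hOU (h1 hy).1, fun hs => ?_⟩
    obtain ⟨i, hi⟩ := mem_iUnion.1 hs
    exact disjoint_left.1 (h3 i (Finset.mem_univ i)) hy hi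
  intro F
  induction F using Finset.induction_on with
  | empty => exact ⟨_, subset_rfl, hO.inter isOpen_int, ⟨x, hxO, hx⟩, by simp⟩
  | insert i F _ ih =>
    obtain ⟨O', h1, h2, h3, h4⟩ := ih
    obtain ⟨O'', h5, h6, h7, h8⟩ := exists_open_disjoint_trace o (hΓ i) h2 h3
      (h1.trans inter_subset_right)
    refine ⟨O'', h5.trans h1, h6, h7, fun j hj => ?_⟩
    rcases Finset.mem_insert.1 hj with rfl | hj
    · exact h8
    · exact (h4 j hj).mono_left h5

/-- A function that is locally constant off a curve, with a constant jump across the curve. -/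
theorem eventually_eq_of_jump [T2Space R] {D : R → ℚ} {c : ℚ} (hs : GoodParam γ s)
    (hD : ∀ᶠ y in 𝓝 (γ s), y ∉ trace γ → ∀ᶠ y' in 𝓝 y, D y' = D y) {u : Plane}
    (hu : 0 < cross (deriv (o.coord (γ s) ∘ γ) s) u)
    (hj : ∀ᶠ r in 𝓝[>] (0 : ℝ), D ((o.coord (γ s)).symm (o.coord (γ s) (γ s) + r • u)) =
      D ((o.coord (γ s)).symm (o.coord (γ s) (γ s) - r • u)) + c)
    (hg' : DefinesAt o γ s g') :
    ∃ v, ∀ᶠ y in 𝓝 (γ s), y ∉ trace γ → D y = v + if 0 < g' y then c else 0 := by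
  obtain ⟨g, h1, h2, h3, h4⟩ := exists_definesAt o hs
  obtain ⟨N, hN, hNs, hp, hm⟩ := h3 _ (h2.and hD)
  have hφ := orientedAt_coord o hs.interior
  have ht : ∀ u : Plane, Tendsto (fun r : ℝ => (o.coord (γ s)).symm (o.coord (γ s) (γ s) + r • u))
      (𝓝[>] 0) (𝓝 (γ s)) := by
    intro u
    refine hφ.planarAt.tendsto_symm.comp ?_
    have : Tendsto (fun r : ℝ => o.coord (γ s) (γ s) + r • u) (𝓝 0)
        (𝓝 (o.coord (γ s) (γ s) + (0 : ℝ) • u)) := by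
      apply Continuous.tendsto; fun_prop
    rw [zero_smul, add_zero] at this
    exact this.mono_left nhdsWithin_le_nhds
  have ht' := ht (-u)
  simp only [smul_neg, ← sub_eq_add_neg] at ht'
  obtain ⟨r, ⟨hr1, hr2⟩, hr3, hr4, hr5⟩ := ((h1.eventually_ray hs hφ hu).and
    (hj.and (((ht u).eventually hN).and (ht'.eventually hN)))).exists
  have cp : ∀ y ∈ {y ∈ N | 0 < g y}, ∀ᶠ y' in 𝓝[{y ∈ N | 0 < g y}] y, D y' = D y := fun y hy =>
    ((hNs hy.1).2 (fun h => hy.2.ne' ((hNs hy.1).1.2 h))).filter_mono nhdsWithin_le_nhds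
  have cm : ∀ y ∈ {y ∈ N | g y < 0}, ∀ᶠ y' in 𝓝[{y ∈ N | g y < 0}] y, D y' = D y := fun y hy =>
    ((hNs hy.1).2 (fun h => hy.2.ne ((hNs hy.1).1.2 h))).filter_mono nhdsWithin_le_nhds
  -- The multiplicity on the right of the curve; one short segment across the curve links it to the
  -- multiplicity on the left.
  refine ⟨D ((o.coord (γ s)).symm (o.coord (γ s) (γ s) - r • u)), ?_⟩
  filter_upwards [hN, h4 g' hg'] with y hy hsg hyt
  rw [if_congr hsg rfl rfl]
  rcases lt_trichotomy (g y) 0 with h | h | h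
  · rw [if_neg h.not_gt, add_zero]
    exact constant_of_locally hm cm ⟨hy, h⟩ ⟨hr5, hr2⟩
  · exact absurd ((hNs hy).1.1 h) hyt
  · rw [if_pos h, ← hr3]
    exact constant_of_locally hp cp ⟨hy, h⟩ ⟨hr4, hr1⟩

/-! ### Potentials -/

/-- Near `x`, the function `h` is constant, except for a unit jump across `γ`. -/
def LocPot (o : SurfaceOrientation R) (γ : ℝ → R) (h : R → ℝ) (x : R) : Prop :=
  (x ∉ trace γ ∧ ∀ᶠ y in 𝓝 x, h y = h x) ∨
    ∃ s, GoodParam γ s ∧ γ s = x ∧ ∃ g, DefinesAt o γ s g ∧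
      ∀ᶠ y in 𝓝 x, h y = h x + if 0 < g y then 1 else 0

/-- On the curve a local potential takes its value from the right, because `0 < g` fails there. With
this convention two local potentials differ by a constant on a full neighbourhood, which is what
gluing requires. -/
lemma LocPot.sub_eq [T2Space R] {h h' : R → ℝ} {x : R} (H : LocPot o γ h x)
    (H' : LocPot o γ h' x) : ∀ᶠ y in 𝓝 x, h y = h' y + (h x - h' x) := by
  rcases H with ⟨hx, H⟩ | ⟨s, hs, rfl, g, hg, H⟩
  · rcases H' with ⟨-, H'⟩ | ⟨s', hs', rfl, g', hg', H'⟩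
    · filter_upwards [H, H'] with y h1 h2
      rw [h1, h2]; ring
    · exact absurd hs'.mem_trace hx
  · rcases H' with ⟨hx, H'⟩ | ⟨s', hs', hx, g', hg', H'⟩
    · exact absurd hs.mem_trace hx
    · have h3 := hg.sign_eq (hg'.of_eq hs' hs hx) hs
      filter_upwards [H, H', h3] with y h1 h2 h3
      rw [h1, h2, if_congr h3 rfl rfl]; ring

/-- The indicator function of the left side of the curve, or zero away from the curve. -/
lemma exists_locPot [T2Space R] (o : SurfaceOrientation R) (hγ : IsProperCurve γ) {x : R}
    (hx : x ∈ (𝓡∂ 2).interior R) :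
    ∃ h : R → ℝ, (∀ y, ∃ n : ℤ, h y = n) ∧ ∀ᶠ y in 𝓝 x, LocPot o γ h y := by
  by_cases hxt : x ∈ trace γ
  · obtain ⟨s, hs, rfl⟩ := hxt
    have hg := goodParam_of_mem hγ hs hx
    obtain ⟨g, h1, h2, -, -⟩ := exists_definesAt o hg
    refine ⟨fun y => if 0 < g y then 1 else 0, fun y => ?_, ?_⟩
    · by_cases h : 0 < g y
      · exact ⟨1, by simp [h]⟩
      · exact ⟨0, by simp [h]⟩
    · obtain ⟨ε, hε, hb⟩ := Metric.eventually_nhds_iff_ball.1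
        ((h1.eventually_definesAt hg).and hg.eventually_goodParam)
      filter_upwards [h2, (contMDiffAt_iff_contMDiffAt_nhds (by simp)).1 h1.smooth, hg.eventually_mem_trace hε]
        with y h3 h4 h5
      by_cases hy : y ∈ trace γ
      · obtain ⟨t, ht, rfl⟩ := h5 hy
        refine Or.inr ⟨t, (hb t ht).2, rfl, g, (hb t ht).1, Eventually.of_forall fun y' => ?_⟩
        simp [h3.2 hy]
      · refine Or.inl ⟨hy, ?_⟩
        rcases lt_or_gt_of_ne (fun h => hy (h3.1 h)) with h | h
        · filter_upwards [h4.continuousAt.eventually (gt_mem_nhds h)] with y' hy'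
          simp [h.not_gt, not_lt.2 (le_of_lt (show g y' < 0 from hy'))]
        · filter_upwards [h4.continuousAt.eventually (lt_mem_nhds h)] with y' hy'
          simp [h, show 0 < g y' from hy']
  · refine ⟨fun _ => 0, fun _ => ⟨0, by simp⟩, ?_⟩
    filter_upwards [(isCompact_trace hγ).isClosed.isOpen_compl.mem_nhds hxt] with y hy
    exact Or.inl ⟨hy, by simp⟩

/-- A function that is continuous in the interior of the surface, except for a unit jump
across `γ`. -/
def IsPotential (o : SurfaceOrientation R) (γ : ℝ → R) (Φ : R → ℝ) : Prop :=
  ∀ x ∈ (𝓡∂ 2).interior R, ∃ ψ h : R → ℝ, (∀ᶠ y in 𝓝 x, ContinuousAt ψ y) ∧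
    (∀ᶠ y in 𝓝 x, LocPot o γ h y) ∧ (∀ y, ∃ n : ℤ, h y = n) ∧ ∀ᶠ y in 𝓝 x, Φ y = ψ y + h y

/-- Local potentials are averaged by a partition of unity. Near `x` each of those involved differs
from `h x'` by a constant, and the weights add up to 1. Hence the average is `h x'` plus a
combination of the weights with constant coefficients, which is continuous. -/
theorem exists_isPotential [T2Space R] [CompactSpace R] (o : SurfaceOrientation R)
    (hγ : IsProperCurve γ) : ∃ Φ, IsPotential o γ Φ := by
  classical
  -- Compactness of the surface serves only to make the interior metrizable, so that partitions of
  -- unity exist.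
  have : SecondCountableTopology (EuclideanHalfSpace 2) :=
    inferInstanceAs (SecondCountableTopology {x : EuclideanSpace ℝ (Fin 2) // 0 ≤ x 0})
  have : SecondCountableTopology R :=
    ChartedSpace.secondCountable_of_sigmaCompact (EuclideanHalfSpace 2) R
  let Y := ((𝓡∂ 2).interior R : Set R)
  have : TopologicalSpace.MetrizableSpace Y := inferInstance
  let _ := TopologicalSpace.metrizableSpaceMetric Y
  choose h hint hloc using fun x : Y => exists_locPot o hγ x.2
  choose N hN hNo hxN using fun x : Y => eventually_nhds_iff.1 (hloc x)
  obtain ⟨f, hf⟩ := PartitionOfUnity.exists_isSubordinate (X := Y) (isClosed_univ)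
    (fun x : Y => (Subtype.val ⁻¹' N x : Set Y))
    (fun x => (hNo x).preimage continuous_subtype_val)
    (fun x _ => mem_iUnion.2 ⟨x, hxN x⟩)
  have hemb : IsOpenEmbedding (Subtype.val : Y → R) := isOpen_int.isOpenEmbedding_subtypeVal
  refine ⟨fun x => if hx : x ∈ Y then ∑ᶠ i, f i ⟨x, hx⟩ * h i x else 0, fun x hx => ?_⟩
  obtain ⟨F, n, hn, hnF, hFs⟩ := f.exists_finset_nhds_support_subset hf
    (fun x => (hNo x).preimage continuous_subtype_val) ⟨x, hx⟩
  let x' : Y := ⟨x, hx⟩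
  have hxn : x' ∈ n := mem_of_mem_nhds hn
  let ψ : R → ℝ := fun y => if hy : y ∈ Y then ∑ i ∈ F, f i ⟨y, hy⟩ * (h i x - h x' x) else 0
  have hn' : Subtype.val '' n ∈ 𝓝 x := hemb.isOpenMap.image_mem_nhds hn
  have hsub : ∀ i ∈ F, ∀ᶠ y in 𝓝 x, h i y = h x' y + (h i x - h x' x) := by
    intro i hi
    have h1 : x ∈ N i := mem_iInter₂.1 (hnF hxn) i hi
    exact LocPot.sub_eq (hN i x h1) (hN x' x (hxN x'))
  refine ⟨ψ, h x', ?_, hloc x', hint x', ?_⟩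
  · filter_upwards [isOpen_int.mem_nhds hx] with y hy
    have h1 : ContinuousAt (ψ ∘ (Subtype.val : Y → R)) ⟨y, hy⟩ := by
      have : ψ ∘ (Subtype.val : Y → R) = fun y => ∑ i ∈ F, f i y * (h i x - h x' x) := by
        ext y
        simp [ψ, y.2]
      rw [this]
      exact (continuous_finsetSum _ fun i _ => (f i).continuous.mul continuous_const).continuousAt
    exact hemb.continuousAt_iff.1 h1
  · filter_upwards [hn', (F.eventually_all).2 hsub] with y hyn hyF
    obtain ⟨y, hyn, rfl⟩ := hyn
    have e0 : ∑ᶠ i, f i y * h i y = ∑ i ∈ F, f i y * h i y := by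
      refine finsum_eq_sum_of_support_subset _ fun i hi => hFs y hyn ?_
      intro h0
      exact hi (by simp only [h0, zero_mul])
    have e1 : ∑ i ∈ F, f i y = 1 := by
      rw [← f.sum_eq_one (mem_univ y), finsum_eq_sum_of_support_subset _ (hFs y hyn)]
    simp only [ψ, y.2, dite_true, Subtype.coe_eta]
    rw [e0, Finset.sum_congr rfl fun i hi => by rw [hyF i hi, mul_add], Finset.sum_add_distrib,
      ← Finset.sum_mul, e1]
    ring

/-- The discontinuous part `h` of a potential is integer-valued and disappears modulo 1. -/
lemma IsPotential.continuousAt_coe {Φ : R → ℝ} (hΦ : IsPotential o γ Φ) {x : R}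
    (hx : x ∈ (𝓡∂ 2).interior R) : ContinuousAt (fun y => (Φ y : AddCircle (1 : ℝ))) x := by
  obtain ⟨ψ, h, h1, -, h3, h4⟩ := hΦ x hx
  have h5 : ContinuousAt (fun y => (ψ y : AddCircle (1 : ℝ))) x :=
    ContinuousAt.comp (g := fun z : ℝ => (z : AddCircle (1 : ℝ)))
      (AddCircle.continuous_mk' 1).continuousAt h1.self_of_nhds
  refine h5.congr ?_
  filter_upwards [h4] with y hy
  rw [hy, eq_comm, coe_addCircle_eq_iff]
  obtain ⟨n, hn⟩ := h3 y
  exact ⟨n, by rw [hn]; ring⟩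

lemma IsPotential.continuous_coe_comp {Φ : R → ℝ} (hΦ : IsPotential o γ Φ) {A : Type*}
    [TopologicalSpace A] {c : A → R} (hc : Continuous c) (hi : ∀ a, c a ∈ (𝓡∂ 2).interior R) :
    Continuous (fun a => (Φ (c a) : AddCircle (1 : ℝ))) :=
  continuous_iff_continuousAt.2 fun a =>
    ContinuousAt.comp (f := c) (hΦ.continuousAt_coe (hi a)) hc.continuousAt

end Winding

/-! ### Turns of a closed curve as an intersection number. -/

namespace Winding

lemma eventually_eq_of_int {X : Type*} [TopologicalSpace X] {f : X → ℝ} {x : X}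
    (hf : ContinuousAt f x) (hi : ∀ᶠ y in 𝓝 x, ∃ n : ℤ, f y = n) : ∀ᶠ y in 𝓝 x, f y = f x := by
  have := hf.eventually (Metric.ball_mem_nhds (f x) one_pos)
  filter_upwards [this, hi] with y hy ⟨n, hn⟩
  obtain ⟨m, hm⟩ := hi.self_of_nhds
  rw [Real.dist_eq, abs_lt, hn, hm] at hy
  rw [hn, hm]
  have h1 : (n : ℝ) < m + 1 := by linarith [hy.2]
  have h2 : (m : ℝ) < n + 1 := by linarith [hy.1]
  have h3 : n < m + 1 := by exact_mod_cast h1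
  have h4 : m < n + 1 := by exact_mod_cast h2
  rw [show n = m by omega]

/-- The total change of a function with finitely many jumps is the sum of the jumps. -/
lemma sum_jumps {H a b : ℝ → ℝ} (hb : ∀ s ∈ Icc (0 : ℝ) 1, ∀ᶠ t in 𝓝[>] s, H t = b s)
    (ha : ∀ s ∈ Icc (0 : ℝ) 1, ∀ᶠ t in 𝓝[<] s, H t = a s) (F : Finset ℝ)
    (hF : ∀ s ∈ Ico (0 : ℝ) 1, s ∉ F → b s = a s) (hF' : ∀ s ∈ F, s ∈ Ico (0 : ℝ) 1) :
    a 1 - a 0 = ∑ s ∈ F, (b s - a s) := by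
  classical
  -- The left limit, corrected by the jumps already passed, is locally constant on `[0,1]`.
  let G : ℝ → ℝ := fun s => a s - ∑ f ∈ F.filter (· < s), (b f - a f)
  have hc : ∀ s₀ ∈ Icc (0 : ℝ) 1, ∀ᶠ s in 𝓝[Icc (0 : ℝ) 1] s₀, G s = G s₀ := by
    intro s₀ hs₀
    have hfin : ∀ᶠ s in 𝓝 s₀, ∀ f ∈ F, (f < s₀ → f < s) ∧ (s₀ < f → s < f) := by
      rw [F.eventually_all]
      intro f _
      refine (eventually_imp_distrib_left.2 fun h => lt_mem_nhds h).and
        (eventually_imp_distrib_left.2 fun h => gt_mem_nhds h)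
    have hR : ∀ᶠ s in 𝓝[>] s₀, s ∈ Icc (0 : ℝ) 1 → G s = G s₀ := by
      have h1 := eventually_eventually_nhdsWithin.2 (hb s₀ hs₀)
      filter_upwards [h1, hfin.filter_mono nhdsWithin_le_nhds, self_mem_nhdsWithin]
        with s h1 h2 (h3 : s₀ < s) hs
      have h4 : a s = b s₀ := by
        have h5 : ∀ᶠ t in 𝓝[<] s, H t = b s₀ := by
          rw [nhdsWithin_eq_nhds.2 (Ioi_mem_nhds h3)] at h1
          exact h1.filter_mono nhdsWithin_le_nhds
        obtain ⟨t, ht1, ht2⟩ := (h5.and (ha s hs)).exists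
        rw [← ht1, ht2]
      have h6 : F.filter (· < s) = F.filter (· < s₀) ∪ F.filter (· = s₀) := by
        ext f
        simp only [Finset.mem_filter, Finset.mem_union]
        constructor
        · rintro ⟨hf, hfs⟩
          rcases lt_trichotomy f s₀ with h | h | h
          · exact Or.inl ⟨hf, h⟩
          · exact Or.inr ⟨hf, h⟩
          · exact absurd ((h2 f hf).2 h) hfs.not_gt
        · rintro (⟨hf, h⟩ | ⟨hf, rfl⟩)
          · exact ⟨hf, h.trans h3⟩
          · exact ⟨hf, h3⟩
      have h7 : Disjoint (F.filter (· < s₀)) (F.filter (· = s₀)) := by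
        rw [Finset.disjoint_filter]
        intro f _ h h'
        exact h.ne h'
      simp only [G]
      rw [h6, Finset.sum_union h7, h4, Finset.sum_filter (· = s₀), Finset.sum_ite_eq' F s₀]
      split_ifs with h8
      · ring
      · have h9 : s₀ ∈ Ico (0 : ℝ) 1 := ⟨hs₀.1, h3.trans_le hs.2⟩
        rw [hF s₀ h9 h8]; ring
    have hL : ∀ᶠ s in 𝓝[<] s₀, s ∈ Icc (0 : ℝ) 1 → G s = G s₀ := by
      have h1 := eventually_eventually_nhdsWithin.2 (ha s₀ hs₀)
      filter_upwards [h1, hfin.filter_mono nhdsWithin_le_nhds, self_mem_nhdsWithin]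
        with s h1 h2 (h3 : s < s₀) hs
      have h4 : a s = a s₀ := by
        have h5 : ∀ᶠ t in 𝓝[<] s, H t = a s₀ := by
          rw [nhdsWithin_eq_nhds.2 (Iio_mem_nhds h3)] at h1
          exact h1.filter_mono nhdsWithin_le_nhds
        obtain ⟨t, ht1, ht2⟩ := (h5.and (ha s hs)).exists
        rw [← ht1, ht2]
      have h6 : F.filter (· < s) = F.filter (· < s₀) := by
        apply Finset.filter_congr
        intro f hf
        exact ⟨fun h => h.trans h3, fun h => (h2 f hf).1 h⟩
      simp only [G]
      rw [h6, h4]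
    rw [eventually_nhdsWithin_iff] at hR hL ⊢
    filter_upwards [hR, hL] with s h1 h2 hs
    rcases lt_trichotomy s s₀ with h | h | h
    · exact h2 h hs
    · rw [h]
    · exact h1 h hs
  have key := constant_of_locally isPreconnected_Icc hc (left_mem_Icc.2 zero_le_one)
    (right_mem_Icc.2 zero_le_one)
  have e0 : F.filter (· < (0 : ℝ)) = ∅ :=
    Finset.filter_eq_empty_iff.2 fun f hf => not_lt.2 (hF' f hf).1
  have e1 : F.filter (· < (1 : ℝ)) = F := Finset.filter_eq_self.2 fun f hf => (hF' f hf).2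
  simp only [G, e0, e1, Finset.sum_empty, sub_zero] at key
  linarith

variable {R : Type*} [TopologicalSpace R] [ChartedSpace (EuclideanHalfSpace 2) R]
  [IsManifold (𝓡∂ 2) ∞ R] {o : SurfaceOrientation R} {c ξ : ℝ → R} {s t : ℝ}

lemma cross_change {φ ψ : PartialEquiv R Plane} (hφ : PlanarAt φ (c s)) (hψ : PlanarAt ψ (c s))
    (hc : ContMDiffAt 𝓘(ℝ, ℝ) (𝓡∂ 2) ∞ c s) (hξ : ContMDiffAt 𝓘(ℝ, ℝ) (𝓡∂ 2) ∞ ξ t)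
    (hst : c s = ξ t) :
    cross (deriv (ψ ∘ c) s) (deriv (ψ ∘ ξ) t) =
      (fderiv ℝ (ψ ∘ φ.symm) (φ (c s))).det * cross (deriv (φ ∘ c) s) (deriv (φ ∘ ξ) t) := by
  rw [PlanarAt.deriv_change hφ hψ hc, PlanarAt.deriv_change (hst ▸ hφ) (hst ▸ hψ) hξ, ← hst,
    cross_map]

/-- Transversality, read in arbitrary planar coordinates. -/
lemma transverse_iff {φ : PartialEquiv R Plane} (hs : s ∈ unitI) (ht : t ∈ unitI)
    (hφ : PlanarAt φ (c s))
    (hc : ContMDiffAt 𝓘(ℝ, ℝ) (𝓡∂ 2) ∞ c s) (hξ : ContMDiffAt 𝓘(ℝ, ℝ) (𝓡∂ 2) ∞ ξ t)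
    (hst : c s = ξ t) :
    cross (velIn (extChartAt (𝓡∂ 2) (c s)) c s) (velIn (extChartAt (𝓡∂ 2) (c s)) ξ t) ≠ 0 ↔
      cross (deriv (φ ∘ c) s) (deriv (φ ∘ ξ) t) ≠ 0 := by
  have hψ := planarAt_extChartAt hφ.interior
  rw [GoodParam.velIn_eq hs hc hψ, GoodParam.velIn_eq ht hξ (hst ▸ hψ), cross_change hφ hψ hc hξ hst]
  rw [mul_ne_zero_iff]
  exact ⟨fun h => h.2, fun h => ⟨PlanarAt.det_change_ne_zero hφ hψ, h⟩⟩

lemma GoodParam.exists_mem_Ico (h : GoodParam ξ t) : ∃ t' ∈ Ico (0 : ℝ) 1, ξ t' = ξ t := by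
  rcases h with h | ⟨h, ht⟩
  · simpa using h.exists_mem (h.mem_trace t) 0
  · exact ⟨t, ⟨ht.1.le, ht.2⟩, rfl⟩

lemma IsProperCurve.injOn_Ico (h : IsProperCurve ξ) : InjOn ξ (Ico 0 1) := by
  rcases h with h | h
  · exact h.injOn
  · exact h.injOn.mono Ico_subset_Icc_self

/-- A closed curve turns around the circle, with respect to a potential of `ξ`, as often as it
crosses `ξ`. -/
theorem hasTurn_signedCount [T2Space R] (hc : IsClosedCurve c) (hξ : IsProperCurve ξ)
    (htr : Transverse c ξ) {Φ : R → ℝ} (hΦ : IsPotential o ξ Φ) :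
    HasTurn (fun s => (Φ (c s) : AddCircle (1 : ℝ))) (signedCount o c ξ) := by
  classical
  obtain ⟨L, hL, hLf⟩ := exists_lift (hΦ.continuous_coe_comp hc.smooth.continuous hc.interior)
  refine ⟨L, hL, hLf, ?_⟩
  -- An integer-valued function which is locally constant off `ξ` and jumps by minus the sign of
  -- each crossing. Over one period it changes by `-(L 1 - L 0)`, so summing the jumps gives the
  -- claim.
  let H : ℝ → ℝ := fun s => Φ (c s) - L s
  have hHint : ∀ s, ∃ n : ℤ, H s = n := fun s => coe_addCircle_eq_iff.1 (hLf s).symm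
  -- With `Φ = ψ + h` near `c s`, the function `ψ ∘ c - L` is continuous and integer-valued. Thus
  -- `H` varies exactly as `h ∘ c`.
  have hform : ∀ s, ∃ h : R → ℝ, LocPot o ξ h (c s) ∧
      ∀ᶠ t in 𝓝 s, H t = H s - h (c s) + h (c t) := by
    intro s
    obtain ⟨ψ, h, h1, h2, h3, h4⟩ := hΦ (c s) (hc.interior s)
    refine ⟨h, h2.self_of_nhds, ?_⟩
    have hcs : ContinuousAt c s := hc.smooth.continuous.continuousAt
    have h5 : ContinuousAt (fun t => ψ (c t) - L t) s :=
      (ContinuousAt.comp (f := c) h1.self_of_nhds hcs).sub hL.continuousAt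
    have h6 : ∀ᶠ t in 𝓝 s, ψ (c t) - L t = H t - h (c t) := by
      filter_upwards [hcs.eventually h4] with t ht
      simp only [H, ht]; ring
    have h7 := eventually_eq_of_int h5 (by
      filter_upwards [h6] with t ht
      obtain ⟨n, hn⟩ := hHint t
      obtain ⟨m, hm⟩ := h3 (c t)
      exact ⟨n - m, by rw [ht, hn, hm]; push_cast; ring⟩)
    filter_upwards [h6, h7] with t h8 h9
    have h10 := h6.self_of_nhds
    linarith
  have hcr : ∀ s ∈ unitI, ∀ t ∈ unitI, c s = ξ t →
      cross (deriv (o.coord (c s) ∘ c) s) (deriv (o.coord (c s) ∘ ξ) t) ≠ 0 := by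
    intro s hs t ht hst
    have hg : GoodParam ξ t := goodParam_of_mem hξ ht (hst ▸ hc.interior s)
    exact (transverse_iff hs ht (orientedAt_coord o (hc.interior s)).planarAt (hc.smooth s)
      hg.contMDiffAt hst).1 (htr s hs t ht hst)
  have hoff : ∀ s, c s ∉ trace ξ → ∀ᶠ t in 𝓝 s, H t = H s := by
    intro s hs
    obtain ⟨h, h1, h2⟩ := hform s
    rcases h1 with ⟨-, h1⟩ | ⟨t, ht, hts, -⟩
    · filter_upwards [h2, hc.smooth.continuous.continuousAt.eventually h1] with t h3 h4
      rw [h3, h4]; ring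
    · exact absurd (hts ▸ ht.mem_trace) hs
  have hon : ∀ s ∈ unitI, ∀ t ∈ unitI, c s = ξ t → ∃ a b : ℝ,
      (∀ᶠ t in 𝓝[>] s, H t = b) ∧ (∀ᶠ t in 𝓝[<] s, H t = a) ∧
      b - a = -(crossSign o c ξ s t : ℝ) ∧ ∀ᶠ s' in 𝓝[≠] s, c s' ∉ trace ξ := by
    intro s hs t ht hst
    have hg : GoodParam ξ t := goodParam_of_mem hξ ht (hst ▸ hc.interior s)
    obtain ⟨h, h1, h2⟩ := hform s
    have hne := hcr s hs t ht hst
    rcases h1 with ⟨h1, -⟩ | ⟨t', ht', hts', g, hg', h1⟩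
    · exact absurd (hst ▸ hg.mem_trace) h1
    have hgt : DefinesAt o ξ t g := hg'.of_eq ht' hg (hts'.trans hst)
    have hφ := orientedAt_coord o (hc.interior s)
    obtain ⟨κ, hκ, hd⟩ := hgt.exists_hasDerivAt (φ := o.coord (c s)) hg
      (by rw [← hst]; exact hφ) hst (hc.smooth s)
    have hg0 : g (c s) = 0 := by rw [hst]; exact hgt.apply_eq_zero hg
    have hH : ∀ᶠ t in 𝓝 s, H t = H s + if 0 < g (c t) then 1 else 0 := by
      filter_upwards [h2, hc.smooth.continuous.continuousAt.eventually h1] with t h3 h4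
      rw [h3, h4]; ring
    have hiso : ∀ᶠ s' in 𝓝[≠] s, c s' ∉ trace ξ := by
      have h5 := hd.eventually_ne (c := 0) (mul_ne_zero hκ.ne' (by
        rw [cross_swap]; exact neg_ne_zero.2 hne))
      have h6 := hgt.zero
      rw [← hst] at h6
      filter_upwards [h5, (hc.smooth.continuous.continuousAt.eventually h6).filter_mono
        nhdsWithin_le_nhds] with s' h7 h8 h9
      exact h7 (h8 h9)
    have hsgn : (crossSign o c ξ s t : ℝ) =
        ((SignType.sign (cross (deriv (o.coord (c s) ∘ c) s) (deriv (o.coord (c s) ∘ ξ) t)) : ℤ)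
          : ℝ) := by
      rw [crossSign, GoodParam.velIn_eq hs (hc.smooth s) hφ.planarAt,
        GoodParam.velIn_eq ht hg.contMDiffAt (hst ▸ hφ.planarAt)]
    have hslope : Tendsto (fun t => (t - s)⁻¹ * g (c t)) (𝓝[≠] s)
        (𝓝 (κ * cross (deriv (o.coord (c s) ∘ ξ) t) (deriv (o.coord (c s) ∘ c) s))) := by
      refine hd.tendsto_slope.congr fun t => ?_
      rw [slope_def_field]
      simp only [comp_apply, hg0, sub_zero]
      rw [div_eq_inv_mul]
    -- The derivative of `g ∘ c` involves `ξ` first and `c` second, in the order opposite to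
    -- `crossSign`: a positive crossing leads from the left of `ξ` to its right, and `H` drops.
    rw [cross_swap] at hslope
    have hgr : 𝓝[>] s ≤ 𝓝[≠] s := nhdsWithin_mono _ fun x (hx : s < x) => hx.ne'
    have hgl : 𝓝[<] s ≤ 𝓝[≠] s := nhdsWithin_mono _ fun x (hx : x < s) => hx.ne
    rw [hsgn]
    rcases lt_or_gt_of_ne hne with hlt | hgt'
    · refine ⟨H s, H s + 1, ?_, ?_, by simp [sign_neg hlt], hiso⟩
      · have h5 := (hslope.eventually (lt_mem_nhds (mul_pos hκ (neg_pos.2 hlt)))).filter_mono hgr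
        filter_upwards [h5, hH.filter_mono nhdsWithin_le_nhds, self_mem_nhdsWithin]
          with t h6 h7 (h8 : s < t)
        rw [h7, if_pos ((pos_iff_pos_of_mul_pos h6).1 (inv_pos.2 (by linarith)))]
      · have h5 := (hslope.eventually (lt_mem_nhds (mul_pos hκ (neg_pos.2 hlt)))).filter_mono hgl
        filter_upwards [h5, hH.filter_mono nhdsWithin_le_nhds, self_mem_nhdsWithin]
          with t h6 h7 (h8 : t < s)
        rw [h7, if_neg ((neg_iff_neg_of_mul_pos h6).1 (inv_lt_zero.2 (by linarith))).not_gt,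
          add_zero]
    · have hpos : κ * -cross (deriv (o.coord (c s) ∘ c) s) (deriv (o.coord (c s) ∘ ξ) t) < 0 := by
        nlinarith [mul_pos hκ hgt']
      refine ⟨H s + 1, H s, ?_, ?_, by simp [sign_pos hgt'], hiso⟩
      · have h5 := (hslope.eventually (gt_mem_nhds hpos)).filter_mono hgr
        filter_upwards [h5, hH.filter_mono nhdsWithin_le_nhds, self_mem_nhdsWithin]
          with t h6 h7 (h8 : s < t)
        have h9 : 0 < (t - s)⁻¹ := inv_pos.2 (by linarith)
        rw [h7, if_neg (fun h => by nlinarith [mul_pos h9 h]), add_zero]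
      · have h5 := (hslope.eventually (gt_mem_nhds hpos)).filter_mono hgl
        filter_upwards [h5, hH.filter_mono nhdsWithin_le_nhds, self_mem_nhdsWithin]
          with t h6 h7 (h8 : t < s)
        have h9 : (t - s)⁻¹ < 0 := inv_lt_zero.2 (by linarith)
        rw [h7, if_pos (by by_contra h; push Not at h; nlinarith [mul_nonneg_of_nonpos_of_nonpos h9.le h])]
  have hlim : ∀ s, ∃ a b : ℝ, s ∈ unitI → (∀ᶠ t in 𝓝[>] s, H t = b) ∧
      (∀ᶠ t in 𝓝[<] s, H t = a) ∧ (c s ∉ trace ξ → b = a) ∧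
      ∀ t ∈ unitI, c s = ξ t → b - a = -(crossSign o c ξ s t : ℝ) := by
    intro s
    by_cases hs : s ∈ unitI
    swap
    · exact ⟨0, 0, fun h => absurd h hs⟩
    by_cases hst : c s ∈ trace ξ
    · obtain ⟨t, ht, hts⟩ := hst
      obtain ⟨a, b, h1, h2, h3, -⟩ := hon s hs t ht hts.symm
      refine ⟨a, b, fun _ => ⟨h1, h2, fun h => absurd ⟨t, ht, hts⟩ h, fun t' ht' hts' => ?_⟩⟩
      obtain ⟨a', b', h1', h2', h3', -⟩ := hon s hs t' ht' hts'
      obtain ⟨x, hx1, hx2⟩ := (h1.and h1').exists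
      obtain ⟨y, hy1, hy2⟩ := (h2.and h2').exists
      rw [← h3', ← hx1, ← hx2, ← hy1, ← hy2]
    · refine ⟨H s, H s, fun _ => ⟨(hoff s hst).filter_mono nhdsWithin_le_nhds,
        (hoff s hst).filter_mono nhdsWithin_le_nhds, fun _ => rfl, fun t ht hts => ?_⟩⟩
      exact absurd ⟨t, ht, hts.symm⟩ hst
  choose a b hab using hlim
  let E : Set ℝ := {s | s ∈ Ico (0 : ℝ) 1 ∧ c s ∈ trace ξ}
  have hE : E.Finite := by
    have hK : ({s | s ∈ Icc (0 : ℝ) 1 ∧ c s ∈ trace ξ} ∩ Icc (0 : ℝ) 1).Finite := by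
      refine isCompact_Icc.induction_on
        (p := fun T => ({s | s ∈ Icc (0 : ℝ) 1 ∧ c s ∈ trace ξ} ∩ T).Finite) (by simp) ?_ ?_ ?_
      · intro s t hst ht
        exact ht.subset (inter_subset_inter_right _ hst)
      · intro s t hs ht
        rw [inter_union_distrib_left]
        exact hs.union ht
      · intro s hs
        by_cases hst : c s ∈ trace ξ
        · obtain ⟨t, ht, hts⟩ := hst
          obtain ⟨_, _, -, -, -, h4⟩ := hon s hs t ht hts.symm
          rw [eventually_nhdsWithin_iff] at h4
          refine ⟨_, mem_nhdsWithin_of_mem_nhds h4, (finite_singleton s).subset ?_⟩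
          rintro s' ⟨⟨-, h5⟩, h6⟩
          by_contra h7
          exact h6 h7 h5
        · have h4 : ∀ᶠ s' in 𝓝 s, c s' ∉ trace ξ :=
            hc.smooth.continuous.continuousAt.eventually
              ((isCompact_trace hξ).isClosed.isOpen_compl.mem_nhds hst)
          refine ⟨_, mem_nhdsWithin_of_mem_nhds h4, finite_empty.subset ?_⟩
          rintro s' ⟨⟨-, h5⟩, h6⟩
          exact h6 h5
    exact hK.subset fun s hs => ⟨⟨Ico_subset_Icc_self hs.1, hs.2⟩, Ico_subset_Icc_self hs.1⟩
  have hsum := sum_jumps (H := H) (a := a) (b := b) (fun s hs => (hab s hs).1)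
    (fun s hs => (hab s hs).2.1) hE.toFinset
    (fun s hs hsE => (hab s (Ico_subset_Icc_self hs)).2.2.1 fun h => hsE (by simpa using ⟨hs, h⟩))
    (fun s hs => (by simpa using hs : s ∈ E).1)
  -- The period relates the left limits at 0 and at 1. The one at 0 uses negative parameters, where
  -- `c` is still defined.
  have hper : a 1 = a 0 - (L 1 - L 0) := by
    have h1 := (hab 1 (right_mem_Icc.2 zero_le_one)).2.1
    have h0 := (hab 0 (left_mem_Icc.2 zero_le_one)).2.1
    have hsh : ∀ s, H (s + 1) = H s - (L 1 - L 0) := by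
      intro s
      have := lift_sub_eq (A := ℝ) (L := fun x => L (x + 1)) (L' := fun x => L x) (by fun_prop)
        (by fun_prop) (fun x => by rw [hLf, hLf, hc.periodic]) s 0
      simp only [zero_add] at this
      simp only [H, hc.periodic]
      linarith
    have ht : Tendsto (fun s : ℝ => s + 1) (𝓝[<] 0) (𝓝[<] 1) := by
      refine tendsto_nhdsWithin_iff.2 ⟨?_, ?_⟩
      · have : Tendsto (fun s : ℝ => s + 1) (𝓝 0) (𝓝 (0 + 1)) :=
          (continuous_add_const 1).tendsto 0
        rw [zero_add] at this
        exact this.mono_left nhdsWithin_le_nhds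
      · filter_upwards [self_mem_nhdsWithin] with s hs
        have : s < 0 := hs
        change s + 1 < 1
        linarith
    obtain ⟨s, h2, h3⟩ := ((ht.eventually h1).and h0).exists
    rw [← h2, ← h3, hsh]
  have hfs : (signedCount o c ξ : ℝ) = - ∑ s ∈ hE.toFinset, (b s - a s) := by
    let Q : Set (ℝ × ℝ) := {q | q.1 ∈ Ico (0 : ℝ) 1 ∧ q.2 ∈ Ico (0 : ℝ) 1 ∧ c q.1 = ξ q.2}
    -- A crossing is determined by its parameter on `c`, since `ξ` is injective on `[0,1)`.
    have hbij : BijOn Prod.fst Q E := by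
      refine ⟨?_, ?_, ?_⟩
      · rintro q ⟨h1, h2, h3⟩
        exact ⟨h1, q.2, Ico_subset_Icc_self h2, h3.symm⟩
      · rintro ⟨q1, q2⟩ ⟨h1, h2, h3⟩ ⟨p1, p2⟩ ⟨h1', h2', h3'⟩ hqp
        simp only at h1 h2 h3 h1' h2' h3' hqp
        subst hqp
        rw [hξ.injOn_Ico h2 h2' (h3.symm.trans h3')]
      · rintro s ⟨hs, t, ht, hts⟩
        have hg : GoodParam ξ t := goodParam_of_mem hξ ht (hts ▸ hc.interior s)
        obtain ⟨t', ht', htt'⟩ := hg.exists_mem_Ico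
        exact ⟨(s, t'), ⟨hs, ht', by rw [htt', hts]⟩, rfl⟩
    have hQ : Q.Finite := Set.Finite.of_finite_image (hbij.image_eq ▸ hE) hbij.injOn
    have e1 : (signedCount o c ξ : ℝ) = ∑ᶠ q ∈ Q, (crossSign o c ξ q.1 q.2 : ℝ) := by
      rw [signedCount]
      rw [finsum_mem_eq_finite_toFinset_sum _ hQ, finsum_mem_eq_finite_toFinset_sum _ hQ]
      push_cast
      rfl
    rw [e1, finsum_mem_eq_of_bijOn (g := fun s => -(b s - a s)) Prod.fst hbij ?_,
      finsum_mem_eq_finite_toFinset_sum _ hE, Finset.sum_neg_distrib]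
    rintro q ⟨h1, h2, h3⟩
    have := (hab q.1 (Ico_subset_Icc_self h1)).2.2.2 q.2 (Ico_subset_Icc_self h2) h3
    rw [this, neg_neg]
  rw [hfs, ← hsum, hper]
  ring

/-- A single intersection point has a single pair of parameters in `[0,1)`, and transversality makes
its sign nonzero. -/
lemma signedCount_of_meetOnce (hτ : IsCircle c) (hξ : IsProperCurve ξ)
    (h : MeetOnce c ξ) : signedCount o c ξ = 1 ∨ signedCount o c ξ = -1 := by
  obtain ⟨⟨p, hp⟩, htr⟩ := h
  have hpm : p ∈ trace c ∩ trace ξ := hp ▸ mem_singleton p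
  obtain ⟨s, hs, hsp⟩ := hτ.exists_mem hpm.1 0
  rw [zero_add] at hs
  have hpi : p ∈ (𝓡∂ 2).interior R := hsp ▸ hτ.interior s
  obtain ⟨t₀, ht₀, ht₀p⟩ := hpm.2
  have hg₀ : GoodParam ξ t₀ := goodParam_of_mem hξ ht₀ (ht₀p ▸ hpi)
  obtain ⟨t, ht, htt⟩ := hg₀.exists_mem_Ico
  have htp : ξ t = p := htt.trans ht₀p
  have hst : c s = ξ t := hsp.trans htp.symm
  have hQ : {q : ℝ × ℝ | q.1 ∈ Ico (0 : ℝ) 1 ∧ q.2 ∈ Ico (0 : ℝ) 1 ∧ c q.1 = ξ q.2} = {(s, t)} := by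
    ext ⟨x, y⟩
    simp only [mem_ofPred_eq, mem_singleton_iff, Prod.mk.injEq]
    constructor
    · rintro ⟨h1, h2, h3⟩
      have h4 : c x ∈ trace c ∩ trace ξ :=
        ⟨⟨x, Ico_subset_Icc_self h1, rfl⟩, ⟨y, Ico_subset_Icc_self h2, h3.symm⟩⟩
      rw [hp] at h4
      have h5 : c x = p := h4
      exact ⟨hτ.injOn h1 hs (h5.trans hsp.symm), hξ.injOn_Ico h2 ht (by rw [← h3, h5, htp])⟩
    · rintro ⟨rfl, rfl⟩
      exact ⟨hs, ht, hst⟩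
  have hs' := Ico_subset_Icc_self hs
  have ht' := Ico_subset_Icc_self ht
  have hgt : GoodParam ξ t := goodParam_of_mem hξ ht' (htp ▸ hpi)
  have hφ := (orientedAt_coord o (hτ.interior s)).planarAt
  have hne := (transverse_iff hs' ht' hφ (hτ.smooth s) hgt.contMDiffAt hst).1 (htr s hs' t ht' hst)
  rw [signedCount, hQ, finsum_mem_singleton, crossSign, GoodParam.velIn_eq hs' (hτ.smooth s) hφ,
    GoodParam.velIn_eq ht' hgt.contMDiffAt (hst ▸ hφ)]
  rcases lt_or_gt_of_ne hne with h | h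
  · right; simp [sign_neg h]
  · left; simp [sign_pos h]

lemma hasTurn_of_meetOnce [T2Space R] (hτ : IsCircle c) (hξ : IsProperCurve ξ)
    (h : MeetOnce c ξ) {Φ : R → ℝ} (hΦ : IsPotential o ξ Φ) :
    ∃ d : ℝ, |d| = 1 ∧ HasTurn (fun s => (Φ (c s) : AddCircle (1 : ℝ))) d := by
  refine ⟨_, ?_, hasTurn_signedCount hτ.toIsClosedCurve hξ h.2 hΦ⟩
  rcases signedCount_of_meetOnce (o := o) hτ hξ h with h | h <;> simp [h]

/-- The number of turns is a homotopy invariant, so it may be computed on the transverse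
representative. -/
lemma hasTurn_of_hasIntersectionNumber [T2Space R] (hξ : IsProperCurve ξ) {k : ℤ}
    (h : HasIntersectionNumber o c ξ k) {Φ : R → ℝ} (hΦ : IsPotential o ξ Φ) :
    HasTurn (fun s => (Φ (c s) : AddCircle (1 : ℝ))) k := by
  obtain ⟨γ', h1, ⟨H, h2, h3, h4, h5, h6⟩, h7, rfl⟩ := h
  have h8 := hasTurn_signedCount h1 hξ h7 hΦ
  have h9 : Continuous fun p : ℝ × ℝ => (Φ (H p.1 p.2) : AddCircle (1 : ℝ)) :=
    hΦ.continuous_coe_comp h2 fun p => h6 _ _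
  have := hasTurn_homotopy h9 (fun r s => by simp only [h5]) (r := 1) (r' := 0)
    (m := signedCount o γ' ξ) (by simpa only [h4] using h8)
  simpa only [h3] using this

end Winding

/-! ### Potentials of moved curves, and multiplicities in terms of potentials. -/

namespace Winding

variable {R : Type*} [TopologicalSpace R] [ChartedSpace (EuclideanHalfSpace 2) R]
  [IsManifold (𝓡∂ 2) ∞ R] {o : SurfaceOrientation R}

/-- The potential of the image of a curve under an orientation preserving diffeomorphism. -/
lemma IsPotential.transport [T2Space R] {ξ : ℝ → R} {Φ : R → ℝ} (hΦ : IsPotential o ξ Φ)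
    {T S : R → R}
    (hST : ∀ x, S (T x) = x) (hTS : ∀ x, T (S x) = x)
    (hT : ∀ x ∈ (𝓡∂ 2).interior R, PreservesAt o T x)
    (hS : ∀ x ∈ (𝓡∂ 2).interior R, PreservesAt o S x)
    (hTξ : IsProperCurve (T ∘ ξ)) : IsPotential o (T ∘ ξ) (Φ ∘ S) := by
  intro x hx
  have hcS : ContinuousAt S x := (hS x hx).2.1.continuousAt
  obtain ⟨ψ, h, h1, h2, h3, h4⟩ := hΦ (S x) (hS x hx).1
  refine ⟨ψ ∘ S, h ∘ S, ?_, ?_, fun y => h3 _, ?_⟩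
  · filter_upwards [hcS.eventually h1, isOpen_int.mem_nhds hx] with y hy hyi
    exact ContinuousAt.comp hy (hS y hyi).2.1.continuousAt
  · filter_upwards [hcS.eventually h2, isOpen_int.mem_nhds hx] with y hy hyi
    have hcy : ContinuousAt S y := (hS y hyi).2.1.continuousAt
    rcases hy with ⟨hy, hl⟩ | ⟨s, hs, hsy, g, hg, hl⟩
    · left
      refine ⟨?_, ?_⟩
      · rintro ⟨s, hs, hsy⟩
        exact hy ⟨s, hs, by rw [← hsy]; exact (hST _).symm⟩
      · filter_upwards [hcy.eventually hl] with z hz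
        exact hz
    · right
      have hys : T (ξ s) = y := by rw [hsy, hTS]
      have hgs : GoodParam (T ∘ ξ) s := by
        rcases hs with hs' | ⟨hs', hs''⟩
        · obtain ⟨t, ht, hts⟩ := hs'.exists_mem (hs'.mem_trace s) 0
          rcases hTξ with h | h
          · exact Or.inl h
          -- The image of a circle takes the same value at 0 and 1, so it cannot be an arc.
          · exfalso
            have e : (T ∘ ξ) 0 = (T ∘ ξ) 1 := by
              have := hs'.periodic 0
              rw [zero_add] at this
              simp only [comp_apply, this]
            have := h.injOn (left_mem_Icc.2 zero_le_one) (right_mem_Icc.2 zero_le_one) e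
            norm_num at this
        · exact goodParam_of_mem hTξ (Ioo_subset_Icc_self hs'') (by
            change T (ξ s) ∈ _
            rw [hys]; exact hyi)
      have hξi : ξ s ∈ (𝓡∂ 2).interior R := hs.interior
      refine ⟨s, hgs, hys, g ∘ S, hg.transport hs hST hTS (hT _ hξi) ?_ hgs, ?_⟩
      · rw [hys]; exact (hS y hyi).2.1
      · filter_upwards [hcy.eventually hl] with z hz
        exact hz
  · filter_upwards [hcS.eventually h4] with y hy
    exact hy

section Domain

variable {ι : Type*} [Fintype ι] {Γ : ι → ℝ → R} {D : R → ℚ} {c : ι → ℚ}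

lemma notMem_support {x : R} : x ∉ support Γ ↔ ∀ i, x ∉ trace (Γ i) := by
  simp [support]

/-- Near a point which lies on at most one curve, the multiplicities of a domain are determined by
its boundary. -/
lemma eventually_domain_eq_of_le_one [T2Space R] (hΓ : ∀ i, IsProperCurve (Γ i))
    (hD : IsRelativeDomain (support Γ) D) (hb : HasBoundary o Γ D c) {h : ι → R → ℝ} {x : R}
    (hx : x ∈ (𝓡∂ 2).interior R)
    (hone : ∀ i j, i ≠ j → x ∈ trace (Γ i) → x ∉ trace (Γ j))
    (hh : ∀ i, LocPot o (Γ i) (h i) x) :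
    ∃ v : ℝ, ∀ᶠ y in 𝓝 x, y ∉ support Γ → (D y : ℝ) - ∑ i, (c i : ℝ) * h i y = v := by
  classical
  by_cases hxs : x ∈ support Γ
  · obtain ⟨i, hi⟩ := mem_iUnion.1 hxs
    have hoff : ∀ j, j ≠ i → ∀ᶠ y in 𝓝 x, y ∉ trace (Γ j) := fun j hj =>
      (isCompact_trace (hΓ j)).isClosed.isOpen_compl.mem_nhds (hone i j hj.symm hi)
    have hoff' : ∀ᶠ y in 𝓝 x, ∀ j, j ≠ i → y ∉ trace (Γ j) := by
      rw [eventually_all]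
      intro j
      by_cases hj : j = i
      · exact Eventually.of_forall fun y h => absurd hj h
      · filter_upwards [hoff j hj] with y hy _ using hy
    rcases hh i with ⟨h1, -⟩ | ⟨s', hs', hsx', g, hg, hl⟩
    · exact absurd hi h1
    obtain ⟨s, hs, rfl⟩ := hi
    have hgs := goodParam_of_mem (hΓ i) hs hx
    have hφ := orientedAt_coord o hx
    have hg2 := hg.of_eq hs' hgs hsx'
    have hu := cross_rotLeft_pos (hgs.deriv_ne_zero hφ.planarAt)
    obtain ⟨v, hv⟩ := eventually_eq_of_jump (c := c i) hgs (by
      filter_upwards [hoff'] with y hy hyi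
      exact hD y (notMem_support.2 fun j => by
        by_cases hj : j = i
        · rwa [hj]
        · exact hy j hj)) hu (hb i s hs hx (fun j hj => hone i j hj.symm ⟨s, hs, rfl⟩) _ (by
          rw [GoodParam.velIn_eq hs hgs.contMDiffAt hφ.planarAt]; exact hu)) hg2
    -- The point lies on no other curve, so only the potential of `Γ i` jumps near it.
    have hrest : ∀ᶠ y in 𝓝 (Γ i s), ∀ j, j ≠ i → h j y = h j (Γ i s) := by
      rw [eventually_all]
      intro j
      by_cases hj : j = i
      · exact Eventually.of_forall fun y h => absurd hj h
      · rcases hh j with ⟨-, h2⟩ | ⟨s'', hs'', hsx'', -⟩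
        · filter_upwards [h2] with y hy _ using hy
        · exact absurd (hsx'' ▸ hs''.mem_trace) (hone i j (Ne.symm hj) ⟨s, hs, rfl⟩)
    refine ⟨v - ∑ j, (c j : ℝ) * h j (Γ i s), ?_⟩
    filter_upwards [hv, hl, hrest] with y h1 h2 h3 hy
    rw [h1 (notMem_support.1 hy i)]
    have e : ∑ j, (c j : ℝ) * h j y =
        ∑ j, (c j : ℝ) * h j (Γ i s) + (c i : ℝ) * (if 0 < g y then 1 else 0) := by
      rw [← Finset.add_sum_erase _ _ (Finset.mem_univ i),
        ← Finset.add_sum_erase _ (fun j => (c j : ℝ) * h j (Γ i s)) (Finset.mem_univ i),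
        Finset.sum_congr rfl (fun j hj => by rw [h3 j (Finset.ne_of_mem_erase hj)]), h2]
      ring
    rw [e]
    split_ifs <;> push_cast <;> ring
  · refine ⟨D x - ∑ i, (c i : ℝ) * h i x, ?_⟩
    have h1 : ∀ᶠ y in 𝓝 x, ∀ i, h i y = h i x := by
      rw [eventually_all]
      intro i
      rcases hh i with ⟨-, h2⟩ | ⟨s, hs, hsx, -⟩
      · exact h2
      · exact absurd (hsx ▸ hs.mem_trace) (notMem_support.1 hxs i)
    filter_upwards [h1, hD x hxs] with y h2 h3 _
    simp only [h2, h3]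

/-- `HasBoundary` is silent at crossings. By transversality these are isolated, and a punctured disc
around one is connected, so the constants found at the surrounding points all agree. -/
lemma eventually_domain_eq [T2Space R] (hΓ : IsCurveSystem Γ)
    (hD : IsRelativeDomain (support Γ) D) (hb : HasBoundary o Γ D c) {h : ι → R → ℝ} {x : R}
    (hx : x ∈ (𝓡∂ 2).interior R) (hh : ∀ i, ∀ᶠ y in 𝓝 x, LocPot o (Γ i) (h i) y) :
    ∃ v : ℝ, ∀ᶠ y in 𝓝 x, y ∉ support Γ → (D y : ℝ) - ∑ i, (c i : ℝ) * h i y = v := by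
  by_cases hxs : x ∈ support Γ
  swap
  · exact eventually_domain_eq_of_le_one hΓ.proper hD hb hx
      (fun i _ _ hi => absurd hi (notMem_support.1 hxs i)) fun i => (hh i).self_of_nhds
  have hcross : ∀ᶠ y in 𝓝 x, ∀ i j, i ≠ j → y ∈ trace (Γ i) → y ∈ trace (Γ j) → y = x := by
    rw [eventually_all]
    intro i
    rw [eventually_all]
    intro j
    by_cases hi : x ∈ trace (Γ i)
    swap
    · filter_upwards [(isCompact_trace (hΓ.proper i)).isClosed.isOpen_compl.mem_nhds hi]
        with y hy _ h using absurd h hy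
    by_cases hj : x ∈ trace (Γ j)
    swap
    · filter_upwards [(isCompact_trace (hΓ.proper j)).isClosed.isOpen_compl.mem_nhds hj]
        with y hy _ _ h using absurd h hy
    by_cases hij : i = j
    · exact Eventually.of_forall fun y h => absurd hij h
    obtain ⟨s, hs, rfl⟩ := hi
    obtain ⟨t, ht, hts⟩ := hj
    have hgs := goodParam_of_mem (hΓ.proper i) hs hx
    have hgt := goodParam_of_mem (hΓ.proper j) ht (hts ▸ hx)
    have hφ := orientedAt_coord o hx
    have := eventually_eq_of_transverse hgs hgt hts.symm hφ
      ((transverse_iff hs ht hφ.planarAt hgs.contMDiffAt hgt.contMDiffAt hts.symm).1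
        (hΓ.transverse i j hij s hs t ht hts.symm))
    filter_upwards [this] with y hy _ using hy
  obtain ⟨N, hN, hNs, hpre⟩ := exists_punctured hx (hcross.and
    ((eventually_all.2 hh).and (isOpen_int.mem_nhds hx)))
  obtain ⟨y₀, hy₀, hy₀N⟩ := ((frequently_notMem_support o hΓ.proper hx).and_eventually hN).exists
  have hne : ∀ y, y ∉ support Γ → y ≠ x := fun y hy h => hy (h ▸ hxs)
  refine ⟨(D y₀ : ℝ) - ∑ i, (c i : ℝ) * h i y₀, ?_⟩
  filter_upwards [hN] with y hy hys
  refine constant_off (f := fun y => (D y : ℝ) - ∑ i, (c i : ℝ) * h i y) hpre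
    (fun z hz => frequently_notMem_support o hΓ.proper (hNs hz.1).2.2) (fun z hz => ?_)
    ⟨hy, hne y hys⟩ ⟨hy₀N, hne y₀ hy₀⟩ hys hy₀
  exact eventually_domain_eq_of_le_one hΓ.proper hD hb (hNs hz.1).2.2
    (fun i j hij hi hj => hz.2 ((hNs hz.1).1 i j hij hi hj)) (hNs hz.1).2.1

/-- The change of the multiplicity of a domain along a path, in terms of potentials. -/
theorem domain_sub_eq [T2Space R] (hΓ : IsCurveSystem Γ)
    (hD : IsRelativeDomain (support Γ) D) (hb : HasBoundary o Γ D c) {Φ : ι → R → ℝ}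
    (hΦ : ∀ i, IsPotential o (Γ i) (Φ i)) {A : ℝ → R} (hA : Continuous A)
    (hAi : ∀ t, A t ∈ (𝓡∂ 2).interior R) {L : ι → ℝ → ℝ} (hL : ∀ i, Continuous (L i))
    (hLΦ : ∀ i t, (L i t : AddCircle (1 : ℝ)) = Φ i (A t))
    (h0 : A 0 ∉ support Γ) (h1 : A 1 ∉ support Γ) :
    (D (A 1) : ℝ) - D (A 0) =
      ∑ i, (c i : ℝ) * ((Φ i (A 1) - L i 1) - (Φ i (A 0) - L i 0)) := by
  -- Here `ψ i` is the continuous branch of `Φ i` modulo 1 near `A t` which takes the value `L i t`,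
  -- and `e` is the part of `D` not explained by the jumps `Φ i - ψ i`. Such an `e` exists for every
  -- `t`, is unique and is locally constant in `t`, so it is the same at both ends of the path.
  let Rel : ℝ → ℝ → Prop := fun t e => ∃ ψ : ι → R → ℝ, (∀ i, ψ i (A t) = L i t) ∧
    (∀ᶠ y in 𝓝 (A t), ∀ i, ContinuousAt (ψ i) y ∧ ∃ n : ℤ, Φ i y - ψ i y = n) ∧
    ∀ᶠ y in 𝓝 (A t), y ∉ support Γ → (D y : ℝ) = e + ∑ i, (c i : ℝ) * (Φ i y - ψ i y)
  have hex : ∀ t, ∃ e, Rel t e := by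
    intro t
    choose ψ h p1 p2 p3 p4 using fun i => hΦ i (A t) (hAi t)
    obtain ⟨v, hv⟩ := eventually_domain_eq hΓ hD hb (hAi t) p2
    have hm : ∀ i, ∃ m : ℤ, L i t - ψ i (A t) = m := by
      intro i
      obtain ⟨n, hn⟩ := coe_addCircle_eq_iff.1 (hLΦ i t)
      obtain ⟨k, hk⟩ := p3 i (A t)
      refine ⟨n + k, ?_⟩
      have := (p4 i).self_of_nhds
      push_cast
      linarith
    choose m hm using hm
    -- The integers `m i` move the branches to the values prescribed by the lifts.
    refine ⟨v + ∑ i, (c i : ℝ) * m i, fun i y => ψ i y + m i, fun i => by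
      have := hm i
      dsimp only
      linarith, ?_, ?_⟩
    · filter_upwards [eventually_all.2 p1, eventually_all.2 p4] with y h1 h2 i
      refine ⟨(h1 i).add continuousAt_const, ?_⟩
      obtain ⟨k, hk⟩ := p3 i y
      exact ⟨k - m i, by rw [h2 i, hk]; push_cast; ring⟩
    · filter_upwards [hv, eventually_all.2 p4] with y h1 h2 hy
      have : ∑ i, (c i : ℝ) * (Φ i y - (ψ i y + m i)) =
          ∑ i, (c i : ℝ) * h i y - ∑ i, (c i : ℝ) * m i := by
        rw [← Finset.sum_sub_distrib]
        refine Finset.sum_congr rfl fun i _ => ?_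
        rw [h2 i]; ring
      rw [this, ← h1 hy]; ring
  have huniq : ∀ t e e', Rel t e → Rel t e' → e = e' := by
    rintro t e e' ⟨ψ, a1, a2, a3⟩ ⟨ψ', b1, b2, b3⟩
    have key : ∀ᶠ y in 𝓝 (A t), ∀ i, ψ i y = ψ' i y := by
      rw [eventually_all]
      intro i
      have := eventually_eq_of_int (f := fun y => ψ i y - ψ' i y)
        ((a2.self_of_nhds i).1.sub (b2.self_of_nhds i).1) (by
          filter_upwards [a2, b2] with y h1 h2
          obtain ⟨n, hn⟩ := (h1 i).2
          obtain ⟨k, hk⟩ := (h2 i).2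
          exact ⟨k - n, by push_cast; linarith⟩)
      filter_upwards [this] with y hy
      rw [a1, b1] at hy
      linarith
    obtain ⟨y, hy, k1, k2, k3⟩ := ((frequently_notMem_support o hΓ.proper (hAi t)).and_eventually
      (key.and (a3.and b3))).exists
    have e1 := k2 hy
    have e2 := k3 hy
    simp only [k1] at e1
    linarith
  have hloc : ∀ t e, Rel t e → ∀ᶠ t' in 𝓝 t, Rel t' e := by
    rintro t e ⟨ψ, a1, a2, a3⟩
    have hAt : ContinuousAt A t := hA.continuousAt
    have key : ∀ᶠ t' in 𝓝 t, ∀ i, ψ i (A t') = L i t' := by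
      rw [eventually_all]
      intro i
      have := eventually_eq_of_int (f := fun t' => ψ i (A t') - L i t')
        ((ContinuousAt.comp (f := A) (a2.self_of_nhds i).1 hAt).sub (hL i).continuousAt) (by
          filter_upwards [hAt.eventually a2] with t' h1
          obtain ⟨n, hn⟩ := (h1 i).2
          obtain ⟨k, hk⟩ := coe_addCircle_eq_iff.1 (hLΦ i t')
          exact ⟨-k - n, by push_cast; linarith⟩)
      filter_upwards [this] with t' ht'
      rw [a1] at ht'
      linarith
    filter_upwards [key, hAt.eventually a2.eventually_nhds, hAt.eventually a3.eventually_nhds]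
      with t' k1 k2 k3
    exact ⟨ψ, k1, k2, k3⟩
  choose e he using hex
  have hconst : e 1 = e 0 := by
    refine constant_of_locally (S := univ) isPreconnected_univ (fun t _ => ?_) (mem_univ _)
      (mem_univ _)
    filter_upwards [(hloc t _ (he t)).filter_mono nhdsWithin_le_nhds] with t' ht'
    exact huniq t' _ _ (he t') ht'
  have hend : ∀ t, A t ∉ support Γ →
      (D (A t) : ℝ) = e t + ∑ i, (c i : ℝ) * (Φ i (A t) - L i t) := by
    intro t ht
    obtain ⟨ψ, a1, -, a3⟩ := he t
    have := a3.self_of_nhds ht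
    simpa only [a1] using this
  rw [hend 1 h1, hend 0 h0, hconst]
  simp only [mul_sub, Finset.sum_sub_distrib]
  ring

end Domain

end Winding

/-! ### Construction of annular neighbourhoods. -/

namespace Winding

variable {R : Type*} [TopologicalSpace R] [ChartedSpace (EuclideanHalfSpace 2) R]
  [IsManifold (𝓡∂ 2) ∞ R] {o : SurfaceOrientation R} {τ : ℝ → R} {V : Set R}

lemma cross_pos_of_exists {c ξ : ℝ → R} {s t : ℝ} {φ ψ : PartialEquiv R Plane}
    (hφ : OrientedAt o φ (c s)) (hψ : OrientedAt o ψ (c s))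
    (hc : ContMDiffAt 𝓘(ℝ, ℝ) (𝓡∂ 2) ∞ c s) (hξ : ContMDiffAt 𝓘(ℝ, ℝ) (𝓡∂ 2) ∞ ξ t)
    (hst : c s = ξ t) :
    (0 ≤ cross (deriv (φ ∘ c) s) (deriv (φ ∘ ξ) t) →
      0 ≤ cross (deriv (ψ ∘ c) s) (deriv (ψ ∘ ξ) t)) ∧
    (0 < cross (deriv (φ ∘ c) s) (deriv (φ ∘ ξ) t) →
      0 < cross (deriv (ψ ∘ c) s) (deriv (ψ ∘ ξ) t)) := by
  rw [cross_change hφ.planarAt hψ.planarAt hc hξ hst]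
  have := hφ.det_change_pos hψ
  exact ⟨fun h => mul_nonneg this.le h, fun h => mul_pos this h⟩

/-- A family of curves transverse to `τ`, not yet restricted to short times. It crosses `τ` from
right to left at the parameters in `S`, and never crosses from left to right. -/
structure IsPreCollar (o : SurfaceOrientation R) (τ : ℝ → R) (K : ℝ → ℝ → R) (S : Set ℝ) :
    Prop where
  smooth : ∀ a, ∀ᶠ q in 𝓝 (a, (0 : ℝ)), ContMDiffAt 𝓘(ℝ, ℝ × ℝ) (𝓡∂ 2) ∞ (uncurry K) q
  periodic : ∀ a t, K (a + 1) t = K a t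
  core : ∀ a, K a 0 = τ a
  nonneg : ∀ a φ, OrientedAt o φ (τ a) → 0 ≤ cross (deriv (φ ∘ τ) a) (deriv (φ ∘ K a) 0)
  pos : ∀ a ∈ S, ∀ φ, OrientedAt o φ (τ a) → 0 < cross (deriv (φ ∘ τ) a) (deriv (φ ∘ K a) 0)

lemma contMDiffAt_slice {K : ℝ → ℝ → R} {a t : ℝ}
    (h : ContMDiffAt 𝓘(ℝ, ℝ × ℝ) (𝓡∂ 2) ∞ (uncurry K) (a, t)) :
    ContMDiffAt 𝓘(ℝ, ℝ) (𝓡∂ 2) ∞ (K a) t := by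
  have : ContMDiffAt 𝓘(ℝ, ℝ) 𝓘(ℝ, ℝ × ℝ) ∞ (fun t : ℝ => (a, t)) t :=
    (contDiffAt_const.prodMk contDiffAt_id).contMDiffAt
  exact ContMDiffAt.comp t (g := uncurry K) (f := fun t : ℝ => (a, t)) h this

/-- A statement about nearby points rather than nearby parameters: as `τ` is embedded, it comes
close to `τ a` only at parameters close to `a`, up to periods. -/
lemma eventually_cross_pos [T2Space R] (hτ : IsCircle τ) (a : ℝ) {φ : PartialEquiv R Plane}
    (hφ : OrientedAt o φ (τ a)) {u : Plane} (hu : 0 < cross (deriv (φ ∘ τ) a) u) :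
    ∀ᶠ y in 𝓝 (τ a), ∀ b, τ b = y → 0 < cross (deriv (φ ∘ τ) b) u := by
  have hg : ∀ b, GoodParam τ b := fun b => Or.inl hτ
  have h1 : ContinuousAt (fun b => deriv (φ ∘ τ) b) a := by
    have := hφ.planarAt.contDiffAt_comp (n := ∞) le_rfl (hτ.smooth a)
    have h := (this.fderiv_right (m := 0) (by simp)).continuousAt.clm_apply
      (continuousAt_const (y := (1 : ℝ)))
    simpa only [fderiv_apply_one_eq_deriv] using h
  have h2 : ∀ᶠ b in 𝓝 a, 0 < cross (deriv (φ ∘ τ) b) u := by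
    have : ContinuousAt (fun b => cross (deriv (φ ∘ τ) b) u) a :=
      ContinuousAt.comp (f := fun b => (deriv (φ ∘ τ) b, u)) continuous_cross.continuousAt
        (h1.prodMk continuousAt_const)
    exact this.eventually (lt_mem_nhds hu)
  obtain ⟨δ, hδ, hb⟩ := Metric.eventually_nhds_iff_ball.1 h2
  filter_upwards [(hg a).eventually_mem_trace hδ] with y hy b hby
  obtain ⟨t, ht, hty⟩ := hy (hby ▸ hτ.mem_trace b)
  rw [(hg b).deriv_eq (hg t) (hby.trans hty.symm)]
  exact hb t ht

/-- The family is pushed in a chart by `t • χ • u`, where `u` points to the left of `τ` wherever the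
bump `χ` is positive on `τ`. This adds `χ • u` to the initial velocities. The determinant with the
tangent of `τ` never decreases and becomes positive near `a₀`, so nothing gained on `S` is lost. -/
lemma exists_preCollar_step [T2Space R] (o : SurfaceOrientation R) (hτ : IsCircle τ) (a₀ : ℝ) :
    ∃ T ∈ 𝓝 a₀, ∀ S K, IsPreCollar o τ K S → ∃ K', IsPreCollar o τ K' (S ∪ T) := by
  classical
  set φ := o.coord (τ a₀) with hφdef
  have hφ : OrientedAt o φ (τ a₀) := orientedAt_coord o (hτ.interior a₀)
  have hφ' : ∀ y ∈ φ.source, y ∈ (𝓡∂ 2).interior R → OrientedAt o φ y := by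
    intro y hy hyi
    obtain ⟨e, he, -, h, -⟩ := hφ
    exact ⟨e, he, by rw [h] at hy; simpa using hy, h, hyi⟩
  have hg : ∀ b, GoodParam τ b := fun b => Or.inl hτ
  set u := rotLeft (deriv (φ ∘ τ) a₀)
  have hu : 0 < cross (deriv (φ ∘ τ) a₀) u :=
    cross_rotLeft_pos ((hg a₀).deriv_ne_zero hφ.planarAt)
  have htg : ∀ᶠ p in 𝓝 (φ (τ a₀)), p ∈ φ.target := hφ.planarAt.target_mem_nhds
  have hev := (hφ.planarAt.tendsto_symm.eventually (eventually_cross_pos hτ a₀ hφ hu)).and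
    (htg.and hφ.planarAt.eventually_symm)
  obtain ⟨δ, hδ, hball⟩ := Metric.nhds_basis_closedBall.eventually_iff.1 hev
  let χ : ContDiffBump (φ (τ a₀)) := ⟨δ / 2, δ, by linarith, by linarith⟩
  let C : Set R := φ.symm '' Metric.closedBall (φ (τ a₀)) δ
  have hC : IsClosed C := by
    refine ((isCompact_closedBall _ _).image_of_continuousOn fun p hp => ?_).isClosed
    have h := (hball hp).2.2
    have h1 := h.2.symm_continuousAt
    rw [h.1] at h1
    exact h1.continuousWithinAt
  have hCs : C ⊆ φ.source := by
    rintro _ ⟨p, hp, rfl⟩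
    exact φ.map_target (hball hp).2.1
  have hχ0 : ∀ y ∈ φ.source, y ∉ C → χ (φ y) = 0 := by
    intro y hy hyC
    refine χ.zero_of_le_dist ?_
    by_contra h
    push Not at h
    exact hyC ⟨φ y, h.le, φ.left_inv hy⟩
  have hχτ : ∀ b, τ b ∈ φ.source → 0 < χ (φ (τ b)) → 0 < cross (deriv (φ ∘ τ) b) u := by
    intro b hb hpos
    by_cases h : τ b ∈ C
    · obtain ⟨p, hp, hpb⟩ := h
      exact (hball hp).1 b hpb.symm
    · exact absurd (hχ0 _ hb h) hpos.ne'
  -- The push is the identity off the closed set `C`, which lies inside the chart, so it extends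
  -- smoothly by the identity.
  let F : ℝ → R → R := fun t y =>
    if y ∈ φ.source then φ.symm (φ y + (t * χ (φ y)) • u) else y
  have hF : ∀ t y, y ∉ C → F t y = y := by
    intro t y hy
    simp only [F]
    split_ifs with h
    · rw [hχ0 y h hy, mul_zero, zero_smul, add_zero, φ.left_inv h]
    · rfl
  have hF0 : ∀ y, F 0 y = y := by
    intro y
    simp only [F]
    split_ifs with h
    · rw [zero_mul, zero_smul, add_zero, φ.left_inv h]
    · rfl
  have hT : {a | τ a ∈ φ.source ∧ 0 < χ (φ (τ a))} ∈ 𝓝 a₀ := by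
    have h1 : ContinuousAt τ a₀ := hτ.smooth.continuous.continuousAt
    have h2 : ContinuousAt (fun a => χ (φ (τ a))) a₀ :=
      ContinuousAt.comp (f := fun a => φ (τ a)) χ.continuous.continuousAt
        (ContinuousAt.comp (f := τ) hφ.planarAt.continuousAt h1)
    refine (h1.eventually hφ.planarAt.source_mem_nhds).and (h2.eventually (lt_mem_nhds ?_))
    exact χ.pos_of_mem_ball (Metric.mem_ball_self χ.rOut_pos)
  refine ⟨_, hT, fun S K hK => ⟨fun a t => F t (K a t), ?_⟩⟩
  have hsm : ∀ a, ∀ᶠ q in 𝓝 (a, (0 : ℝ)),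
      ContMDiffAt 𝓘(ℝ, ℝ × ℝ) (𝓡∂ 2) ∞ (uncurry fun a t => F t (K a t)) q := by
    intro a
    have hcK : ContinuousAt (uncurry K) (a, 0) := (hK.smooth a).self_of_nhds.continuousAt
    have hva : uncurry K (a, 0) = τ a := hK.core a
    by_cases ha : τ a ∈ φ.source
    · have hpa := (hφ' _ ha (hτ.interior a)).planarAt
      have hev : (uncurry fun a t => F t (K a t)) =ᶠ[𝓝 (a, 0)]
          φ.symm ∘ fun q : ℝ × ℝ => φ (uncurry K q) + (q.2 * χ (φ (uncurry K q))) • u := by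
        filter_upwards [hcK.eventually (by rw [hva]; exact hpa.source_mem_nhds)] with q hq
        exact if_pos hq
      have hinner : ∀ q, PlanarAt φ (uncurry K q) →
          ContMDiffAt 𝓘(ℝ, ℝ × ℝ) (𝓡∂ 2) ∞ (uncurry K) q → ContDiffAt ℝ ∞
            (fun q : ℝ × ℝ => φ (uncurry K q) + (q.2 * χ (φ (uncurry K q))) • u) q := by
        intro q hp hq
        have hφK : ContDiffAt ℝ ∞ (fun q : ℝ × ℝ => φ (uncurry K q)) q :=
          PlanarAt.contDiffAt_comp (c := uncurry K) le_rfl hp hq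
        have hχK : ContDiffAt ℝ ∞ (fun q : ℝ × ℝ => χ (φ (uncurry K q))) q :=
          χ.contDiff.contDiffAt.comp q hφK
        exact hφK.add ((contDiffAt_snd.mul hχK).smul contDiffAt_const)
      have h0 : φ (uncurry K (a, 0)) + ((a, (0 : ℝ)).2 * χ (φ (uncurry K (a, 0)))) • u =
          φ (τ a) := by
        simp only [hva, zero_mul, zero_smul, add_zero]
      have hpK : PlanarAt φ (uncurry K (a, 0)) := by rw [hva]; exact hpa
      have h1 := (hinner (a, 0) hpK (hK.smooth a).self_of_nhds).continuousAt.tendsto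
      beta_reduce at h1
      rw [h0] at h1
      replace h1 := h1.eventually hpa.eventually_symm
      filter_upwards [hev.eventuallyEq_nhds, h1, hcK.eventually hpK.eventually_planarAt,
        hK.smooth a] with q k1 k2 k3 k4
      refine ContMDiffAt.congr_of_eventuallyEq ?_ k1
      refine ContMDiffAt.comp q (g := φ.symm)
        (f := fun q : ℝ × ℝ => φ (uncurry K q) + (q.2 * χ (φ (uncurry K q))) • u) ?_
        (hinner q k3 k4).contMDiffAt
      have := k2.2.symm_contMDiffAt
      rwa [k2.1] at this
    · have haC : τ a ∉ C := fun h => ha (hCs h)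
      have hev : (uncurry fun a t => F t (K a t)) =ᶠ[𝓝 (a, 0)] uncurry K := by
        filter_upwards [hcK.eventually (by rw [hva]; exact hC.isOpen_compl.mem_nhds haC)]
          with q hq
        exact hF _ _ hq
      filter_upwards [hev.eventuallyEq_nhds, hK.smooth a] with q k1 k2
      exact k2.congr_of_eventuallyEq k1
  have hcore : ∀ a, F 0 (K a 0) = τ a := fun a => by rw [hF0, hK.core]
  have key : ∀ a ψ, OrientedAt o ψ (τ a) →
      0 ≤ cross (deriv (ψ ∘ τ) a) (deriv (ψ ∘ fun t => F t (K a t)) 0) ∧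
      (a ∈ S ∪ {a | τ a ∈ φ.source ∧ 0 < χ (φ (τ a))} →
        0 < cross (deriv (ψ ∘ τ) a) (deriv (ψ ∘ fun t => F t (K a t)) 0)) := by
    intro a ψ hψ
    have hsl := contMDiffAt_slice (hK.smooth a).self_of_nhds
    have hsl' := contMDiffAt_slice (hsm a).self_of_nhds
    by_cases ha : τ a ∈ φ.source
    · have hoa := hφ' _ ha (hτ.interior a)
      have hpa := hoa.planarAt
      have hφK : HasDerivAt (φ ∘ K a) (deriv (φ ∘ K a) 0) 0 :=
        ((PlanarAt.contDiffAt_comp (c := K a) (n := ∞) le_rfl (by rw [hK.core]; exact hpa)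
          hsl).differentiableAt (by simp)).hasDerivAt
      have hχK : DifferentiableAt ℝ (fun t => χ (φ (K a t))) 0 :=
        (χ.contDiff (n := 1)).differentiable (by simp) |>.differentiableAt.comp 0
          hφK.differentiableAt
      have hd : HasDerivAt (φ ∘ fun t => F t (K a t))
          (deriv (φ ∘ K a) 0 + χ (φ (τ a)) • u) 0 := by
        have h1 : HasDerivAt (fun t => φ (K a t) + (t * χ (φ (K a t))) • u)
            (deriv (φ ∘ K a) 0 + χ (φ (τ a)) • u) 0 := by
          have h2 := hφK.add (((hasDerivAt_id (0 : ℝ)).mul hχK.hasDerivAt).smul_const u)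
          simp only [id, one_mul, zero_mul, add_zero, hK.core] at h2
          exact h2
        refine h1.congr_of_eventuallyEq ?_
        have h3 : ContinuousAt (K a) 0 := hsl.continuousAt
        have h4 : ContinuousAt (fun t => φ (K a t) + (t * χ (φ (K a t))) • u) 0 := h1.continuousAt
        have h5 := hpa.eventually_symm
        filter_upwards [h3.eventually (by rw [hK.core]; exact hpa.source_mem_nhds),
          h4.eventually (by
            simp only [hK.core, zero_mul, zero_smul, add_zero]; exact h5)] with t h6 h7
        have h8 : F t (K a t) = φ.symm (φ (K a t) + (t * χ (φ (K a t))) • u) := if_pos h6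
        rw [comp_apply, h8, h7.1]
      have hcr := cross_pos_of_exists (ξ := fun t => F t (K a t)) (t := 0) hoa hψ (hτ.smooth a)
        hsl' (hcore a).symm
      rw [hd.deriv, cross_add_right, cross_smul_right] at hcr
      have h0 := hK.nonneg a φ hoa
      have h1 : 0 ≤ χ (φ (τ a)) * cross (deriv (φ ∘ τ) a) u := by
        rcases (χ.nonneg (x := φ (τ a))).eq_or_lt with h | h
        · rw [← h, zero_mul]
        · exact (mul_pos h (hχτ a ha h)).le
      refine ⟨hcr.1 (add_nonneg h0 h1), fun h => hcr.2 ?_⟩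
      rcases h with h | ⟨-, h⟩
      · exact add_pos_of_pos_of_nonneg (hK.pos a h φ hoa) h1
      · exact add_pos_of_nonneg_of_pos h0 (mul_pos h (hχτ a ha h))
    · have haC : τ a ∉ C := fun h => ha (hCs h)
      have hev : (fun t => F t (K a t)) =ᶠ[𝓝 0] K a := by
        filter_upwards [hsl.continuousAt.eventually (by
          rw [hK.core]; exact hC.isOpen_compl.mem_nhds haC)] with t ht
        exact hF _ _ ht
      rw [(hev.fun_comp ψ).deriv_eq]
      refine ⟨hK.nonneg a ψ hψ, fun h => ?_⟩
      rcases h with h | ⟨h, -⟩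
      · exact hK.pos a h ψ hψ
      · exact absurd h ha
  exact ⟨hsm, fun a t => by simp only [hK.periodic], hcore, fun a ψ hψ => (key a ψ hψ).1,
    fun a ha ψ hψ => (key a ψ hψ).2 ha⟩

/-- One starts from the family that is constant in `t`; by compactness finitely many pushes make it
transverse along the whole circle. -/
lemma exists_preCollar [T2Space R] (o : SurfaceOrientation R) (hτ : IsCircle τ) :
    ∃ K, IsPreCollar o τ K (Icc 0 1) := by
  have h0 : IsPreCollar o τ (fun a _ => τ a) ∅ := by
    refine ⟨fun a => ?_, fun a _ => hτ.periodic a, fun _ => rfl, fun a φ _ => ?_, by simp⟩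
    · exact Eventually.of_forall fun q => ContMDiffAt.comp q (g := τ) (f := Prod.fst)
        (hτ.smooth q.1) contDiffAt_fst.contMDiffAt
    · have : φ ∘ (fun _ : ℝ => τ a) = fun _ => φ (τ a) := rfl
      rw [this, deriv_const]
      simp [cross]
  have key := isCompact_Icc (a := (0 : ℝ)) (b := 1) |>.induction_on
    (p := fun T => ∀ S K, IsPreCollar o τ K S → ∃ K', IsPreCollar o τ K' (S ∪ T))
    (fun S K h => ⟨K, by simpa using h⟩)
    (fun S T hST h S' K hK => by
      obtain ⟨K', hK'⟩ := h S' K hK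
      exact ⟨K', hK'.smooth, hK'.periodic, hK'.core, hK'.nonneg,
        fun a ha => hK'.pos a (union_subset_union_right _ hST ha)⟩)
    (fun S T hS hT S' K hK => by
      obtain ⟨K', hK'⟩ := hS S' K hK
      obtain ⟨K'', hK''⟩ := hT _ K' hK'
      exact ⟨K'', by rwa [← union_assoc]⟩)
    (fun a _ => by
      obtain ⟨T, hT, h⟩ := exists_preCollar_step o hτ a
      exact ⟨T, mem_nhdsWithin_of_mem_nhds hT, h⟩)
  obtain ⟨K, hK⟩ := key ∅ _ h0
  exact ⟨K, by simpa using hK⟩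

/-- An annular neighbourhood of `τ` in `V`, parametrized compatibly with the orientation. -/
structure IsCollar (o : SurfaceOrientation R) (τ : ℝ → R) (V : Set R) (K : ℝ → ℝ → R) :
    Prop where
  smooth : ∀ q : ℝ × ℝ, q.2 ∈ Ioo (-1 : ℝ) 1 →
    ContMDiffAt 𝓘(ℝ, ℝ × ℝ) (𝓡∂ 2) ∞ (uncurry K) q
  periodic : ∀ a t, K (a + 1) t = K a t
  inj : ∀ a t a' t', t ∈ Ioo (-1 : ℝ) 1 → t' ∈ Ioo (-1 : ℝ) 1 → K a t = K a' t' →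
    (∃ n : ℤ, a - a' = n) ∧ t = t'
  oriented : ∀ q : ℝ × ℝ, q.2 ∈ Ioo (-1 : ℝ) 1 → ∀ φ, OrientedAt o φ (uncurry K q) →
    0 < cross (fderiv ℝ (φ ∘ uncurry K) q (1, 0)) (fderiv ℝ (φ ∘ uncurry K) q (0, 1))
  core : ∀ a, K a 0 = τ a
  interior : ∀ a, ∀ t ∈ Ioo (-1 : ℝ) 1, K a t ∈ (𝓡∂ 2).interior R
  subset : ∀ a, ∀ t ∈ Ioo (-1 : ℝ) 1, K a t ∈ V

lemma cross_fderiv_change {K : ℝ × ℝ → R} {q : ℝ × ℝ} {φ ψ : PartialEquiv R Plane}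
    (hφ : OrientedAt o φ (K q)) (hψ : OrientedAt o ψ (K q))
    (hK : ContMDiffAt 𝓘(ℝ, ℝ × ℝ) (𝓡∂ 2) ∞ K q)
    (h : 0 < cross (fderiv ℝ (φ ∘ K) q (1, 0)) (fderiv ℝ (φ ∘ K) q (0, 1))) :
    0 < cross (fderiv ℝ (ψ ∘ K) q (1, 0)) (fderiv ℝ (ψ ∘ K) q (0, 1)) := by
  have h1 := hφ.planarAt.contDiffAt_comp (n := ∞) le_rfl hK
  have h2 := hφ.planarAt.contDiffAt_change hψ.planarAt
  have h3 : (ψ ∘ K) =ᶠ[𝓝 q] (ψ ∘ φ.symm) ∘ (φ ∘ K) := by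
    filter_upwards [hK.continuousAt.eventually hφ.planarAt.source_mem_nhds] with p hp
    simp only [comp_apply]
    rw [φ.left_inv hp]
  have h4 : fderiv ℝ (ψ ∘ K) q =
      (fderiv ℝ (ψ ∘ φ.symm) (φ (K q))).comp (fderiv ℝ (φ ∘ K) q) := by
    rw [h3.fderiv_eq]
    exact fderiv_comp q (h2.differentiableAt (by simp)) (h1.differentiableAt (by simp))
  rw [h4]
  simp only [ContinuousLinearMap.comp_apply]
  rw [cross_map]
  exact mul_pos (hφ.det_change_pos hψ) h

/-- Along the core the family has invertible derivative. Compactness of `[0,1]`, and of `[0,1]²` for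
pairs of angles, yields an `ε` such that all requirements, including injectivity, hold for `|t| <
ε`; then `t` is rescaled. -/
lemma IsPreCollar.exists_isCollar [T2Space R] (hτ : IsCircle τ) (hV : IsOpen V)
    (hτV : trace τ ⊆ V) {K : ℝ → ℝ → R} (hK : IsPreCollar o τ K (Icc 0 1)) :
    ∃ K, IsCollar o τ V K := by
  let Good : ℝ × ℝ → Prop := fun q => ContMDiffAt 𝓘(ℝ, ℝ × ℝ) (𝓡∂ 2) ∞ (uncurry K) q ∧
    uncurry K q ∈ V ∧ uncurry K q ∈ (𝓡∂ 2).interior R ∧ ∃ φ, OrientedAt o φ (uncurry K q) ∧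
    0 < cross (fderiv ℝ (φ ∘ uncurry K) q (1, 0)) (fderiv ℝ (φ ∘ uncurry K) q (0, 1))
  have hcK : ∀ a, ContinuousAt (uncurry K) (a, 0) := fun a =>
    (hK.smooth a).self_of_nhds.continuousAt
  have hva : ∀ a, uncurry K (a, 0) = τ a := hK.core
  have hcr : ∀ a ∈ Icc (0 : ℝ) 1, ∀ φ, OrientedAt o φ (τ a) → 0 <
      cross (fderiv ℝ (φ ∘ uncurry K) (a, 0) (1, 0)) (fderiv ℝ (φ ∘ uncurry K) (a, 0) (0, 1)) := by
    intro a ha φ hφ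
    have hd : HasFDerivAt (φ ∘ uncurry K) (fderiv ℝ (φ ∘ uncurry K) (a, 0)) (a, 0) :=
      ((PlanarAt.contDiffAt_comp (c := uncurry K) (n := ∞) le_rfl
        (by rw [hva]; exact hφ.planarAt) (hK.smooth a).self_of_nhds).differentiableAt
        (by simp)).hasFDerivAt
    have h1 : HasDerivAt (fun b : ℝ => (b, (0 : ℝ))) (1, 0) a :=
      (hasDerivAt_id a).prodMk (hasDerivAt_const _ _)
    have h2 : HasDerivAt (fun t : ℝ => (a, t)) (0, 1) 0 :=
      (hasDerivAt_const _ _).prodMk (hasDerivAt_id _)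
    have e1 := HasFDerivAt.comp_hasDerivAt (f := fun b : ℝ => (b, (0 : ℝ))) a hd h1
    have e2 := HasFDerivAt.comp_hasDerivAt (f := fun t : ℝ => (a, t)) 0 hd h2
    have e3 : (φ ∘ uncurry K) ∘ (fun b : ℝ => (b, (0 : ℝ))) = φ ∘ τ := by
      ext1 b; exact congrArg φ (hva b)
    have e4 : (φ ∘ uncurry K) ∘ (fun t : ℝ => (a, t)) = φ ∘ K a := rfl
    rw [e3] at e1
    rw [e4] at e2
    rw [← e1.deriv, ← e2.deriv]
    exact hK.pos a ha φ hφ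
  have hG : ∀ a ∈ Icc (0 : ℝ) 1, ∀ᶠ q in 𝓝 (a, (0 : ℝ)), Good q := by
    intro a ha
    have hφ := orientedAt_coord o (hτ.interior a)
    set φ := o.coord (τ a)
    have hp : PlanarAt φ (uncurry K (a, 0)) := by rw [hva]; exact hφ.planarAt
    have h1 := PlanarAt.contDiffAt_comp (c := uncurry K) (n := ∞) le_rfl hp
      (hK.smooth a).self_of_nhds
    have h2 : ContinuousAt (fderiv ℝ (φ ∘ uncurry K)) (a, 0) :=
      (h1.fderiv_right (m := 0) (by simp)).continuousAt
    have h3 : ContinuousAt (fun q => cross (fderiv ℝ (φ ∘ uncurry K) q (1, 0))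
        (fderiv ℝ (φ ∘ uncurry K) q (0, 1))) (a, 0) :=
      ContinuousAt.comp (f := fun q => (fderiv ℝ (φ ∘ uncurry K) q (1, 0),
        fderiv ℝ (φ ∘ uncurry K) q (0, 1))) continuous_cross.continuousAt
        ((h2.clm_apply continuousAt_const).prodMk (h2.clm_apply continuousAt_const))
    filter_upwards [hK.smooth a, (hcK a).eventually (by
        rw [hva]; exact hV.mem_nhds (hτV (hτ.mem_trace a))), (hcK a).eventually (by
        rw [hva]; exact isOpen_int.mem_nhds (hτ.interior a)), (hcK a).eventually (by
        rw [hva]; exact hφ.eventually_orientedAt), h3.eventually (lt_mem_nhds (hcr a ha φ hφ))]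
      with q k1 k2 k3 k4 k5
    exact ⟨k1, k2, k3, φ, k4, k5⟩
  -- If both angles give the same point of `τ` they differ by an integer, and after translation one
  -- local inverse handles both. Otherwise the two points are separated by open sets.
  have hinj : ∀ p ∈ Icc (0 : ℝ) 1 ×ˢ Icc (0 : ℝ) 1, ∀ᶠ z : (ℝ × ℝ) × ℝ × ℝ in 𝓝 ((0 : ℝ × ℝ), p),
      K z.2.1 z.1.1 = K z.2.2 z.1.2 → (∃ n : ℤ, z.2.1 - z.2.2 = (n : ℝ)) ∧ z.1.1 = z.1.2 := by
    rintro ⟨a, b⟩ ⟨ha, hb⟩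
    have t1 : Tendsto (fun z : (ℝ × ℝ) × ℝ × ℝ => (z.2.1, z.1.1)) (𝓝 (0, (a, b))) (𝓝 (a, 0)) := by
      have : Continuous fun z : (ℝ × ℝ) × ℝ × ℝ => (z.2.1, z.1.1) := by fun_prop
      exact this.tendsto _
    have t2 : Tendsto (fun z : (ℝ × ℝ) × ℝ × ℝ => (z.2.2, z.1.2)) (𝓝 (0, (a, b))) (𝓝 (b, 0)) := by
      have : Continuous fun z : (ℝ × ℝ) × ℝ × ℝ => (z.2.2, z.1.2) := by fun_prop
      exact this.tendsto _
    have c1 := (hcK a).tendsto.comp t1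
    have c2 := (hcK b).tendsto.comp t2
    rw [hva] at c1 c2
    by_cases hab : τ a = τ b
    · obtain ⟨n, hn⟩ := hτ.exists_int hab
      have hφ := orientedAt_coord o (hτ.interior a)
      set φ := o.coord (τ a)
      have hp : PlanarAt φ (uncurry K (a, 0)) := by rw [hva]; exact hφ.planarAt
      obtain ⟨G, -, -, hG, -⟩ := exists_local_inverse (PlanarAt.contDiffAt_comp (c := uncurry K)
        le_rfl hp (hK.smooth a).self_of_nhds) (hcr a ha φ hφ).ne'
      have t3 : Tendsto (fun z : (ℝ × ℝ) × ℝ × ℝ => (z.2.2 + n, z.1.2)) (𝓝 (0, (a, b)))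
          (𝓝 (a, 0)) := by
        have h1 : Continuous fun z : (ℝ × ℝ) × ℝ × ℝ => (z.2.2 + (n : ℝ), z.1.2) := by fun_prop
        have h2 := h1.tendsto ((0 : ℝ × ℝ), (a, b))
        have h3 : b + (n : ℝ) = a := by linarith
        simp only [h3] at h2
        exact h2
      filter_upwards [t1.eventually hG, t3.eventually hG] with z k1 k2 hz
      have hper : K (z.2.2 + n) z.1.2 = K z.2.2 z.1.2 := by
        have hp : Function.Periodic (fun a => K a z.1.2) 1 := fun a => hK.periodic a _
        simpa using hp.int_mul n z.2.2
      have e : (z.2.1, z.1.1) = (z.2.2 + n, z.1.2) := by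
        rw [← k1, ← k2]
        simp only [comp_apply, uncurry_apply_pair, hper, hz]
      rw [Prod.mk.injEq] at e
      exact ⟨⟨n, by linarith [e.1]⟩, e.2⟩
    · obtain ⟨A, B, hA, hB, haA, hbB, hAB⟩ := t2_separation hab
      filter_upwards [c1.eventually (hA.mem_nhds haA), c2.eventually (hB.mem_nhds hbB)]
        with z k1 k2 hz
      exact absurd hz (hAB.ne_of_mem k1 k2)
  have e1 : ∀ᶠ t in 𝓝 (0 : ℝ), ∀ a ∈ Icc (0 : ℝ) 1, Good (a, t) := by
    refine isCompact_Icc.eventually_forall_of_forall_eventually fun a ha => ?_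
    have : Tendsto (fun z : ℝ × ℝ => (z.2, z.1)) (𝓝 (0, a)) (𝓝 (a, 0)) :=
      continuous_swap.tendsto _
    exact this.eventually (hG a ha)
  have e2 := (isCompact_Icc.prod isCompact_Icc).eventually_forall_of_forall_eventually
    (P := fun (x : ℝ × ℝ) (y : ℝ × ℝ) => K y.1 x.1 = K y.2 x.2 →
      (∃ n : ℤ, y.1 - y.2 = (n : ℝ)) ∧ x.1 = x.2) hinj
  obtain ⟨ε, hε, h1, h2⟩ : ∃ ε > 0, (∀ t ∈ Ioo (-ε) ε, ∀ a ∈ Icc (0 : ℝ) 1, Good (a, t)) ∧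
      ∀ t ∈ Ioo (-ε) ε, ∀ t' ∈ Ioo (-ε) ε, ∀ a ∈ Icc (0 : ℝ) 1, ∀ b ∈ Icc (0 : ℝ) 1,
        K a t = K b t' → (∃ n : ℤ, a - b = n) ∧ t = t' := by
    obtain ⟨ε₁, h1, h1'⟩ := Metric.eventually_nhds_iff_ball.1 e1
    obtain ⟨ε₂, h2, h2'⟩ := Metric.eventually_nhds_iff_ball.1 e2
    have hab : ∀ {t : ℝ}, t ∈ Ioo (-(min ε₁ ε₂)) (min ε₁ ε₂) → |t| < ε₁ ∧ |t| < ε₂ :=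
      fun {t} ht => lt_min_iff.1 (abs_lt.2 ht)
    refine ⟨min ε₁ ε₂, lt_min h1 h2, fun t ht a ha => h1' t (by
      simpa [Real.dist_eq] using (hab ht).1) a ha, fun t ht t' ht' a ha b hb h => ?_⟩
    exact h2' (t, t') (by
      rw [Metric.mem_ball, Prod.dist_eq, max_lt_iff]
      simpa [Real.dist_eq] using ⟨(hab ht).2, (hab ht').2⟩) (a, b) ⟨ha, hb⟩ h
  have hfr : ∀ a t, K (Int.fract a) t = K a t := by
    intro a t
    have hp : Function.Periodic (fun a => K a t) 1 := fun a => hK.periodic a _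
    rw [Int.fract]
    simpa using hp.sub_int_mul_eq ⌊a⌋ (x := a)
  have hfm : ∀ a : ℝ, Int.fract a ∈ Icc (0 : ℝ) 1 := fun a =>
    ⟨Int.fract_nonneg a, (Int.fract_lt_one a).le⟩
  have hGood : ∀ t ∈ Ioo (-ε) ε, ∀ a, Good (a, t) := by
    intro t ht a
    obtain ⟨g1, g2, g3, φ, g4, g5⟩ := h1 t ht _ (hfm a)
    have e : uncurry K = fun q : ℝ × ℝ => uncurry K (q + (-(⌊a⌋ : ℝ), 0)) := by
      ext1 q
      have hp : Function.Periodic (fun a => K a q.2) 1 := fun a => hK.periodic a _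
      have := hp.sub_int_mul_eq ⌊a⌋ (x := q.1)
      simp only [mul_one] at this
      simp only [uncurry, Prod.fst_add, Prod.snd_add, add_zero, ← sub_eq_add_neg, this]
    have e' : ((a, t) + (-(⌊a⌋ : ℝ), 0) : ℝ × ℝ) = (Int.fract a, t) := by
      rw [Prod.mk_add_mk, add_zero, ← sub_eq_add_neg, Int.self_sub_floor]
    have hv : uncurry K (a, t) = uncurry K (Int.fract a, t) := (hfr a t).symm
    refine ⟨?_, hv ▸ g2, hv ▸ g3, φ, hv ▸ g4, ?_⟩
    · rw [e]
      refine ContMDiffAt.comp (a, t) (g := uncurry K)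
        (f := fun q : ℝ × ℝ => q + (-(⌊a⌋ : ℝ), 0)) (by rw [e']; exact g1)
        (contDiffAt_id.add contDiffAt_const).contMDiffAt
    · have : fderiv ℝ (φ ∘ uncurry K) (a, t) = fderiv ℝ (φ ∘ uncurry K) (Int.fract a, t) := by
        conv_lhs => rw [e]
        have := fderiv_comp_add_right (𝕜 := ℝ) (f := φ ∘ uncurry K) (x := (a, t))
          (-(⌊a⌋ : ℝ), 0)
        rw [e'] at this
        exact this
      rw [this]; exact g5
  have hmem : ∀ t ∈ Ioo (-1 : ℝ) 1, ε * t ∈ Ioo (-ε) ε := fun t ht =>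
    ⟨by nlinarith [ht.1], by nlinarith [ht.2]⟩
  have hlin : ∀ q : ℝ × ℝ, ContDiffAt ℝ ∞ (fun q : ℝ × ℝ => (q.1, ε * q.2)) q := fun q =>
    contDiffAt_fst.prodMk (contDiffAt_const.mul contDiffAt_snd)
  have hsm : ∀ q : ℝ × ℝ, q.2 ∈ Ioo (-1 : ℝ) 1 →
      ContMDiffAt 𝓘(ℝ, ℝ × ℝ) (𝓡∂ 2) ∞ (uncurry fun a t => K a (ε * t)) q := fun q hq =>
    ContMDiffAt.comp q (g := uncurry K) (f := fun q : ℝ × ℝ => (q.1, ε * q.2))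
      (hGood _ (hmem _ hq) q.1).1 (hlin q).contMDiffAt
  refine ⟨fun a t => K a (ε * t), ⟨hsm, fun a t => hK.periodic _ _, fun a t a' t' ht ht' h => ?_,
    fun q hq φ hφ => ?_, fun a => by simp only [mul_zero, hK.core],
    fun a t ht => (hGood _ (hmem t ht) a).2.2.1, fun a t ht => (hGood _ (hmem t ht) a).2.1⟩⟩
  · obtain ⟨⟨n, hn⟩, h4⟩ := h2 _ (hmem t ht) _ (hmem t' ht') _ (hfm a) _ (hfm a')
      (by rw [hfr, hfr]; exact h)
    refine ⟨⟨n + ⌊a⌋ - ⌊a'⌋, ?_⟩, mul_left_cancel₀ hε.ne' h4⟩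
    rw [Int.fract, Int.fract] at hn
    push_cast
    linarith
  · obtain ⟨g1, g2, g3, ψ, g4, g5⟩ := hGood _ (hmem _ hq) q.1
    refine cross_fderiv_change (φ := ψ) (K := uncurry fun a t => K a (ε * t)) g4 hφ (hsm q hq) ?_
    have hd : HasFDerivAt (ψ ∘ uncurry K) (fderiv ℝ (ψ ∘ uncurry K) (q.1, ε * q.2))
        (q.1, ε * q.2) :=
      ((PlanarAt.contDiffAt_comp (c := uncurry K) (n := ∞) le_rfl
        g4.planarAt g1).differentiableAt (by simp)).hasFDerivAt
    have hl : HasFDerivAt (fun q : ℝ × ℝ => (q.1, ε * q.2))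
        ((ContinuousLinearMap.fst ℝ ℝ ℝ).prod (ε • ContinuousLinearMap.snd ℝ ℝ ℝ)) q :=
      hasFDerivAt_fst.prodMk (hasFDerivAt_snd.const_mul ε)
    have hcomp := HasFDerivAt.comp (g := ψ ∘ uncurry K) (f := fun q : ℝ × ℝ => (q.1, ε * q.2))
      q hd hl
    have e : ψ ∘ (uncurry fun a t => K a (ε * t)) =
      (ψ ∘ uncurry K) ∘ (fun q : ℝ × ℝ => (q.1, ε * q.2)) := rfl
    rw [e, hcomp.fderiv]
    have l1 : ((ContinuousLinearMap.fst ℝ ℝ ℝ).prod (ε • ContinuousLinearMap.snd ℝ ℝ ℝ)) (1, 0) =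
      ((1 : ℝ), (0 : ℝ)) := by simp
    have l2 : ((ContinuousLinearMap.fst ℝ ℝ ℝ).prod (ε • ContinuousLinearMap.snd ℝ ℝ ℝ)) (0, 1) =
      ε • ((0 : ℝ), (1 : ℝ)) := by simp
    rw [ContinuousLinearMap.comp_apply, ContinuousLinearMap.comp_apply, l1, l2, map_smul,
      cross_smul_right]
    exact mul_pos hε g5

theorem exists_isCollar [T2Space R] (o : SurfaceOrientation R) (hτ : IsCircle τ) (hV : IsOpen V)
    (hτV : trace τ ⊆ V) : ∃ K, IsCollar o τ V K := by
  obtain ⟨K, hK⟩ := exists_preCollar o hτ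
  exact hK.exists_isCollar hτ hV hτV

end Winding

namespace Winding

variable {R : Type*} [TopologicalSpace R] [ChartedSpace (EuclideanHalfSpace 2) R]
  [IsManifold (𝓡∂ 2) ∞ R] {o : SurfaceOrientation R} {τ : ℝ → R} {V : Set R} {K : ℝ → ℝ → R}

/-! ### Orientation preserving diffeomorphisms fixing the boundary -/

/-- `W` is an orientation preserving diffeomorphism, the identity near the boundary, with
inverse `S`. -/
structure IsIso (o : SurfaceOrientation R) (W S : R → R) : Prop where
  left_inv : ∀ x, S (W x) = x
  right_inv : ∀ x, W (S x) = x
  preserves : ∀ x ∈ (𝓡∂ 2).interior R, PreservesAt o W x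
  preserves_inv : ∀ x ∈ (𝓡∂ 2).interior R, PreservesAt o S x
  near_boundary : ∀ x ∉ (𝓡∂ 2).interior R, ∀ᶠ y in 𝓝 x, W y = y

namespace IsIso

variable {W S W' S' : R → R} {γ δ : ℝ → R}

lemma refl (o : SurfaceOrientation R) : IsIso o id id :=
  ⟨fun _ => rfl, fun _ => rfl, fun _ h => preservesAt_id o h, fun _ h => preservesAt_id o h,
    fun _ _ => Eventually.of_forall fun _ => rfl⟩

lemma comp (h : IsIso o W S) (h' : IsIso o W' S') : IsIso o (W ∘ W') (S' ∘ S) where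
  left_inv x := by simp only [comp_apply, h.left_inv, h'.left_inv]
  right_inv x := by simp only [comp_apply, h.right_inv, h'.right_inv]
  preserves x hx := (h.preserves _ (h'.preserves x hx).1).comp (h'.preserves x hx)
  preserves_inv x hx := (h'.preserves_inv _ (h.preserves_inv x hx).1).comp (h.preserves_inv x hx)
  near_boundary x hx := by
    filter_upwards [h.near_boundary x hx, h'.near_boundary x hx] with y h1 h2
    simp only [comp_apply, h1, h2]

lemma injective (h : IsIso o W S) : Injective W := LeftInverse.injective h.left_inv

lemma mem_interior_iff (h : IsIso o W S) (x : R) :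
    W x ∈ (𝓡∂ 2).interior R ↔ x ∈ (𝓡∂ 2).interior R := by
  refine ⟨fun hx => ?_, fun hx => (h.preserves x hx).1⟩
  have := (h.preserves_inv _ hx).1
  rwa [h.left_inv] at this

lemma contMDiffAt (h : IsIso o W S) (x : R) : ContMDiffAt (𝓡∂ 2) (𝓡∂ 2) ∞ W x := by
  by_cases hx : x ∈ (𝓡∂ 2).interior R
  · exact (h.preserves x hx).2.1
  · exact contMDiffAt_id.congr_of_eventuallyEq (h.near_boundary x hx)

/-- Planar coordinates are available only at interior points. This covers the ends of arcs, near
which the map is the identity. -/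
lemma velIn_of_boundary (h : IsIso o W S) {s : ℝ} (hγ : ContMDiffOn 𝓘(ℝ, ℝ) (𝓡∂ 2) ∞ γ unitI)
    (hs : s ∈ unitI) (hi : γ s ∉ (𝓡∂ 2).interior R) (φ : PartialEquiv R Plane) :
    velIn φ (W ∘ γ) s = velIn φ γ s := by
  have h1 : ∀ᶠ t in 𝓝[unitI] s, W (γ t) = γ t :=
    (hγ s hs).continuousWithinAt.eventually (h.near_boundary _ hi)
  refine Filter.EventuallyEq.derivWithin_eq ?_ ?_
  · filter_upwards [h1] with t ht
    simp only [comp_apply, ht]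
  · simp only [comp_apply, h1.self_of_nhdsWithin hs]

lemma map_deriv_ne_zero {A : Plane →L[ℝ] Plane} (hA : A.det ≠ 0) {u : Plane} (hu : u ≠ 0) :
    A u ≠ 0 := by
  intro h
  have := cross_map A u (rotLeft u)
  rw [h] at this
  have h0 : cross 0 (A (rotLeft u)) = 0 := by simp [cross]
  rw [h0] at this
  exact mul_ne_zero hA (cross_rotLeft_pos hu).ne' this.symm

lemma isProperCurve (h : IsIso o W S) (hγ : IsProperCurve γ) : IsProperCurve (W ∘ γ) := by
  have him : IsImmersed (W ∘ γ) := by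
    intro s hs
    by_cases hi : γ s ∈ (𝓡∂ 2).interior R
    · have hg := goodParam_of_mem hγ hs hi
      have hP := h.preserves _ hi
      have h1 := orientedAt_coord o hi
      have h2 := orientedAt_coord o hP.1
      have h3 := planarAt_extChartAt hP.1
      have h4 : ContMDiffAt 𝓘(ℝ, ℝ) (𝓡∂ 2) ∞ (W ∘ γ) s := hP.2.1.comp s hg.contMDiffAt
      have h5 := GoodParam.velIn_eq (γ := W ∘ γ) hs h4 h3
      rw [comp_apply, h5, PlanarAt.deriv_change h2.planarAt h3 h4]
      refine map_deriv_ne_zero (PlanarAt.det_change_ne_zero h2.planarAt h3) ?_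
      rw [PlanarAt.deriv_read h1.planarAt h2.planarAt hP.2.1 hg.contMDiffAt]
      exact map_deriv_ne_zero (hP.2.2 _ _ h1 h2).ne' (hg.deriv_ne_zero h1.planarAt)
    · rw [h.velIn_of_boundary hγ.contMDiffOn hs hi, comp_apply,
        (h.near_boundary _ hi).self_of_nhds]
      exact hγ.immersed s hs
  rcases hγ with hγ | hγ
  · left
    exact
      { smooth := fun s => (h.contMDiffAt _).comp s (hγ.smooth s)
        periodic := fun s => by simp only [comp_apply, hγ.periodic]
        interior := fun s => (h.preserves _ (hγ.interior s)).1
        injOn := h.injective.comp_injOn hγ.injOn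
        immersed := him }
  · right
    refine ⟨fun s hs => (h.contMDiffAt _).comp_contMDiffWithinAt s (hγ.smooth s hs),
      h.injective.comp_injOn hγ.injOn, him, fun s hs => ?_⟩
    rw [← hγ.boundary_iff s hs, ← (𝓡∂ 2).compl_interior, mem_compl_iff, mem_compl_iff,
      comp_apply, h.mem_interior_iff]

lemma transverse (h : IsIso o W S) (hγ : IsProperCurve γ) (hδ : IsProperCurve δ)
    (hγδ : Transverse γ δ) : Transverse (W ∘ γ) (W ∘ δ) := by
  intro s hs t ht hst
  have hst' : γ s = δ t := h.injective hst
  have h0 := hγδ s hs t ht hst'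
  by_cases hi : γ s ∈ (𝓡∂ 2).interior R
  · have hg := goodParam_of_mem hγ hs hi
    have hd := goodParam_of_mem hδ ht (hst' ▸ hi)
    have hP := h.preserves _ hi
    have h1 := orientedAt_coord o hi
    have h2 := orientedAt_coord o hP.1
    rw [transverse_iff hs ht h1.planarAt hg.contMDiffAt hd.contMDiffAt hst'] at h0
    have hP' := hP.2.1
    have k1 : ContMDiffAt 𝓘(ℝ, ℝ) (𝓡∂ 2) ∞ (W ∘ γ) s := hP.2.1.comp s hg.contMDiffAt
    have k2 : ContMDiffAt 𝓘(ℝ, ℝ) (𝓡∂ 2) ∞ (W ∘ δ) t := by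
      rw [hst'] at hP'
      exact hP'.comp t hd.contMDiffAt
    rw [transverse_iff (c := W ∘ γ) hs ht h2.planarAt k1 k2 hst]
    rw [PlanarAt.deriv_read h1.planarAt h2.planarAt hP.2.1 hg.contMDiffAt]
    have e : deriv (o.coord (W (γ s)) ∘ W ∘ δ) t = fderiv ℝ (o.coord (W (γ s)) ∘ W ∘
        (o.coord (γ s)).symm) (o.coord (γ s) (γ s)) (deriv (o.coord (γ s) ∘ δ) t) := by
      have := PlanarAt.deriv_read (φ := o.coord (γ s)) (ψ := o.coord (W (γ s))) (W := W) (γ := δ)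
        (s := t) (hst' ▸ h1.planarAt) (hst' ▸ h2.planarAt) (hst' ▸ hP.2.1) hd.contMDiffAt
      rw [this, ← hst']
    rw [e, cross_map]
    exact mul_ne_zero (hP.2.2 _ _ h1 h2).ne' h0
  · rw [h.velIn_of_boundary hγ.contMDiffOn hs hi, h.velIn_of_boundary hδ.contMDiffOn ht
      (hst' ▸ hi), comp_apply, (h.near_boundary _ hi).self_of_nhds]
    exact h0

end IsIso

/-! ### Collars and rotations -/

/-- Angle and level as smooth functions near a point of the collar. They can only be local, because
the angle is defined modulo 1. -/
lemma exists_coords {q : ℝ × ℝ} (hs : ContMDiffAt 𝓘(ℝ, ℝ × ℝ) (𝓡∂ 2) ∞ (uncurry K) q)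
    {φ : PartialEquiv R Plane} (hφ : PlanarAt φ (uncurry K q))
    (hne : cross (fderiv ℝ (φ ∘ uncurry K) q (1, 0)) (fderiv ℝ (φ ∘ uncurry K) q (0, 1)) ≠ 0) :
    ∃ J : R → ℝ × ℝ, ContMDiffAt (𝓡∂ 2) 𝓘(ℝ, ℝ × ℝ) ∞ J (uncurry K q) ∧ J (uncurry K q) = q ∧
      (∀ᶠ p in 𝓝 q, J (uncurry K p) = p) ∧ ∀ᶠ y in 𝓝 (uncurry K q), uncurry K (J y) = y := by
  obtain ⟨G, h1, h2, h3, h4⟩ := exists_local_inverse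
    (PlanarAt.contDiffAt_comp (c := uncurry K) le_rfl hφ hs) hne
  have hJ : ContMDiffAt (𝓡∂ 2) 𝓘(ℝ, ℝ × ℝ) ∞ (G ∘ φ) (uncurry K q) :=
    ContMDiffAt.comp _ (g := G) (f := φ) h1.contMDiffAt hφ.contMDiffAt
  have hJq : (G ∘ φ) (uncurry K q) = q := h2
  refine ⟨G ∘ φ, hJ, hJq, h3, ?_⟩
  have h5 : ContinuousAt (fun y => uncurry K ((G ∘ φ) y)) (uncurry K q) :=
    ContinuousAt.comp (g := uncurry K) (by rw [hJq]; exact hs.continuousAt) hJ.continuousAt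
  filter_upwards [hφ.continuousAt.eventually h4, hφ.source_mem_nhds,
    h5.eventually (by beta_reduce; rw [hJq]; exact hφ.source_mem_nhds)] with y k1 k2 k3
  exact φ.injOn k3 k2 k1

/-- The set of all points of the collar with level in `P`. -/
def strip (K : ℝ → ℝ → R) (P : Set ℝ) : Set R := {x | ∃ a, ∃ t ∈ P, K a t = x}

lemma strip_mono {P Q : Set ℝ} (h : P ⊆ Q) : strip K P ⊆ strip K Q :=
  fun _ ⟨a, t, ht, hx⟩ => ⟨a, t, h ht, hx⟩

namespace IsCollar

variable (hK : IsCollar o τ V K)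
include hK

lemma add_int (a t : ℝ) (n : ℤ) : K (a + n) t = K a t := by
  have hp : Function.Periodic (fun a => K a t) 1 := fun a => hK.periodic a _
  simpa using hp.int_mul n a

lemma exists_coords {q : ℝ × ℝ} (hq : q.2 ∈ Ioo (-1 : ℝ) 1) :
    ∃ J : R → ℝ × ℝ, ContMDiffAt (𝓡∂ 2) 𝓘(ℝ, ℝ × ℝ) ∞ J (uncurry K q) ∧ J (uncurry K q) = q ∧
      (∀ᶠ p in 𝓝 q, J (uncurry K p) = p) ∧ ∀ᶠ y in 𝓝 (uncurry K q), uncurry K (J y) = y := by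
  have hφ := orientedAt_coord o (hK.interior q.1 q.2 hq)
  exact Winding.exists_coords (hK.smooth q hq) hφ.planarAt (hK.oriented q hq _ hφ).ne'

lemma isCompact_strip {P : Set ℝ} (hP : IsCompact P) (hP' : P ⊆ Ioo (-1) 1) :
    IsCompact (strip K P) := by
  have : strip K P = uncurry K '' (Icc 0 1 ×ˢ P) := by
    ext x
    constructor
    · rintro ⟨a, t, ht, rfl⟩
      refine ⟨(Int.fract a, t), ⟨⟨Int.fract_nonneg a, (Int.fract_lt_one a).le⟩, ht⟩, ?_⟩
      have := hK.add_int (Int.fract a) t ⌊a⌋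
      rw [Int.fract_add_floor] at this
      exact this.symm
    · rintro ⟨⟨a, t⟩, ⟨-, ht⟩, rfl⟩
      exact ⟨a, t, ht, rfl⟩
  rw [this]
  exact (isCompact_Icc.prod hP).image_of_continuousOn fun q hq =>
    (hK.smooth q (hP' hq.2)).continuousAt.continuousWithinAt

/-- The preimage chosen in `rotate` is unique up to an integer in the angle, which periodicity
absorbs. -/
lemma rotate_apply (ρ : ℝ → ℝ) (a : ℝ) {t : ℝ} (ht : t ∈ Ioo (-1 : ℝ) 1) :
    rotate K ρ (K a t) = K (a + ρ t) t := by
  have h : ∃ q : ℝ × ℝ, q.2 ∈ Ioo (-1 : ℝ) 1 ∧ K q.1 q.2 = K a t := ⟨(a, t), ht, rfl⟩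
  rw [rotate, dif_pos h]
  obtain ⟨h1, h2⟩ := h.choose_spec
  obtain ⟨⟨n, hn⟩, h4⟩ := hK.inj _ _ _ _ h1 ht h2
  rw [h4, show h.choose.1 + ρ t = a + ρ t + n by linarith, hK.add_int]

omit hK in
lemma rotate_eq_self {ρ : ℝ → ℝ} {x : R}
    (h : x ∉ strip K (Function.support ρ ∩ Ioo (-1) 1)) : rotate K ρ x = x := by
  rw [rotate]
  split_ifs with h'
  · obtain ⟨h1, h2⟩ := h'.choose_spec
    have : ρ h'.choose.2 = 0 := by
      by_contra h3
      exact h ⟨_, _, ⟨h3, h1⟩, h2⟩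
    rw [this, add_zero, h2]
  · rfl

lemma rotate_rotate (ρ ρ' : ℝ → ℝ) (x : R) :
    rotate K ρ (rotate K ρ' x) = rotate K (fun t => ρ t + ρ' t) x := by
  by_cases h : x ∈ strip K (Ioo (-1) 1)
  · obtain ⟨a, t, ht, rfl⟩ := h
    rw [hK.rotate_apply _ _ ht, hK.rotate_apply _ _ ht, hK.rotate_apply _ _ ht]
    congr 1; ring
  · have : ∀ P : Set ℝ, x ∉ strip K (P ∩ Ioo (-1) 1) := fun P hx =>
      h (strip_mono inter_subset_right hx)
    rw [rotate_eq_self (ρ := ρ') (this _), rotate_eq_self (this _), rotate_eq_self (this _)]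

omit hK in
lemma rotate_zero (x : R) : rotate K (fun _ => 0) x = x :=
  rotate_eq_self (by rintro ⟨a, t, ⟨ht, -⟩, -⟩; exact ht rfl)

lemma rotate_neg_left (ρ : ℝ → ℝ) (x : R) : rotate K (fun t => -ρ t) (rotate K ρ x) = x := by
  rw [hK.rotate_rotate]
  simp only [neg_add_cancel]
  exact rotate_zero x

lemma rotate_neg_right (ρ : ℝ → ℝ) (x : R) : rotate K ρ (rotate K (fun t => -ρ t) x) = x := by
  rw [hK.rotate_rotate]
  simp only [add_neg_cancel]
  exact rotate_zero x

lemma eventually_rotate_eq {q : ℝ × ℝ} (hq : q.2 ∈ Ioo (-1 : ℝ) 1) {J : R → ℝ × ℝ}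
    (hJ : ContinuousAt J (uncurry K q)) (hJq : J (uncurry K q) = q)
    (hKJ : ∀ᶠ y in 𝓝 (uncurry K q), uncurry K (J y) = y) :
    ∀ᶠ y in 𝓝 (uncurry K q), ∀ ρ : ℝ → ℝ,
      rotate K ρ y = uncurry K ((J y).1 + ρ (J y).2, (J y).2) := by
  have h1 : ∀ᶠ y in 𝓝 (uncurry K q), (J y).2 ∈ Ioo (-1 : ℝ) 1 := by
    have : ContinuousAt (fun y => (J y).2) (uncurry K q) := hJ.snd
    exact this.eventually (by beta_reduce; rw [hJq]; exact isOpen_Ioo.mem_nhds hq)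
  filter_upwards [h1, hKJ] with y h2 h3 ρ
  conv_lhs => rw [← h3]
  exact hK.rotate_apply ρ _ h2

variable [T2Space R] {ρ : ℝ → ℝ}

lemma eventually_rotate_eq_self (hρ : tsupport ρ ⊆ Ioo (-1) 1) {x : R}
    (hx : x ∉ strip K (tsupport ρ)) :
    ∀ᶠ y in 𝓝 x, ∀ ρ' : ℝ → ℝ, Function.support ρ' ⊆ Function.support ρ → rotate K ρ' y = y := by
  have hc : IsCompact (tsupport ρ) :=
    isCompact_Icc.of_isClosed_subset (isClosed_tsupport ρ) (hρ.trans Ioo_subset_Icc_self)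
  filter_upwards [(hK.isCompact_strip hc hρ).isClosed.isOpen_compl.mem_nhds hx] with y hy ρ' hρ'
  exact rotate_eq_self fun h => hy (strip_mono
    (inter_subset_left.trans (hρ'.trans (subset_tsupport ρ))) h)

/-- Rotations depend continuously on their amplitude. -/
lemma continuousAt_rotate (hs : ContDiff ℝ ∞ ρ) (hρ : tsupport ρ ⊆ Ioo (-1) 1) (r : ℝ) (x : R) :
    ContinuousAt (fun p : ℝ × R => rotate K (fun t => p.1 * ρ t) p.2) (r, x) := by
  by_cases hx : x ∈ strip K (tsupport ρ)
  · obtain ⟨a, t, ht, rfl⟩ := hx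
    obtain ⟨J, h1, h2, -, h4⟩ := hK.exists_coords (q := (a, t)) (hρ ht)
    have h5 := hK.eventually_rotate_eq (q := (a, t)) (hρ ht) h1.continuousAt h2 h4
    have h1' : ContinuousAt J (K a t) := h1.continuousAt
    change J (K a t) = (a, t) at h2
    have hJ : ContinuousAt (fun p : ℝ × R => J p.2) (r, K a t) :=
      ContinuousAt.comp (g := J) (f := Prod.snd) h1' continuousAt_snd
    have hin : ContinuousAt (fun p : ℝ × R => ((J p.2).1 + p.1 * ρ (J p.2).2, (J p.2).2))
        (r, K a t) :=
      (hJ.fst.add (continuousAt_fst.mul (hs.continuous.continuousAt.comp hJ.snd))).prodMk hJ.snd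
    have hout : ContinuousAt (fun p : ℝ × R => uncurry K
        ((J p.2).1 + p.1 * ρ (J p.2).2, (J p.2).2)) (r, K a t) := by
      refine ContinuousAt.comp (g := uncurry K) ?_ hin
      refine (hK.smooth _ ?_).continuousAt
      simpa only [h2] using hρ ht
    refine hout.congr ?_
    filter_upwards [continuousAt_snd.eventually h5] with p hp
    exact (hp fun t => p.1 * ρ t).symm
  · have h1 := hK.eventually_rotate_eq_self hρ hx
    refine continuousAt_snd.congr ?_
    filter_upwards [continuousAt_snd.eventually h1] with p hp
    refine (hp _ fun t ht => ?_).symm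
    exact right_ne_zero_of_mul ht

lemma contMDiffAt_rotate (hs : ContDiff ℝ ∞ ρ) (hρ : tsupport ρ ⊆ Ioo (-1) 1) (x : R) :
    ContMDiffAt (𝓡∂ 2) (𝓡∂ 2) ∞ (rotate K ρ) x := by
  by_cases hx : x ∈ strip K (tsupport ρ)
  · obtain ⟨a, t, ht, rfl⟩ := hx
    obtain ⟨J, h1, h2, -, h4⟩ := hK.exists_coords (q := (a, t)) (hρ ht)
    have h5 := hK.eventually_rotate_eq (q := (a, t)) (hρ ht) h1.continuousAt h2 h4
    have hsh : ContDiff ℝ ∞ fun q : ℝ × ℝ => (q.1 + ρ q.2, q.2) :=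
      (contDiff_fst.add (hs.comp contDiff_snd)).prodMk contDiff_snd
    have h6 : ContMDiffAt (𝓡∂ 2) 𝓘(ℝ, ℝ × ℝ) ∞
        ((fun q : ℝ × ℝ => (q.1 + ρ q.2, q.2)) ∘ J) (K a t) :=
      ContMDiffAt.comp (K a t) (g := fun q : ℝ × ℝ => (q.1 + ρ q.2, q.2)) (f := J)
        hsh.contDiffAt.contMDiffAt h1
    have h7 : ContMDiffAt (𝓡∂ 2) (𝓡∂ 2) ∞
        (uncurry K ∘ ((fun q : ℝ × ℝ => (q.1 + ρ q.2, q.2)) ∘ J)) (K a t) := by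
      refine ContMDiffAt.comp (K a t) (g := uncurry K) (hK.smooth _ ?_) h6
      change (J (uncurry K (a, t))).2 ∈ _
      rw [h2]; exact hρ ht
    refine h7.congr_of_eventuallyEq ?_
    filter_upwards [h5] with y hy using hy ρ
  · refine contMDiffAt_id.congr_of_eventuallyEq ?_
    filter_upwards [hK.eventually_rotate_eq_self hρ hx] with y hy
    exact hy ρ le_rfl

/-- In collar coordinates the rotation is the shear `(a, t) ↦ (a + ρ t, t)` of determinant 1, and
the collar is compatible with the orientation at both points. -/
lemma preservesAt_rotate (hs : ContDiff ℝ ∞ ρ) (hρ : tsupport ρ ⊆ Ioo (-1) 1) {x : R}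
    (hx : x ∈ (𝓡∂ 2).interior R) : PreservesAt o (rotate K ρ) x := by
  by_cases hxs : x ∈ strip K (tsupport ρ)
  · obtain ⟨a, t, ht, rfl⟩ := hxs
    have ht' := hρ ht
    have hW := hK.contMDiffAt_rotate hs hρ (K a t)
    have hWx : rotate K ρ (K a t) = uncurry K (a + ρ t, t) := hK.rotate_apply ρ a ht'
    have hWi : rotate K ρ (K a t) ∈ (𝓡∂ 2).interior R := by
      rw [hWx]; exact hK.interior _ _ ht'
    have hφ := orientedAt_coord o hx
    have hψ := orientedAt_coord o hWi
    refine PreservesAt.of_exists hWi hW hφ hψ ?_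
    set φ := o.coord (K a t)
    set ψ := o.coord (rotate K ρ (K a t))
    set M := fderiv ℝ (ψ ∘ rotate K ρ ∘ φ.symm) (φ (K a t)) with hM
    have hMd : HasFDerivAt (ψ ∘ rotate K ρ ∘ φ.symm) M ((φ ∘ uncurry K) (a, t)) :=
      ((PlanarAt.contDiffAt_read (n := ∞) le_rfl hφ.planarAt hψ.planarAt hW).differentiableAt
        (by simp)).hasFDerivAt
    have hKd : HasFDerivAt (φ ∘ uncurry K) (fderiv ℝ (φ ∘ uncurry K) (a, t)) (a, t) :=
      ((PlanarAt.contDiffAt_comp (c := uncurry K) (n := ∞) le_rfl hφ.planarAt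
        (hK.smooth (a, t) ht')).differentiableAt (by simp)).hasFDerivAt
    have hKd' : HasFDerivAt (ψ ∘ uncurry K) (fderiv ℝ (ψ ∘ uncurry K) (a + ρ t, t))
        (a + ρ t, t) :=
      ((PlanarAt.contDiffAt_comp (c := uncurry K) (n := ∞) le_rfl (by
        rw [← hWx]; exact hψ.planarAt)
        (hK.smooth (a + ρ t, t) ht')).differentiableAt (by simp)).hasFDerivAt
    have hρd : HasDerivAt ρ (deriv ρ t) t := (hs.differentiable (by simp) t).hasDerivAt
    have l1 : HasDerivAt (fun r : ℝ => (a + r, t)) (1, 0) 0 :=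
      ((hasDerivAt_id (0 : ℝ)).const_add a).prodMk (hasDerivAt_const _ _)
    have l1' : HasDerivAt (fun r : ℝ => (a + r + ρ t, t)) (1, 0) 0 :=
      (((hasDerivAt_id (0 : ℝ)).const_add a).add_const (ρ t)).prodMk (hasDerivAt_const _ _)
    have l2 : HasDerivAt (fun r : ℝ => (a, r)) (0, 1) t :=
      (hasDerivAt_const _ _).prodMk (hasDerivAt_id _)
    have l2' : HasDerivAt (fun r : ℝ => (a + ρ r, r)) (deriv ρ t, 1) t :=
      (hρd.const_add a).prodMk (hasDerivAt_id _)
    have hmain : ∀ p : ℝ × ℝ, p.2 ∈ Ioo (-1 : ℝ) 1 → uncurry K p ∈ φ.source →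
        (ψ ∘ rotate K ρ ∘ φ.symm) ((φ ∘ uncurry K) p) = (ψ ∘ uncurry K) (p.1 + ρ p.2, p.2) := by
      intro p hp hps
      simp only [comp_apply]
      rw [φ.left_inv hps]
      exact congrArg ψ (hK.rotate_apply ρ p.1 hp)
    have hnear : ∀ᶠ p in 𝓝 (a, t), p.2 ∈ Ioo (-1 : ℝ) 1 ∧ uncurry K p ∈ φ.source :=
      (continuousAt_snd.eventually (isOpen_Ioo.mem_nhds ht')).and
        ((hK.smooth (a, t) ht').continuousAt.eventually hφ.planarAt.source_mem_nhds)
    have e1 : M (fderiv ℝ (φ ∘ uncurry K) (a, t) (1, 0)) =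
        fderiv ℝ (ψ ∘ uncurry K) (a + ρ t, t) (1, 0) := by
      have d1 : HasDerivAt (fun r : ℝ => (φ ∘ uncurry K) (a + r, t))
          (fderiv ℝ (φ ∘ uncurry K) (a, t) (1, 0)) 0 :=
        HasFDerivAt.comp_hasDerivAt (f := fun r : ℝ => (a + r, t)) 0
          (by simpa using hKd) l1
      have d2 : HasDerivAt (fun r : ℝ => (ψ ∘ rotate K ρ ∘ φ.symm) ((φ ∘ uncurry K) (a + r, t)))
          (M (fderiv ℝ (φ ∘ uncurry K) (a, t) (1, 0))) 0 :=
        HasFDerivAt.comp_hasDerivAt (f := fun r : ℝ => (φ ∘ uncurry K) (a + r, t)) 0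
          (by simpa using hMd) d1
      have d3 : HasDerivAt (fun r : ℝ => (ψ ∘ uncurry K) (a + r + ρ t, t))
          (fderiv ℝ (ψ ∘ uncurry K) (a + ρ t, t) (1, 0)) 0 :=
        HasFDerivAt.comp_hasDerivAt (f := fun r : ℝ => (a + r + ρ t, t)) 0
          (by simpa using hKd') l1'
      refine d2.unique (d3.congr_of_eventuallyEq ?_)
      have : Tendsto (fun r : ℝ => (a + r, t)) (𝓝 0) (𝓝 (a, t)) := by
        have := l1.continuousAt.tendsto; simpa using this
      filter_upwards [this.eventually hnear] with r hr
      exact hmain _ hr.1 hr.2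
    have e2 : M (fderiv ℝ (φ ∘ uncurry K) (a, t) (0, 1)) =
        fderiv ℝ (ψ ∘ uncurry K) (a + ρ t, t) (deriv ρ t, 1) := by
      have d1 : HasDerivAt (fun r : ℝ => (φ ∘ uncurry K) (a, r))
          (fderiv ℝ (φ ∘ uncurry K) (a, t) (0, 1)) t :=
        HasFDerivAt.comp_hasDerivAt (f := fun r : ℝ => (a, r)) t hKd l2
      have d2 : HasDerivAt (fun r : ℝ => (ψ ∘ rotate K ρ ∘ φ.symm) ((φ ∘ uncurry K) (a, r)))
          (M (fderiv ℝ (φ ∘ uncurry K) (a, t) (0, 1))) t :=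
        HasFDerivAt.comp_hasDerivAt (f := fun r : ℝ => (φ ∘ uncurry K) (a, r)) t hMd d1
      have d3 : HasDerivAt (fun r : ℝ => (ψ ∘ uncurry K) (a + ρ r, r))
          (fderiv ℝ (ψ ∘ uncurry K) (a + ρ t, t) (deriv ρ t, 1)) t :=
        HasFDerivAt.comp_hasDerivAt (f := fun r : ℝ => (a + ρ r, r)) t hKd' l2'
      refine d2.unique (d3.congr_of_eventuallyEq ?_)
      have : Tendsto (fun r : ℝ => (a, r)) (𝓝 t) (𝓝 (a, t)) := l2.continuousAt.tendsto
      filter_upwards [this.eventually hnear] with r hr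
      exact hmain _ hr.1 hr.2
    have p1 := hK.oriented (a, t) ht' φ hφ
    have p2 := hK.oriented (a + ρ t, t) ht' ψ (by rw [← hWx]; exact hψ)
    have e3 : ((deriv ρ t, 1) : ℝ × ℝ) = deriv ρ t • ((1 : ℝ), (0 : ℝ)) + ((0 : ℝ), (1 : ℝ)) := by
      simp
    have e4 := cross_map M (fderiv ℝ (φ ∘ uncurry K) (a, t) (1, 0))
      (fderiv ℝ (φ ∘ uncurry K) (a, t) (0, 1))
    rw [e1, e2, e3, map_add, map_smul, cross_add_right, cross_smul_right, cross_self, mul_zero,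
      zero_add] at e4
    rw [e4] at p2
    exact (pos_iff_pos_of_mul_pos p2).2 p1
  · exact (preservesAt_id o hx).congr (by
      filter_upwards [hK.eventually_rotate_eq_self hρ hxs] with y hy
      exact hy ρ le_rfl) hx

lemma isIso_rotate (hs : ContDiff ℝ ∞ ρ) (hρ : tsupport ρ ⊆ Ioo (-1) 1) :
    IsIso o (rotate K ρ) (rotate K fun t => -ρ t) where
  left_inv := hK.rotate_neg_left ρ
  right_inv := hK.rotate_neg_right ρ
  preserves x hx := hK.preservesAt_rotate hs hρ hx
  preserves_inv x hx := hK.preservesAt_rotate hs.neg (by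
    have : tsupport (fun t => -ρ t) = tsupport ρ := tsupport_neg ρ
    rw [this]; exact hρ) hx
  near_boundary x hx := by
    have : x ∉ strip K (tsupport ρ) := by
      rintro ⟨a, t, ht, rfl⟩
      exact hx (hK.interior a t (hρ ht))
    filter_upwards [hK.eventually_rotate_eq_self hρ this] with y hy
    exact hy ρ le_rfl

end IsCollar

end Winding

namespace Winding

open MeasureTheory Asymptotics

/-! ### Sets of measure zero -/

lemma det_zero_real : (0 : ℝ →L[ℝ] ℝ).det = 0 := by
  simp [ContinuousLinearMap.det]

/-- Sard's theorem in dimension one, for derivatives within an arbitrary set. -/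
lemma volume_image_of_deriv_eq_zero {f : ℝ → ℝ} {s : Set ℝ}
    (h : ∀ x ∈ s, HasDerivWithinAt f 0 s x) : volume (f '' s) = 0 := by
  refine addHaar_image_eq_zero_of_det_fderivWithin_eq_zero volume
    (f' := fun _ => (0 : ℝ →L[ℝ] ℝ)) (fun x hx => ?_) fun _ _ => det_zero_real
  have := (h x hx).hasFDerivWithinAt
  simpa using this

/-- A function that on `Z` varies more slowly than a local coordinate of `Z` takes only few values
on `Z`. -/
lemma volume_image_of_isLittleO {α : Type*} [MetricSpace α] [SecondCountableTopology α] {Z : Set α}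
    {y s : α → ℝ} (h1 : ∀ p ∈ Z, (fun q => dist q p) =O[𝓝[Z] p] fun q => y q - y p)
    (h2 : ∀ p ∈ Z, (fun q => s q - s p) =o[𝓝[Z] p] fun q => y q - y p) :
    volume (s '' Z) = 0 := by
  -- On `T n` the big-O bound is uniform, with constant `n` at scale `1 / (n + 1)`.
  let T : ℕ → Set α := fun n => {p ∈ Z | ∀ q ∈ Z, dist q p < 1 / (n + 1) →
    dist q p ≤ n * |y q - y p|}
  have hT : Z ⊆ ⋃ n, T n := by
    intro p hp
    obtain ⟨C, hC⟩ := (h1 p hp).bound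
    rw [eventually_nhdsWithin_iff, Metric.eventually_nhds_iff] at hC
    obtain ⟨ε, hε, hb⟩ := hC
    obtain ⟨n, hn⟩ := exists_nat_gt (max C (1 / ε))
    have hn0 : (0 : ℝ) < n := (one_div_pos.2 hε).trans ((le_max_right _ _).trans_lt hn)
    refine mem_iUnion.2 ⟨n, hp, fun q hq hqp => ?_⟩
    have h3 : 1 / ((n : ℝ) + 1) < ε := by
      have : 1 / ε < n := (le_max_right _ _).trans_lt hn
      rw [div_lt_iff₀ hε] at this
      rw [div_lt_iff₀ (by linarith)]
      nlinarith
    have h4 := hb (hqp.trans h3) hq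
    rw [Real.norm_eq_abs, Real.norm_eq_abs, abs_of_nonneg dist_nonneg] at h4
    exact h4.trans (mul_le_mul_of_nonneg_right ((le_max_left _ _).trans hn.le) (abs_nonneg _))
  have hpiece : ∀ (n : ℕ) (S : Set α), S ⊆ T n →
      (∀ p ∈ S, ∀ q ∈ S, dist q p < 1 / (n + 1)) → volume (s '' S) = 0 := by
    intro n S hS hd
    have hdist : ∀ p ∈ S, ∀ q ∈ S, dist q p ≤ n * |y q - y p| := fun p hp q hq =>
      (hS hp).2 q (hS hq).1 (hd p hp q hq)
    have hinj : InjOn y S := by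
      intro p hp q hq hpq
      have := hdist p hp q hq
      rw [hpq, sub_self, abs_zero, mul_zero] at this
      exact (dist_le_zero.1 this).symm
    rcases S.eq_empty_or_nonempty with rfl | hne
    · simp
    have hα : Nonempty α := ⟨hne.some⟩
    -- On a piece of small diameter `y` has a Lipschitz inverse `g`, and the little-o bound says
    -- that `s ∘ g` has derivative zero on `y '' S`.
    let g := invFunOn y S
    have hg : ∀ p ∈ S, g (y p) = p := fun p hp => hinj.leftInvOn_invFunOn hp
    have him : s '' S = (s ∘ g) '' (y '' S) := by
      rw [← image_comp]
      exact image_congr fun p hp => by simp only [comp_apply, hg p hp]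
    rw [him]
    refine volume_image_of_deriv_eq_zero ?_
    rintro _ ⟨p, hp, rfl⟩
    have ht : Tendsto g (𝓝[y '' S] (y p)) (𝓝[Z] p) := by
      refine tendsto_nhdsWithin_iff.2 ⟨?_, ?_⟩
      · rw [tendsto_iff_dist_tendsto_zero]
        have hz : Tendsto (fun v => (n : ℝ) * |v - y p|) (𝓝[y '' S] (y p)) (𝓝 0) := by
          have : Continuous fun v => (n : ℝ) * |v - y p| := by fun_prop
          have := this.tendsto (y p)
          simp only [sub_self, abs_zero, mul_zero] at this
          exact this.mono_left nhdsWithin_le_nhds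
        refine squeeze_zero' (Eventually.of_forall fun _ => dist_nonneg) ?_ hz
        filter_upwards [self_mem_nhdsWithin] with v hv
        obtain ⟨q, hq, rfl⟩ := hv
        rw [hg q hq]
        exact hdist p hp q hq
      · filter_upwards [self_mem_nhdsWithin] with v hv
        obtain ⟨q, hq, rfl⟩ := hv
        rw [hg q hq]
        exact (hS hq).1
    rw [hasDerivWithinAt_iff_isLittleO]
    refine ((h2 p (hS hp).1).comp_tendsto ht).congr' ?_ ?_
    · exact Eventually.of_forall fun v => by simp [hg p hp]
    · filter_upwards [self_mem_nhdsWithin] with v hv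
      obtain ⟨q, hq, rfl⟩ := hv
      simp only [comp_apply, hg q hq]
  have hcov : ∀ n : ℕ, volume (s '' T n) = 0 := by
    intro n
    -- Half the scale, so that any two points of one ball are at distance less than `1 / (n + 1)`.
    have hn : (0 : ℝ) < 1 / (2 * (n + 1)) := by positivity
    obtain ⟨A, hA, hAc⟩ := TopologicalSpace.countable_cover_nhds
      (f := fun p : α => Metric.ball p (1 / (2 * ((n : ℝ) + 1))))
      fun p => Metric.ball_mem_nhds p hn
    have : s '' T n ⊆ ⋃ p ∈ A, s '' (T n ∩ Metric.ball p (1 / (2 * ((n : ℝ) + 1)))) := by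
      rintro _ ⟨q, hq, rfl⟩
      have : q ∈ ⋃ p ∈ A, Metric.ball p (1 / (2 * ((n : ℝ) + 1))) := by rw [hAc]; trivial
      obtain ⟨p, hp, hqp⟩ := mem_iUnion₂.1 this
      exact mem_iUnion₂.2 ⟨p, hp, q, ⟨hq, hqp⟩, rfl⟩
    refine measure_mono_null this ((measure_biUnion_null_iff hA).2 fun p _ => ?_)
    refine hpiece n _ inter_subset_left fun q hq q' hq' => ?_
    have := dist_triangle_right q' q p
    have h3 : (1 : ℝ) / (n + 1) = 1 / (2 * (n + 1)) + 1 / (2 * (n + 1)) := by field_simp; ring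
    rw [h3]
    exact this.trans_lt (add_lt_add hq'.2 hq.2)
  refine measure_mono_null (image_mono hT) ?_
  rw [image_iUnion]
  exact measure_iUnion_null hcov

lemma isBigO_sub_of_hasDerivAt {f : ℝ → ℝ} {f' x : ℝ} (hf : HasDerivAt f f' x) (hf' : f' ≠ 0) :
    (fun y => y - x) =O[𝓝 x] fun y => f y - f x :=
  (HasDerivAtFilter.isTheta_sub hf hf').2.comp_tendsto
    (tendsto_id.prodMk (tendsto_const_pure (b := x)))

/-- Along the solutions `(x, y, s)` of the equation of an intersection with a sheared curve, the
shift `s` is stationary at a tangency. -/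
lemma isLittleO_of_tangency {c d : ℝ → ℝ × ℝ} {c' d' : ℝ × ℝ} {x₀ y₀ s₀ r' : ℝ} {r : ℝ → ℝ}
    (hc : HasDerivAt c c' x₀) (hd : HasDerivAt d d' y₀) (hr : HasDerivAt r r' ((c x₀).2 - s₀))
    (hr' : r' ≠ 0) (hreg : c'.2 ≠ 0)
    (hdet : (c'.1 + r' * c'.2) * d'.2 - c'.2 * d'.1 = 0)
    {Z : Set (ℝ × ℝ × ℝ)} {e : ℝ} (h0 : (x₀, y₀, s₀) ∈ Z)
    (hZ : ∀ᶠ p in 𝓝[Z] (x₀, y₀, s₀), (c p.1).2 = (d p.2.1).2 ∧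
      (c p.1).1 + r ((c p.1).2 - p.2.2) - (d p.2.1).1 = e) :
    ((fun p : ℝ × ℝ × ℝ => dist p (x₀, y₀, s₀)) =O[𝓝[Z] (x₀, y₀, s₀)] fun p => p.2.1 - y₀) ∧
    (fun p : ℝ × ℝ × ℝ => p.2.2 - s₀) =o[𝓝[Z] (x₀, y₀, s₀)] fun p => p.2.1 - y₀ := by
  set l := 𝓝[Z] (x₀, y₀, s₀) with hl
  have hle : l ≤ 𝓝 (x₀, y₀, s₀) := nhdsWithin_le_nhds
  have tx : Tendsto (fun p : ℝ × ℝ × ℝ => p.1) l (𝓝 x₀) :=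
    (continuous_fst.tendsto (x₀, y₀, s₀)).mono_left hle
  have ty : Tendsto (fun p : ℝ × ℝ × ℝ => p.2.1) l (𝓝 y₀) :=
    ((continuous_fst.comp continuous_snd).tendsto (x₀, y₀, s₀)).mono_left hle
  have ts : Tendsto (fun p : ℝ × ℝ × ℝ => p.2.2) l (𝓝 s₀) :=
    ((continuous_snd.comp continuous_snd).tendsto (x₀, y₀, s₀)).mono_left hle
  have hc1 : HasDerivAt (fun x => (c x).1) c'.1 x₀ := hc.fst
  have hc2 : HasDerivAt (fun x => (c x).2) c'.2 x₀ := hc.snd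
  have hd1 : HasDerivAt (fun x => (d x).1) d'.1 y₀ := hd.fst
  have hd2 : HasDerivAt (fun x => (d x).2) d'.2 y₀ := hd.snd
  have tv : Tendsto (fun p : ℝ × ℝ × ℝ => (c p.1).2 - p.2.2) l (𝓝 ((c x₀).2 - s₀)) :=
    (hc2.continuousAt.tendsto.comp tx).sub ts
  have hZ0 := (hZ.self_of_nhdsWithin h0)
  simp only at hZ0
  have eP : (fun p : ℝ × ℝ × ℝ => (c p.1).2 - (c x₀).2) =ᶠ[l]
      fun p => (d p.2.1).2 - (d y₀).2 := by
    filter_upwards [hZ] with p hp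
    rw [hp.1, hZ0.1]
  have eR : (fun p : ℝ × ℝ × ℝ => r ((c p.1).2 - p.2.2) - r ((c x₀).2 - s₀)) =ᶠ[l]
      fun p => ((d p.2.1).1 - (d y₀).1) - ((c p.1).1 - (c x₀).1) := by
    filter_upwards [hZ] with p hp
    linarith [hp.2, hZ0.2]
  have oQ : (fun p : ℝ × ℝ × ℝ => (d p.2.1).2 - (d y₀).2) =O[l] fun p => p.2.1 - y₀ :=
    hd2.isBigO_sub.comp_tendsto ty
  have oB : (fun p : ℝ × ℝ × ℝ => (d p.2.1).1 - (d y₀).1) =O[l] fun p => p.2.1 - y₀ :=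
    hd1.isBigO_sub.comp_tendsto ty
  have oP := eP.trans_isBigO oQ
  have ox : (fun p : ℝ × ℝ × ℝ => p.1 - x₀) =O[l] fun p => p.2.1 - y₀ :=
    ((isBigO_sub_of_hasDerivAt hc2 hreg).comp_tendsto tx).trans oP
  have oA := (hc1.isBigO_sub.comp_tendsto tx).trans ox
  have oR := eR.trans_isBigO (oB.sub oA)
  have ov : (fun p : ℝ × ℝ × ℝ => ((c p.1).2 - p.2.2) - ((c x₀).2 - s₀)) =O[l]
      fun p => p.2.1 - y₀ :=
    ((isBigO_sub_of_hasDerivAt hr hr').comp_tendsto tv).trans oR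
  have os : (fun p : ℝ × ℝ × ℝ => p.2.2 - s₀) =O[l] fun p => p.2.1 - y₀ := by
    refine (oP.sub ov).congr_left fun p => ?_
    ring
  refine ⟨?_, ?_⟩
  · have : (fun p : ℝ × ℝ × ℝ => p - (x₀, y₀, s₀)) =O[l] fun p => p.2.1 - y₀ :=
      ox.prod_left ((isBigO_refl _ _).prod_left os)
    refine this.norm_left.congr_left fun p => ?_
    rw [dist_eq_norm]
  · have E1 := (((hasDerivAt_iff_isLittleO.1 hc2).comp_tendsto tx).trans_isBigO ox)
    have E2 := (hasDerivAt_iff_isLittleO.1 hd2).comp_tendsto ty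
    have E3 := (((hasDerivAt_iff_isLittleO.1 hc1).comp_tendsto tx).trans_isBigO ox)
    have E4 := (hasDerivAt_iff_isLittleO.1 hd1).comp_tendsto ty
    have E5 := (((hasDerivAt_iff_isLittleO.1 hr).comp_tendsto tv).trans_isBigO ov)
    -- To first order, `c'.2 dx = d'.2 dy` and `c'.1 dx + r' (c'.2 dx - ds) = d'.1 dy`. Eliminating
    -- `dx` gives `c'.2 r' ds = ((c'.1 + r' c'.2) d'.2 - c'.2 d'.1) dy`, which is 0 by `hdet`. The
    -- same elimination is carried out with the error terms.
    have key := ((((E2.const_mul_left (c'.2 * r')).sub (E4.const_mul_left c'.2)).add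
      (E3.const_mul_left c'.2)).add ((E2.sub E1).const_mul_left c'.1)).add
      (E5.const_mul_left c'.2)
    have key2 := key.const_mul_left (c'.2 * r')⁻¹
    refine key2.congr' ?_ (Eventually.of_forall fun p => rfl)
    filter_upwards [eP, eR] with p h1 h2
    simp only [comp_apply, smul_eq_mul]
    rw [inv_mul_eq_iff_eq_mul₀ (mul_ne_zero hreg hr')]
    linear_combination c'.2 * h2 - (c'.2 * r' + c'.1) * h1 - (p.2.1 - y₀) * hdet

end Winding

/-! ### Transversality in collar coordinates. -/

namespace Winding

open MeasureTheory Asymptotics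

variable {R : Type*} [TopologicalSpace R] [ChartedSpace (EuclideanHalfSpace 2) R]
  [IsManifold (𝓡∂ 2) ∞ R] {o : SurfaceOrientation R} {τ : ℝ → R} {V : Set R} {K : ℝ → ℝ → R}
  {γ δ : ℝ → R}

/-- In collar coordinates, `γ` is at `q` with velocity `v` at the parameter `x`. -/
def HasVel (K : ℝ → ℝ → R) (γ : ℝ → R) (x : ℝ) (q v : ℝ × ℝ) : Prop :=
  ∃ c : ℝ → ℝ × ℝ, HasDerivAt c v x ∧ c x = q ∧ ∀ᶠ y in 𝓝 x, γ y = uncurry K (c y)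

lemma IsCollar.exists_lift (hK : IsCollar o τ V K) {x : ℝ} {q : ℝ × ℝ}
    (hq : q.2 ∈ Ioo (-1 : ℝ) 1) (hγ : ContMDiffAt 𝓘(ℝ, ℝ) (𝓡∂ 2) ∞ γ x)
    (hx : γ x = uncurry K q) :
    ∃ c : ℝ → ℝ × ℝ, ContDiffAt ℝ ∞ c x ∧ c x = q ∧ ∀ᶠ y in 𝓝 x, γ y = uncurry K (c y) := by
  obtain ⟨J, h1, h2, -, h4⟩ := hK.exists_coords hq
  rw [← hx] at h1 h2 h4
  refine ⟨J ∘ γ, contMDiffAt_iff_contDiffAt.1 (ContMDiffAt.comp x (g := J) (f := γ) h1 hγ), h2, ?_⟩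
  filter_upwards [hγ.continuousAt.eventually h4] with y hy
  exact hy.symm

lemma IsCollar.exists_hasVel (hK : IsCollar o τ V K) {x : ℝ} {q : ℝ × ℝ}
    (hq : q.2 ∈ Ioo (-1 : ℝ) 1) (hγ : ContMDiffAt 𝓘(ℝ, ℝ) (𝓡∂ 2) ∞ γ x)
    (hx : γ x = uncurry K q) : ∃ v, HasVel K γ x q v := by
  obtain ⟨c, h1, h2, h3⟩ := hK.exists_lift hq hγ hx
  exact ⟨_, c, (h1.differentiableAt (by simp)).hasDerivAt, h2, h3⟩

lemma HasVel.apply_eq {x : ℝ} {q v : ℝ × ℝ} (h : HasVel K γ x q v) : γ x = uncurry K q := by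
  obtain ⟨c, -, rfl, h3⟩ := h
  exact h3.self_of_nhds

lemma HasVel.deriv_eq (hK : IsCollar o τ V K) {x : ℝ} {q v : ℝ × ℝ} (hq : q.2 ∈ Ioo (-1 : ℝ) 1)
    (h : HasVel K γ x q v) {φ : PartialEquiv R Plane} (hφ : PlanarAt φ (γ x)) :
    deriv (φ ∘ γ) x = fderiv ℝ (φ ∘ uncurry K) q v := by
  have hx := h.apply_eq
  obtain ⟨c, h1, rfl, h3⟩ := h
  have hd : HasFDerivAt (φ ∘ uncurry K) (fderiv ℝ (φ ∘ uncurry K) (c x)) (c x) :=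
    ((PlanarAt.contDiffAt_comp (c := uncurry K) (n := ∞) le_rfl (hx ▸ hφ)
      (hK.smooth _ hq)).differentiableAt (by simp)).hasFDerivAt
  have h4 := hd.comp_hasDerivAt x h1
  refine (h4.congr_of_eventuallyEq ?_).deriv
  filter_upwards [h3] with y hy
  simp only [comp_apply, hy]

lemma fderiv_pair (A : ℝ × ℝ →L[ℝ] Plane) (v : ℝ × ℝ) :
    A v = v.1 • A (1, 0) + v.2 • A (0, 1) := by
  rw [← map_smul, ← map_smul, ← map_add]
  congr 1
  ext <;> simp

lemma cross_pair (A : ℝ × ℝ →L[ℝ] Plane) (v w : ℝ × ℝ) :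
    cross (A v) (A w) = (v.1 * w.2 - v.2 * w.1) * cross (A (1, 0)) (A (0, 1)) := by
  rw [fderiv_pair A v, fderiv_pair A w]
  simp only [cross, PiLp.add_apply, PiLp.smul_apply, smul_eq_mul]
  ring

/-- Transversality, in collar coordinates. -/
lemma cross_ne_zero_iff_of_hasVel (hK : IsCollar o τ V K) {x y : ℝ} {q v w : ℝ × ℝ}
    (hq : q.2 ∈ Ioo (-1 : ℝ) 1) (hx : x ∈ unitI) (hy : y ∈ unitI)
    (hγ : ContMDiffAt 𝓘(ℝ, ℝ) (𝓡∂ 2) ∞ γ x) (hδ : ContMDiffAt 𝓘(ℝ, ℝ) (𝓡∂ 2) ∞ δ y)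
    (h : HasVel K γ x q v) (h' : HasVel K δ y q w) :
    cross (velIn (extChartAt (𝓡∂ 2) (γ x)) γ x) (velIn (extChartAt (𝓡∂ 2) (γ x)) δ y) ≠ 0 ↔
      v.1 * w.2 - v.2 * w.1 ≠ 0 := by
  have hxy : γ x = δ y := h.apply_eq.trans h'.apply_eq.symm
  have hi : γ x ∈ (𝓡∂ 2).interior R := by rw [h.apply_eq]; exact hK.interior _ _ hq
  have hφ := orientedAt_coord o hi
  rw [transverse_iff hx hy hφ.planarAt hγ hδ hxy, h.deriv_eq hK hq hφ.planarAt,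
    h'.deriv_eq hK hq (hxy ▸ hφ.planarAt), cross_pair]
  have := hK.oriented q hq _ (by rw [← h.apply_eq]; exact hφ)
  exact ⟨fun h => left_ne_zero_of_mul h, fun h => mul_ne_zero h this.ne'⟩

lemma HasVel.rotate (hK : IsCollar o τ V K) {x : ℝ} {q v : ℝ × ℝ} (hq : q.2 ∈ Ioo (-1 : ℝ) 1)
    (h : HasVel K γ x q v) {ρ : ℝ → ℝ} (hρ : Differentiable ℝ ρ) :
    HasVel K (rotate K ρ ∘ γ) x (q.1 + ρ q.2, q.2) (v.1 + deriv ρ q.2 * v.2, v.2) := by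
  obtain ⟨c, h1, rfl, h3⟩ := h
  refine ⟨fun y => ((c y).1 + ρ (c y).2, (c y).2), ?_, rfl, ?_⟩
  · have f1 : HasDerivAt (fun y => (c y).1) v.1 x := h1.fst
    have f2 : HasDerivAt (fun y => (c y).2) v.2 x := h1.snd
    have f3 : HasDerivAt (fun y => ρ (c y).2) (deriv ρ (c x).2 * v.2) x :=
      HasDerivAt.comp x (hρ (c x).2).hasDerivAt f2
    exact HasDerivAt.prodMk (f1.add f3) f2
  · have : ContinuousAt (fun y => (c y).2) x := h1.continuousAt.snd
    filter_upwards [h3, this.eventually (isOpen_Ioo.mem_nhds hq)] with y h4 h5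
    rw [comp_apply, h4]
    exact hK.rotate_apply ρ _ h5

lemma HasVel.add_int (hK : IsCollar o τ V K) {x : ℝ} {q v : ℝ × ℝ}
    (h : HasVel K γ x q v) (n : ℤ) : HasVel K γ x (q.1 + n, q.2) v := by
  obtain ⟨c, h1, rfl, h3⟩ := h
  refine ⟨fun y => ((c y).1 + n, (c y).2), (h1.fst.add_const _).prodMk h1.snd, rfl, ?_⟩
  filter_upwards [h3] with y h4
  rw [h4]
  exact (hK.add_int _ _ n).symm

lemma velIn_of_eventually_eq {W : R → R} {s : ℝ} (hγ : ContMDiffOn 𝓘(ℝ, ℝ) (𝓡∂ 2) ∞ γ unitI)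
    (hs : s ∈ unitI) (hW : ∀ᶠ y in 𝓝 (γ s), W y = y) (φ : PartialEquiv R Plane) :
    velIn φ (W ∘ γ) s = velIn φ γ s := by
  have h1 : ∀ᶠ t in 𝓝[unitI] s, W (γ t) = γ t := (hγ s hs).continuousWithinAt.eventually hW
  refine Filter.EventuallyEq.derivWithin_eq ?_ ?_
  · filter_upwards [h1] with t ht
    simp only [comp_apply, ht]
  · simp only [comp_apply, h1.self_of_nhdsWithin hs]

/-- At a level where `ρ` is stationary the rotation is by whole turns and changes neither the point
nor the velocity, so the old transversality applies. At other levels the rotated velocity is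
sheared, and the last hypothesis is exactly what is needed. -/
theorem transverse_rotate [T2Space R] (hK : IsCollar o τ V K) {ρ : ℝ → ℝ} (hs : ContDiff ℝ ∞ ρ)
    (hρ : tsupport ρ ⊆ Ioo (-1) 1) (hint : ∀ t, deriv ρ t = 0 → ∃ n : ℤ, ρ t = n)
    (hγ : IsProperCurve γ) (hδ : IsProperCurve δ) (hγδ : Transverse γ δ)
    (h : ∀ x ∈ unitI, ∀ y ∈ unitI, ∀ a b t v w, HasVel K γ x (a, t) v → HasVel K δ y (b, t) w →
      a + ρ t = b → deriv ρ t ≠ 0 → (v.1 + deriv ρ t * v.2) * w.2 - v.2 * w.1 ≠ 0) :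
    Transverse (rotate K ρ ∘ γ) δ := by
  intro x hx y hy hxy
  by_cases hxs : γ x ∈ strip K (tsupport ρ)
  · obtain ⟨a, t, ht, hxa⟩ := hxs
    have ht' := hρ ht
    have hi : γ x ∈ (𝓡∂ 2).interior R := hxa ▸ hK.interior a t ht'
    have hWx : rotate K ρ (γ x) = K (a + ρ t) t := by rw [← hxa, hK.rotate_apply ρ a ht']
    have hyb : δ y = uncurry K (a + ρ t, t) := by rw [← hxy]; exact hWx
    have hg := goodParam_of_mem hγ hx hi
    have hd := goodParam_of_mem hδ hy (by rw [hyb]; exact hK.interior _ _ ht')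
    obtain ⟨v, hv⟩ := hK.exists_hasVel (q := (a, t)) ht' hg.contMDiffAt hxa.symm
    obtain ⟨w, hw⟩ := hK.exists_hasVel (q := (a + ρ t, t)) ht' hd.contMDiffAt hyb
    have hv' := hv.rotate hK ht' (hs.differentiable (by simp))
    have hWγ : ContMDiffAt 𝓘(ℝ, ℝ) (𝓡∂ 2) ∞ (rotate K ρ ∘ γ) x :=
      (hK.contMDiffAt_rotate hs hρ _).comp x hg.contMDiffAt
    rw [cross_ne_zero_iff_of_hasVel hK (q := (a + ρ t, t)) ht' hx hy hWγ hd.contMDiffAt hv' hw]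
    by_cases h0 : deriv ρ t = 0
    · obtain ⟨n, hn⟩ := hint t h0
      have h1 := hv.add_int hK n
      simp only [← hn] at h1
      have h2 := hγδ x hx y hy (h1.apply_eq.trans hyb.symm)
      rw [cross_ne_zero_iff_of_hasVel hK (q := (a + ρ t, t)) ht' hx hy hg.contMDiffAt
        hd.contMDiffAt h1 hw] at h2
      simpa [h0] using h2
    · exact h x hx y hy a _ t v w hv hw rfl h0
  · have hW := (hK.eventually_rotate_eq_self hρ hxs).mono fun y hy => hy ρ le_rfl
    rw [velIn_of_eventually_eq hγ.contMDiffOn hx hW, comp_apply, hW.self_of_nhds]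
    exact hγδ x hx y hy (by rw [← hxy, comp_apply, hW.self_of_nhds])

/-! ### Generic shifts -/

/-- At levels in `P`, the curve is transverse to the circles of constant level. -/
def LevelRegular (K : ℝ → ℝ → R) (γ : ℝ → R) (P : Set ℝ) : Prop :=
  ∀ x ∈ unitI, ∀ a, ∀ t ∈ P, ∀ v, HasVel K γ x (a, t) v → v.2 ≠ 0

/-- Tangencies `(x, y, s)` of a curve, sheared along the collar by `r` shifted by `s`, with another
curve. -/
def Tangency (K : ℝ → ℝ → R) (γ δ : ℝ → R) (r : ℝ → ℝ) (P : Set ℝ) : Set (ℝ × ℝ × ℝ) :=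
  {p | p.1 ∈ unitI ∧ p.2.1 ∈ unitI ∧ ∃ a b t v w, t ∈ P ∧ HasVel K γ p.1 (a, t) v ∧
    HasVel K δ p.2.1 (b, t) w ∧ (∃ n : ℤ, a + r (t - p.2.2) - b = n) ∧ deriv r (t - p.2.2) ≠ 0 ∧
    (v.1 + deriv r (t - p.2.2) * v.2) * w.2 - v.2 * w.1 = 0}

/-- Regularity of the levels makes `isLittleO_of_tangency` applicable at every tangency: on the set
of tangencies the parameter of `δ` is a local coordinate, and the shift is stationary with respect
to it. -/
lemma volume_tangency_of_left (hK : IsCollar o τ V K) {r : ℝ → ℝ} (hr : ContDiff ℝ ∞ r)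
    {P : Set ℝ} (hP : P ⊆ Ioo (-1) 1) (hreg : LevelRegular K γ P) :
    volume ((fun p : ℝ × ℝ × ℝ => p.2.2) '' Tangency K γ δ r P) = 0 := by
  have key : ∀ p ∈ Tangency K γ δ r P,
      ((fun q : ℝ × ℝ × ℝ => dist q p) =O[𝓝[Tangency K γ δ r P] p] fun q => q.2.1 - p.2.1) ∧
      (fun q : ℝ × ℝ × ℝ => q.2.2 - p.2.2) =o[𝓝[Tangency K γ δ r P] p] fun q => q.2.1 - p.2.1 := by
    rintro ⟨x, y, s⟩ hp
    have hp' := hp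
    obtain ⟨hx, hy, a, b, t, v, w, ht, hv, hw, ⟨n, hn⟩, hr', hdet⟩ := hp
    simp only at hx hy hv hw hn hr' hdet
    have hv2 := hreg x hx a t ht v hv
    obtain ⟨c, hc, hcx, hcγ⟩ := hv
    obtain ⟨d, hd, hdy, hdδ⟩ := hw
    have hrd : HasDerivAt r (deriv r (t - s)) ((c x).2 - s) := by
      rw [hcx]; exact (hr.differentiable (by simp) _).hasDerivAt
    refine isLittleO_of_tangency hc hd hrd hr' hv2 hdet (e := n) hp' ?_
    set Z := Tangency K γ δ r P
    have tx : Tendsto (fun p : ℝ × ℝ × ℝ => p.1) (𝓝 (x, y, s)) (𝓝 x) :=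
      continuous_fst.tendsto (x, y, s)
    have ty : Tendsto (fun p : ℝ × ℝ × ℝ => p.2.1) (𝓝 (x, y, s)) (𝓝 y) :=
      (continuous_fst.comp continuous_snd).tendsto (x, y, s)
    have ts : Tendsto (fun p : ℝ × ℝ × ℝ => p.2.2) (𝓝 (x, y, s)) (𝓝 s) :=
      (continuous_snd.comp continuous_snd).tendsto (x, y, s)
    have tc := hc.continuousAt.tendsto.comp tx
    have td := hd.continuousAt.tendsto.comp ty
    have tc2 : Tendsto (fun p : ℝ × ℝ × ℝ => (c p.1).2) (𝓝 (x, y, s)) (𝓝 (c x).2) :=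
      (continuous_snd.tendsto _).comp tc
    have td2 : Tendsto (fun p : ℝ × ℝ × ℝ => (d p.2.1).2) (𝓝 (x, y, s)) (𝓝 (d y).2) :=
      (continuous_snd.tendsto _).comp td
    have tF : Tendsto (fun p : ℝ × ℝ × ℝ => (c p.1).1 + r ((c p.1).2 - p.2.2) - (d p.2.1).1)
        (𝓝 (x, y, s)) (𝓝 n) := by
      have h1 : Tendsto (fun p : ℝ × ℝ × ℝ => r ((c p.1).2 - p.2.2)) (𝓝 (x, y, s))
          (𝓝 (r ((c x).2 - s))) := (hr.continuous.tendsto _).comp (tc2.sub ts)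
      have h2 := (((continuous_fst.tendsto _).comp tc).add h1).sub
        ((continuous_fst.tendsto _).comp td)
      rw [hcx, hdy] at h2
      simp only [hn] at h2
      exact h2
    -- The angular difference is an integer at every tangency and is close to `n`, so the integer is
    -- the same for all nearby tangencies.
    have hne := tF.eventually (Metric.ball_mem_nhds (n : ℝ) one_pos)
    have k1 : ∀ᶠ p in 𝓝 (x, y, s), (c p.1).2 ∈ Ioo (-1 : ℝ) 1 :=
      tc2.eventually (isOpen_Ioo.mem_nhds (by rw [hcx]; exact hP ht))
    have k2 : ∀ᶠ p in 𝓝 (x, y, s), (d p.2.1).2 ∈ Ioo (-1 : ℝ) 1 :=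
      td2.eventually (isOpen_Ioo.mem_nhds (by rw [hdy]; exact hP ht))
    rw [eventually_nhdsWithin_iff]
    filter_upwards [hne, k1, k2, tx.eventually hcγ, ty.eventually hdδ]
      with p h1 h2 h3 h4 h5 hpZ
    obtain ⟨-, -, a', b', t', v', w', ht', hv', hw', ⟨m, hm⟩, -, -⟩ := hpZ
    obtain ⟨x', y', s'⟩ := p
    simp only at h1 h2 h3 h4 h5 hm hv' hw' ⊢
    obtain ⟨⟨i, hi⟩, e1⟩ := hK.inj (c x').1 (c x').2 a' t' h2 (hP ht') (by
      have := hv'.apply_eq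
      rw [h4] at this
      exact this)
    obtain ⟨⟨j, hj⟩, e2⟩ := hK.inj (d y').1 (d y').2 b' t' h3 (hP ht') (by
      have := hw'.apply_eq
      rw [h5] at this
      exact this)
    refine ⟨e1.trans e2.symm, ?_⟩
    have e3 : (c x').1 + r ((c x').2 - s') - (d y').1 = ((m + i - j : ℤ) : ℝ) := by
      rw [e1]; push_cast; linarith
    rw [e3, Real.dist_eq, abs_lt] at h1
    have h6 : ((m + i - j : ℤ) : ℝ) < (n + 1 : ℤ) := by push_cast at h1 ⊢; linarith [h1.2]
    have h7 : (n : ℝ) < (m + i - j + 1 : ℤ) := by push_cast at h1 ⊢; linarith [h1.1]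
    have h8 : m + i - j < n + 1 := by exact_mod_cast h6
    have h9 : n < m + i - j + 1 := by exact_mod_cast h7
    rw [e3, show m + i - j = n by omega]
  exact volume_image_of_isLittleO (y := fun p : ℝ × ℝ × ℝ => p.2.1) (fun p hp => (key p hp).1)
    fun p hp => (key p hp).2

/-- Rotating `γ` by `r` against `δ` amounts to rotating `δ` by `-r` against `γ`, so regularity of
either curve is enough. -/
lemma volume_tangency (hK : IsCollar o τ V K) {r : ℝ → ℝ} (hr : ContDiff ℝ ∞ r)
    {P : Set ℝ} (hP : P ⊆ Ioo (-1) 1) (hreg : LevelRegular K γ P ∨ LevelRegular K δ P) :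
    volume ((fun p : ℝ × ℝ × ℝ => p.2.2) '' Tangency K γ δ r P) = 0 := by
  rcases hreg with h | h
  · exact volume_tangency_of_left hK hr hP h
  · refine measure_mono_null ?_ (volume_tangency_of_left (δ := γ) hK hr.neg hP h)
    rintro _ ⟨⟨x, y, s⟩, ⟨hx, hy, a, b, t, v, w, ht, hv, hw, ⟨n, hn⟩, hr', hdet⟩, rfl⟩
    have hd : deriv (fun x => -r x) (t - s) = -deriv r (t - s) := deriv.fun_neg
    refine ⟨(y, x, s), ⟨hy, hx, b, a, t, w, v, ht, hw, hv, ⟨-n, ?_⟩, ?_, ?_⟩, rfl⟩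
    · simp only at hn ⊢
      push_cast
      linarith
    · simp only at hr' ⊢
      rw [hd]
      exact neg_ne_zero.2 hr'
    · simp only at hdet ⊢
      rw [hd]
      linarith

/-- Every interval of levels contains an interval of regular levels. -/
lemma exists_levelRegular [T2Space R] (hK : IsCollar o τ V K) (hγ : IsProperCurve γ) {α β : ℝ}
    (hαβ : α < β) (h : Icc α β ⊆ Ioo (-1) 1) :
    ∃ α' β', α' < β' ∧ Icc α' β' ⊆ Icc α β ∧ LevelRegular K γ (Icc α' β') := by
  classical
  have hstrip : IsClosed (strip K (Icc α β)) := (hK.isCompact_strip isCompact_Icc h).isClosed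
  let E : Set ℝ := unitI ∩ γ ⁻¹' strip K (Icc α β)
  have hE : IsClosed E := hγ.contMDiffOn.continuousOn.preimage_isClosed_of_isClosed isClosed_Icc
    hstrip
  -- the level, as a function on the surface
  let lev : R → ℝ := fun y => if hy : ∃ q : ℝ × ℝ, q.2 ∈ Ioo (-1 : ℝ) 1 ∧ uncurry K q = y then
    hy.choose.2 else 0
  have hlev : ∀ q : ℝ × ℝ, q.2 ∈ Ioo (-1 : ℝ) 1 → lev (uncurry K q) = q.2 := by
    intro q hq
    have hy : ∃ q' : ℝ × ℝ, q'.2 ∈ Ioo (-1 : ℝ) 1 ∧ uncurry K q' = uncurry K q := ⟨q, hq, rfl⟩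
    simp only [lev, dif_pos hy]
    exact (hK.inj _ _ _ _ hy.choose_spec.1 hq hy.choose_spec.2).2
  have hvel : ∀ x a t, t ∈ Ioo (-1 : ℝ) 1 → ∀ v, HasVel K γ x (a, t) v →
      HasDerivAt (lev ∘ γ) v.2 x := by
    rintro x a t ht v ⟨c, hc, hcx, hcγ⟩
    have f2 : HasDerivAt (fun y => (c y).2) v.2 x := hc.snd
    refine f2.congr_of_eventuallyEq ?_
    have : ContinuousAt (fun y => (c y).2) x := hc.continuousAt.snd
    filter_upwards [hcγ, this.eventually (isOpen_Ioo.mem_nhds (by beta_reduce; rw [hcx]; exact ht))]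
      with y h1 h2
    rw [comp_apply, h1, hlev _ h2]
  have hsm : ∀ x ∈ E, ContDiffAt ℝ ∞ (lev ∘ γ) x := by
    rintro x ⟨hx, a, t, ht, hxa⟩
    have hg := goodParam_of_mem hγ hx (hxa ▸ hK.interior a t (h ht))
    obtain ⟨c, h1, h2, h3⟩ := hK.exists_lift (q := (a, t)) (h ht) hg.contMDiffAt hxa.symm
    refine (contDiffAt_snd.comp x h1).congr_of_eventuallyEq ?_
    have : ContinuousAt (fun y => (c y).2) x := h1.continuousAt.snd
    filter_upwards [h3, this.eventually (isOpen_Ioo.mem_nhds (by beta_reduce; rw [h2]; exact h ht))]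
      with y h1 h2
    rw [comp_apply, h1, hlev _ h2]
    rfl
  -- The critical parameters form a compact set, so the critical levels are compact and null; the
  -- regular levels are open and nonempty in the interval.
  let Cr : Set ℝ := E ∩ deriv (lev ∘ γ) ⁻¹' {0}
  have hCr : IsClosed Cr := by
    refine ContinuousOn.preimage_isClosed_of_isClosed (fun x hx => ?_) hE isClosed_singleton
    have h1 := ((hsm x hx).fderiv_right (m := 0) (by simp)).continuousAt.clm_apply
      (continuousAt_const (y := (1 : ℝ)))
    simp only [fderiv_apply_one_eq_deriv] at h1
    exact h1.continuousWithinAt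
  have hCrc : IsCompact Cr := isCompact_Icc.of_isClosed_subset hCr fun x hx => hx.1.1
  have him : IsCompact ((lev ∘ γ) '' Cr) := hCrc.image_of_continuousOn fun x hx =>
    (hsm x hx.1).continuousAt.continuousWithinAt
  have hnull : volume ((lev ∘ γ) '' Cr) = 0 := by
    refine volume_image_of_deriv_eq_zero fun x hx => ?_
    have h1 := ((hsm x hx.1).differentiableAt (by simp)).hasDerivAt
    rw [show deriv (lev ∘ γ) x = 0 from hx.2] at h1
    exact h1.hasDerivWithinAt
  have hne : (Ioo α β \ (lev ∘ γ) '' Cr).Nonempty := by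
    rw [nonempty_iff_ne_empty]
    intro h0
    have h1 := measure_mono_null (sdiff_eq_empty.1 h0) hnull
    rw [Real.volume_Ioo, ENNReal.ofReal_eq_zero] at h1
    linarith
  obtain ⟨t₀, ht₀⟩ := hne
  obtain ⟨ε, hε, hb⟩ := Metric.isOpen_iff.1 (isOpen_Ioo.sdiff him.isClosed) t₀ ht₀
  have hsub : Icc (t₀ - ε / 2) (t₀ + ε / 2) ⊆ Ioo α β \ (lev ∘ γ) '' Cr := by
    intro t ht
    apply hb
    rw [Metric.mem_ball, Real.dist_eq, abs_lt]
    constructor <;> linarith [ht.1, ht.2]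
  refine ⟨t₀ - ε / 2, t₀ + ε / 2, by linarith, fun t ht => Ioo_subset_Icc_self (hsub ht).1, ?_⟩
  intro x hx a t ht v hv hv0
  have hta := Ioo_subset_Icc_self (hsub ht).1
  have h1 := hvel x a t (h hta) v hv
  rw [hv0] at h1
  have hxE : x ∈ E := ⟨hx, a, t, hta, hv.apply_eq.symm⟩
  refine (hsub ht).2 ⟨x, ⟨hxE, h1.deriv⟩, ?_⟩
  rw [comp_apply, hv.apply_eq]
  exact hlev (a, t) (h hta)

lemma exists_levelRegular_family [T2Space R] (hK : IsCollar o τ V K) {ι : Type*} [Finite ι]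
    {Γ : ι → ℝ → R} (hΓ : ∀ i, IsProperCurve (Γ i)) {α β : ℝ}
    (hαβ : α < β) (h : Icc α β ⊆ Ioo (-1) 1) :
    ∃ α' β', α' < β' ∧ Icc α' β' ⊆ Icc α β ∧ ∀ i, LevelRegular K (Γ i) (Icc α' β') := by
  classical
  have := Fintype.ofFinite ι
  have key : ∀ s : Finset ι, ∃ α' β', α' < β' ∧ Icc α' β' ⊆ Icc α β ∧
      ∀ i ∈ s, LevelRegular K (Γ i) (Icc α' β') := by
    intro s
    induction s using Finset.induction_on with
    | empty => exact ⟨α, β, hαβ, le_rfl, by simp⟩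
    | insert i s _ ih =>
      obtain ⟨α₁, β₁, h1, h2, h3⟩ := ih
      obtain ⟨α₂, β₂, h4, h5, h6⟩ := exists_levelRegular hK (hΓ i) h1 (h2.trans h)
      refine ⟨α₂, β₂, h4, h5.trans h2, fun j hj => ?_⟩
      rcases Finset.mem_insert.1 hj with rfl | hj
      · exact h6
      · exact fun x hx a t ht => h3 j hj x hx a t (h5 ht)
  obtain ⟨α', β', h1, h2, h3⟩ := key Finset.univ
  exact ⟨α', β', h1, h2, fun i => h3 i (Finset.mem_univ i)⟩

end Winding

namespace Winding

open MeasureTheory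

/-! ### Bump functions -/

/-- With `f = exp (-1/x)` and `g = exp (-1/(1-x))` the transition is `f / (f + g)`. The numerator of
its derivative is `f' g - f g'`, which is positive because `f` increases and `g` decreases. -/
lemma deriv_smoothTransition_ne_zero {x : ℝ} (h0 : 0 < x) (h1 : x < 1) :
    deriv Real.smoothTransition x ≠ 0 := by
  have hd : ∀ y : ℝ, 0 < y → HasDerivAt (fun y => Real.exp (-y⁻¹))
      (Real.exp (-y⁻¹) * (y ^ 2)⁻¹) y := by
    intro y hy
    have := (hasDerivAt_inv hy.ne').neg.exp
    simpa using this
  have hf := hd x h0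
  have hg : HasDerivAt (fun y => Real.exp (-(1 - y)⁻¹))
      (-(Real.exp (-(1 - x)⁻¹) * ((1 - x) ^ 2)⁻¹)) x := by
    have h2 : HasDerivAt (fun y : ℝ => 1 - y) (-1) x := (hasDerivAt_id x).const_sub 1
    have h3 := HasDerivAt.comp x (hd (1 - x) (by linarith)) h2
    rw [mul_neg_one] at h3
    exact h3
  have hq := hf.div (hf.add hg) (add_pos (Real.exp_pos _) (Real.exp_pos _)).ne'
  have hev : Real.smoothTransition =ᶠ[𝓝 x] fun y => Real.exp (-y⁻¹) /
      (Real.exp (-y⁻¹) + Real.exp (-(1 - y)⁻¹)) := by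
    filter_upwards [lt_mem_nhds h0, gt_mem_nhds h1] with y hy0 hy1
    simp [Real.smoothTransition, expNegInvGlue, hy0.not_ge, hy1.not_ge]
  rw [hev.deriv_eq]
  refine ne_of_gt ?_
  have : deriv (fun y => Real.exp (-y⁻¹) / (Real.exp (-y⁻¹) + Real.exp (-(1 - y)⁻¹))) x = _ :=
    hq.deriv
  rw [this]
  have hx : 0 < 1 - x := by linarith
  refine div_pos ?_ (pow_pos (add_pos (Real.exp_pos _) (Real.exp_pos _)) 2)
  simp only [Pi.add_apply]
  have e1 : 0 < Real.exp (-x⁻¹) * (x ^ 2)⁻¹ * Real.exp (-(1 - x)⁻¹) := by positivity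
  have e2 : 0 < Real.exp (-x⁻¹) * (Real.exp (-(1 - x)⁻¹) * ((1 - x) ^ 2)⁻¹) := by positivity
  nlinarith

/-- A smooth bump with a plateau on `[-1, 1]` and support `(-2, 2)`. -/
noncomputable def plateau (u : ℝ) : ℝ :=
  Real.smoothTransition (2 - u) * Real.smoothTransition (2 + u)

lemma contDiff_plateau : ContDiff ℝ ∞ plateau :=
  (Real.smoothTransition.contDiff.comp (contDiff_const.sub contDiff_id)).mul
    (Real.smoothTransition.contDiff.comp (contDiff_const.add contDiff_id))

lemma plateau_of_nonneg {u : ℝ} (h : -1 ≤ u) : plateau u = Real.smoothTransition (2 - u) := by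
  rw [plateau, Real.smoothTransition.one_of_one_le (x := 2 + u) (by linarith), mul_one]

lemma plateau_neg (u : ℝ) : plateau (-u) = plateau u := by
  rw [plateau, plateau, sub_neg_eq_add, ← sub_eq_add_neg, mul_comm]

lemma plateau_of_nonpos {u : ℝ} (h : u ≤ 1) : plateau u = Real.smoothTransition (2 + u) := by
  rw [← plateau_neg, plateau_of_nonneg (by linarith), sub_neg_eq_add]

lemma plateau_eq_zero {u : ℝ} (h : 2 ≤ |u|) : plateau u = 0 := by
  rcases le_abs.1 h with h | h
  · rw [plateau, Real.smoothTransition.zero_of_nonpos (by linarith), zero_mul]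
  · rw [plateau, Real.smoothTransition.zero_of_nonpos (x := 2 + u) (by linarith), mul_zero]

lemma plateau_zero : plateau 0 = 1 := by
  rw [plateau_of_nonneg (by norm_num), Real.smoothTransition.one_of_one_le (by norm_num)]

/-- This is why the bumps have plateaus: stationary levels are levels of whole turns, at which
winding cannot create tangencies. -/
lemma plateau_eq_of_deriv_eq_zero {u : ℝ} (h : deriv plateau u = 0) :
    plateau u = 0 ∨ plateau u = 1 := by
  have key : ∀ u : ℝ, 0 ≤ u → deriv plateau u = 0 → plateau u = 0 ∨ plateau u = 1 := by
    intro u hu h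
    rcases le_or_gt u 1 with h1 | h1
    · right
      rw [plateau_of_nonneg (by linarith), Real.smoothTransition.one_of_one_le (by linarith)]
    rcases le_or_gt 2 u with h2 | h2
    · left
      exact plateau_eq_zero (h2.trans (le_abs_self u))
    exfalso
    have hev : plateau =ᶠ[𝓝 u] fun u => Real.smoothTransition (2 - u) := by
      filter_upwards [lt_mem_nhds h1] with v hv
      exact plateau_of_nonneg (by linarith)
    rw [hev.deriv_eq, deriv_comp_const_sub] at h
    exact deriv_smoothTransition_ne_zero (by linarith) (by linarith) (neg_eq_zero.1 h)
  rcases le_total 0 u with hu | hu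
  · exact key u hu h
  · have e : (fun v => plateau (-v)) = plateau := funext plateau_neg
    rw [← plateau_neg]
    refine key (-u) (by linarith) ?_
    have h1 : deriv (fun v => plateau (-v)) u = -deriv plateau (-u) := deriv_comp_neg _ _
    rw [e, h] at h1
    linarith

lemma isBump_plateau {a η : ℝ} (hη : 0 < η) (h : Icc (a - 2 * η) (a + 2 * η) ⊆ Ioo (-1) 1)
    {f : ℝ → ℝ} (hf : ∀ t, f t = plateau ((t - a) / η)) :
    IsBump f a ∧ tsupport f ⊆ Icc (a - 2 * η) (a + 2 * η) := by
  have hf' : f = fun t => plateau ((t - a) / η) := funext hf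
  have hsupp : tsupport f ⊆ Icc (a - 2 * η) (a + 2 * η) := by
    refine closure_minimal (fun t ht => ?_) isClosed_Icc
    by_contra h1
    apply ht
    rw [hf]
    refine plateau_eq_zero ?_
    rw [abs_div, abs_of_pos hη, le_div_iff₀ hη]
    by_contra h2
    push Not at h2
    rw [abs_lt] at h2
    exact h1 ⟨by linarith [h2.1], by linarith [h2.2]⟩
  refine ⟨⟨?_, ?_, ?_, ?_, hsupp.trans h⟩, hsupp⟩
  · rw [hf']
    exact contDiff_plateau.comp ((contDiff_id.sub contDiff_const).div_const η)
  · rw [hf, sub_self, zero_div, plateau_zero]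
  · intro s hs t ht hst
    have hs' : s ≤ a := hs
    have ht' : t ≤ a := ht
    have e : ∀ t, t ≤ a → (t - a) / η ≤ 1 := fun t ht => by
      rw [div_le_iff₀ hη]; linarith
    rw [hf, hf, plateau_of_nonpos (e s hs'), plateau_of_nonpos (e t ht')]
    apply Real.smoothTransition.monotone
    gcongr
  · intro s hs t ht hst
    have hs' : a ≤ s := hs
    have ht' : a ≤ t := ht
    have e : ∀ t, a ≤ t → -1 ≤ (t - a) / η := fun t ht => by
      rw [le_div_iff₀ hη]; linarith
    rw [hf, hf, plateau_of_nonneg (e s hs'), plateau_of_nonneg (e t ht')]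
    apply Real.smoothTransition.monotone
    gcongr

/-- The amount of winding at each level, up to a shift. -/
noncomputable def profile (p q η : ℝ) (k l : ℕ) (v : ℝ) : ℝ :=
  k * plateau ((v - p) / η) - l * plateau ((v - q) / η)

lemma contDiff_profile (p q η : ℝ) (k l : ℕ) : ContDiff ℝ ∞ (profile p q η k l) :=
  (contDiff_const.mul (contDiff_plateau.comp ((contDiff_id.sub contDiff_const).div_const η))).sub
    (contDiff_const.mul (contDiff_plateau.comp ((contDiff_id.sub contDiff_const).div_const η)))

/-- Each bump vanishes at distance `2 * η` from its centre. As the centres are more than `4 * η`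
apart, only one of the two terms is present near `v`. -/
lemma exists_int_of_deriv_profile {p q η : ℝ} (hη : 0 < η) (hpq : 4 * η < q - p) {k l : ℕ}
    {v : ℝ} (h : deriv (profile p q η k l) v = 0) : ∃ n : ℤ, profile p q η k l v = n := by
  have hz : ∀ a v : ℝ, 2 * η ≤ |v - a| → plateau ((v - a) / η) = 0 := by
    intro a v h
    refine plateau_eq_zero ?_
    rwa [abs_div, abs_of_pos hη, le_div_iff₀ hη]
  have hd : ∀ (c a : ℝ), deriv (fun v => c * plateau ((v - a) / η)) v =
      c * (deriv plateau ((v - a) / η) / η) := by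
    intro c a
    have h1 : HasDerivAt (fun v => (v - a) / η) (1 / η) v :=
      ((hasDerivAt_id v).sub_const a).div_const η
    have h2 := ((contDiff_plateau.differentiable (by simp) ((v - a) / η)).hasDerivAt.comp v
      h1).const_mul c
    rw [mul_one_div] at h2
    exact h2.deriv
  have hint : ∀ (c : ℤ) (a : ℝ), (c : ℝ) * (deriv plateau ((v - a) / η) / η) = 0 →
      ∃ n : ℤ, (c : ℝ) * plateau ((v - a) / η) = n := by
    intro c a h
    rcases mul_eq_zero.1 h with h | h
    · exact ⟨0, by rw [h]; simp⟩
    · rcases plateau_eq_of_deriv_eq_zero ((div_eq_zero_iff.1 h).resolve_right hη.ne') with h | h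
      · exact ⟨0, by rw [h]; simp⟩
      · exact ⟨c, by rw [h]; simp⟩
  have hcont : ∀ a : ℝ, ContinuousAt (fun y => |y - a|) v := fun a => by fun_prop
  rcases le_or_gt (|v - p|) (2 * η) with h1 | h1
  · have h2 : 2 * η < |v - q| := by
      rw [abs_le] at h1
      exact lt_of_lt_of_le (by linarith) (neg_le_abs (v - q))
    have hev : profile p q η k l =ᶠ[𝓝 v] fun v => (k : ℝ) * plateau ((v - p) / η) := by
      filter_upwards [(hcont q).eventually (lt_mem_nhds h2)] with y hy
      rw [profile, hz q y hy.le, mul_zero, sub_zero]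
    rw [hev.deriv_eq, hd] at h
    rw [hev.self_of_nhds]
    exact_mod_cast hint k p h
  · have hev : profile p q η k l =ᶠ[𝓝 v] fun v => -(l : ℝ) * plateau ((v - q) / η) := by
      filter_upwards [(hcont p).eventually (lt_mem_nhds h1)] with y hy
      rw [profile, hz p y hy.le, mul_zero]; ring
    rw [hev.deriv_eq, hd] at h
    rw [hev.self_of_nhds]
    have := hint (-l) q (by push_cast; exact h)
    simpa using this

/-! ### Construction of winding bands -/

variable {R : Type*} [TopologicalSpace R] [ChartedSpace (EuclideanHalfSpace 2) R]
  [IsManifold (𝓡∂ 2) ∞ R] {o : SurfaceOrientation R} {τ : ℝ → R} {V w : Set R} {K : ℝ → ℝ → R}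

lemma IsCollar.injective_mfderiv (hK : IsCollar o τ V K) {q : ℝ × ℝ}
    (hq : q.2 ∈ Ioo (-1 : ℝ) 1) :
    Injective (mfderiv 𝓘(ℝ, ℝ × ℝ) (𝓡∂ 2) (uncurry K) q) := by
  have hφ := orientedAt_coord o (hK.interior q.1 q.2 hq)
  set φ := o.coord (K q.1 q.2)
  have h1 : MDifferentiableAt (𝓡∂ 2) 𝓘(ℝ, Plane) φ (uncurry K q) :=
    hφ.planarAt.contMDiffAt.mdifferentiableAt (by simp)
  have h2 : MDifferentiableAt 𝓘(ℝ, ℝ × ℝ) (𝓡∂ 2) (uncurry K) q :=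
    (hK.smooth q hq).mdifferentiableAt (by simp)
  have h3 := mfderiv_comp q h1 h2
  rw [mfderiv_eq_fderiv] at h3
  have h4 := hK.oriented q hq φ hφ
  rw [injective_iff_map_eq_zero]
  intro v hv
  have h5 : fderiv ℝ (φ ∘ uncurry K) q v = 0 := by
    rw [h3]
    change (mfderiv (𝓡∂ 2) 𝓘(ℝ, Plane) φ (uncurry K q))
      (mfderiv 𝓘(ℝ, ℝ × ℝ) (𝓡∂ 2) (uncurry K) q v) = 0
    rw [hv, map_zero]
  have h6 := cross_pair (fderiv ℝ (φ ∘ uncurry K) q) v (0, 1)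
  have h7 := cross_pair (fderiv ℝ (φ ∘ uncurry K) q) v (1, 0)
  rw [h5] at h6 h7
  have h8 : ∀ u, cross 0 u = 0 := fun u => by simp [cross]
  rw [h8] at h6 h7
  have e1 := (mul_eq_zero.1 h6.symm).resolve_right h4.ne'
  have e2 := (mul_eq_zero.1 h7.symm).resolve_right h4.ne'
  simp only [mul_one, mul_zero, sub_zero, zero_sub, neg_eq_zero] at e1 e2
  exact Prod.ext e1 e2

/-- The levels of the two closed subannuli of a winding band. -/
def WindingBand.levels (B : WindingBand τ V w) : Set ℝ := tsupport B.posBump ∪ tsupport B.negBump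

/-- The pairs `γ a`, `δ a` are those which must stay transverse when the first curve is wound along
the band, for all `k` and `l`. First an interval of levels is found that are regular for every `Γ i`
and are crossed inside `U`, off the curves, at a fixed angle `ϑ`. Then the bumps are placed in this
interval with a shift outside countably many null sets. One curve of each pair must occur in `Γ`,
because only those are known to be regular at the chosen levels. -/
theorem exists_windingBand [T2Space R] (o : SurfaceOrientation R) (hτ : IsCircle τ)
    (hV : IsOpen V) (hτV : trace τ ⊆ V) (hw : w.Finite) {Z : Set R} (hZ : Z.Finite)
    {ι : Type*} [Finite ι] {Γ : ι → ℝ → R} (hΓ : ∀ i, IsProperCurve (Γ i))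
    {U : Set R} (hU : IsOpen U) {z : R} (hzτ : z ∈ trace τ) (hzU : z ∈ U)
    {A : Type*} [Countable A] {γ δ : A → ℝ → R} (hγ : ∀ a, IsProperCurve (γ a))
    (hδ : ∀ a, IsProperCurve (δ a)) (hγδ : ∀ a, Transverse (γ a) (δ a))
    (hreg : ∀ a, (∃ i, γ a = Γ i) ∨ ∃ i, δ a = Γ i) :
    ∃ B : WindingBand τ V w, IsCollar o τ V B.collar ∧
      (∃ a, B.collar a B.posLevel ∈ U ∧ B.collar a B.posLevel ∉ support Γ) ∧
      (∃ a, B.collar a B.negLevel ∈ U ∧ B.collar a B.negLevel ∉ support Γ) ∧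
      Disjoint Z (strip B.collar B.levels) ∧
      ∀ (k l : ℕ) a, Transverse (B.wind k l ∘ γ a) (δ a) := by
  obtain ⟨K, hK⟩ := exists_isCollar o hτ hV hτV
  -- a point near `z` off the curves
  obtain ⟨ϑ, t₁, ht₁, hϑ⟩ : ∃ ϑ t₁, t₁ ∈ Ioo (-1 : ℝ) 1 ∧ K ϑ t₁ ∈ U \ support Γ := by
    obtain ⟨a, -, haz⟩ := hτ.exists_mem hzτ 0
    obtain ⟨J, h1, h2, -, h4⟩ := hK.exists_coords (q := (a, 0)) (by norm_num)
    have hz : uncurry K (a, 0) = z := (hK.core a).trans haz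
    rw [hz] at h1 h2 h4
    have h5 : ContinuousAt (fun y => (J y).2) z := h1.continuousAt.snd
    have h6 := h5.eventually (isOpen_Ioo.mem_nhds (show (J z).2 ∈ Ioo (-1 : ℝ) 1 by
      rw [h2]; norm_num))
    have hzi : z ∈ (𝓡∂ 2).interior R := haz ▸ hτ.interior a
    obtain ⟨y, hy, k1, k2, k3⟩ := ((frequently_notMem_support o hΓ hzi).and_eventually
      (h4.and (h6.and (hU.mem_nhds hzU)))).exists
    refine ⟨(J y).1, (J y).2, k2, ?_⟩
    have : K (J y).1 (J y).2 = y := k1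
    rw [this]
    exact ⟨k3, hy⟩
  have hsupp : IsClosed (support Γ) :=
    isClosed_iUnion_of_finite fun i => (isCompact_trace (hΓ i)).isClosed
  obtain ⟨ε, hε, hεU⟩ : ∃ ε > 0, ∀ t ∈ Icc (t₁ - ε) (t₁ + ε),
      t ∈ Ioo (-1 : ℝ) 1 ∧ K ϑ t ∈ U \ support Γ := by
    have hc : ContinuousAt (K ϑ) t₁ :=
      (contMDiffAt_slice (hK.smooth (ϑ, t₁) ht₁)).continuousAt
    obtain ⟨ε, hε, hb⟩ := Metric.nhds_basis_closedBall.eventually_iff.1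
      ((isOpen_Ioo.eventually_mem ht₁).and (hc.eventually ((hU.sdiff hsupp).mem_nhds hϑ)))
    refine ⟨ε, hε, fun t ht => hb ?_⟩
    rwa [Real.closedBall_eq_Icc]
  obtain ⟨α, β, hαβ, hsub, hlr⟩ := exists_levelRegular_family hK hΓ (α := t₁ - ε) (β := t₁ + ε)
    (by linarith) fun t ht => (hεU t ht).1
  -- levels of the points to be avoided
  let F : Set ℝ := {t | t ∈ Ioo (-1 : ℝ) 1 ∧ ∃ a, K a t ∈ w ∪ Z}
  have hF : F.Finite := by
    have : F ⊆ ⋃ x ∈ w ∪ Z, {t | t ∈ Ioo (-1 : ℝ) 1 ∧ ∃ a, K a t = x} := by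
      rintro t ⟨ht, a, ha⟩
      exact mem_iUnion₂.2 ⟨_, ha, ht, a, rfl⟩
    refine ((hw.union hZ).biUnion fun x _ => Set.Subsingleton.finite ?_).subset this
    rintro t ⟨ht, a, hx⟩ t' ⟨ht', a', hx'⟩
    exact (hK.inj a t a' t' ht ht' (hx.trans hx'.symm)).2
  obtain ⟨t₂, ht₂, ht₂F⟩ : ∃ t ∈ Ioo α β, t ∉ F := by
    have := (Ioo_infinite hαβ).sdiff hF
    obtain ⟨t, ht⟩ := this.nonempty
    exact ⟨t, ht⟩
  -- Room for two bumps of half-width `2 * η` centred at `t₂ ± 10 * η`, shifted by less than `η`.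
  obtain ⟨η, hη, hP⟩ : ∃ η > 0, ∀ t ∈ Icc (t₂ - 20 * η) (t₂ + 20 * η), t ∈ Icc α β ∧ t ∉ F := by
    obtain ⟨κ, hκ, hb⟩ := Metric.nhds_basis_closedBall.eventually_iff.1
      ((isOpen_Ioo.eventually_mem ht₂).and (hF.isClosed.isOpen_compl.eventually_mem ht₂F))
    refine ⟨κ / 20, by positivity, fun t ht => ?_⟩
    have := hb (by
      rw [Real.closedBall_eq_Icc]
      constructor <;> linarith [ht.1, ht.2] : t ∈ Metric.closedBall t₂ κ)
    exact ⟨Ioo_subset_Icc_self this.1, this.2⟩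
  set P := Icc (t₂ - 20 * η) (t₂ + 20 * η) with hPdef
  have hP1 : P ⊆ Ioo (-1) 1 := fun t ht => (hεU t (hsub (hP t ht).1)).1
  have hPr : ∀ i, LevelRegular K (Γ i) P := fun i x hx a t ht => hlr i x hx a t (hP t ht).1
  set p := t₂ - 10 * η
  set q := t₂ + 10 * η
  -- a generic shift
  obtain ⟨s, hs, hsT⟩ : ∃ s ∈ Ioo 0 η, ∀ (k l : ℕ) a,
      s ∉ (fun x : ℝ × ℝ × ℝ => x.2.2) '' Tangency K (γ a) (δ a) (profile p q η k l) P := by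
    have hnull : volume (⋃ i : ℕ × ℕ × A, (fun x : ℝ × ℝ × ℝ => x.2.2) ''
        Tangency K (γ i.2.2) (δ i.2.2) (profile p q η i.1 i.2.1) P) = 0 := by
      refine measure_iUnion_null fun i => volume_tangency hK (contDiff_profile _ _ _ _ _) hP1 ?_
      rcases hreg i.2.2 with ⟨j, hj⟩ | ⟨j, hj⟩
      · exact Or.inl (hj ▸ hPr j)
      · exact Or.inr (hj ▸ hPr j)
    by_contra hcon
    push Not at hcon
    have : Ioo 0 η ⊆ ⋃ i : ℕ × ℕ × A, (fun x : ℝ × ℝ × ℝ => x.2.2) ''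
        Tangency K (γ i.2.2) (δ i.2.2) (profile p q η i.1 i.2.1) P := by
      intro s hs
      obtain ⟨k, l, a, h⟩ := hcon s hs
      exact mem_iUnion.2 ⟨(k, l, a), h⟩
    have h0 := measure_mono_null this hnull
    rw [Real.volume_Ioo, ENNReal.ofReal_eq_zero] at h0
    linarith
  have hpI : Icc (p + s - 2 * η) (p + s + 2 * η) ⊆ P := Icc_subset_Icc (by
    simp only [p]; linarith [hs.1]) (by simp only [p]; linarith [hs.2])
  have hqI : Icc (q + s - 2 * η) (q + s + 2 * η) ⊆ P := Icc_subset_Icc (by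
    simp only [q]; linarith [hs.1]) (by simp only [q]; linarith [hs.2])
  obtain ⟨hb1, hs1⟩ := isBump_plateau (a := p + s) (f := fun t => plateau ((t - s - p) / η)) hη
    (hpI.trans hP1) fun t => by congr 2; ring
  obtain ⟨hb2, hs2⟩ := isBump_plateau (a := q + s) (f := fun t => plateau ((t - s - q) / η)) hη
    (hqI.trans hP1) fun t => by congr 2; ring
  have hav : ∀ t ∈ P, ∀ a, K a t ∉ w ∪ Z := fun t ht a h => (hP t ht).2 ⟨hP1 ht, a, h⟩
  let B : WindingBand τ V w :=
    { collar := K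
      smooth := fun x hx => (hK.smooth x hx.2).contMDiffWithinAt
      periodic := fun a t _ => hK.periodic a t
      injOn := by
        rintro ⟨a, t⟩ ⟨ha, ht⟩ ⟨a', t'⟩ ⟨ha', ht'⟩ h
        obtain ⟨⟨n, hn⟩, h2⟩ := hK.inj a t a' t' ht ht' h
        have h3 : (n : ℝ) < 1 := by rw [← hn]; linarith [ha.2, ha'.1]
        have h4 : (-1 : ℝ) < n := by rw [← hn]; linarith [ha.1, ha'.2]
        have h5 : n < 1 := by exact_mod_cast h3
        have h6 : -1 < n := by exact_mod_cast h4
        rw [show n = 0 by omega, Int.cast_zero] at hn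
        rw [sub_eq_zero.1 hn, h2]
      immersed := fun x hx => hK.injective_mfderiv hx
      core := hK.core
      interior := hK.interior
      subset := hK.subset
      posLevel := p + s
      negLevel := q + s
      -- Both bumps are shifted by the same `s`, so the amplitude of the winding is a translate of
      -- `profile`.
      posBump := fun t => plateau ((t - s - p) / η)
      negBump := fun t => plateau ((t - s - q) / η)
      posBump_isBump := hb1
      negBump_isBump := hb2
      disjoint := by
        refine Disjoint.mono hs1 hs2 (disjoint_left.2 fun t h1 h2 => ?_)
        have e1 := h1.2
        have e2 := h2.1
        simp only [p, q] at e1 e2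
        linarith
      pos_avoids := fun a t ht h => hav t (hpI (hs1 ht)) a (Or.inl h)
      neg_avoids := fun a t ht h => hav t (hqI (hs2 ht)) a (Or.inl h) }
  have hpP : p + s ∈ P := hpI ⟨by linarith, by linarith⟩
  have hqP : q + s ∈ P := hqI ⟨by linarith, by linarith⟩
  refine ⟨B, hK, ⟨ϑ, (hεU _ (hsub (hP _ hpP).1)).2⟩, ⟨ϑ, (hεU _ (hsub (hP _ hqP).1)).2⟩, ?_, ?_⟩
  · rw [disjoint_left]
    rintro _ hx ⟨a, t, ht, rfl⟩
    have htP : t ∈ P := by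
      rcases ht with ht | ht
      · exact hpI (hs1 ht)
      · exact hqI (hs2 ht)
    exact hav t htP a (Or.inr hx)
  · intro k l a
    have hρ0 : ∀ t ∉ P, profile p q η k l (t - s) = 0 := by
      intro t ht
      have e1 : plateau ((t - s - p) / η) = 0 := by
        by_contra h
        exact ht (hpI (hs1 (subset_tsupport _ h)))
      have e2 : plateau ((t - s - q) / η) = 0 := by
        by_contra h
        exact ht (hqI (hs2 (subset_tsupport _ h)))
      rw [profile, e1, e2]; simp
    have hts : tsupport (fun t => profile p q η k l (t - s)) ⊆ P :=
      closure_minimal (fun t ht => by by_contra h; exact ht (hρ0 t h)) isClosed_Icc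
    have hder : ∀ t, deriv (fun t => profile p q η k l (t - s)) t =
        deriv (profile p q η k l) (t - s) := fun t => deriv_comp_sub_const _ _ _
    refine transverse_rotate hK (ρ := fun t => profile p q η k l (t - s))
      ((contDiff_profile _ _ _ _ _).comp (contDiff_id.sub contDiff_const)) (hts.trans hP1)
      (fun t ht => ?_) (hγ a) (hδ a) (hγδ a) fun x hx y hy b b' t v w' hv hw' hbb' hne => ?_
    · rw [hder] at ht
      exact exists_int_of_deriv_profile hη (by simp only [p, q]; linarith) ht
    · have htP : t ∈ P := by
        by_contra h
        apply hne
        have hev : (fun t => profile p q η k l (t - s)) =ᶠ[𝓝 t] fun _ => 0 := by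
          filter_upwards [isClosed_Icc.isOpen_compl.mem_nhds h] with t' ht'
          exact hρ0 t' ht'
        rw [hev.deriv_eq, deriv_const]
      intro h0
      rw [hder] at h0 hne
      exact hsT k l a ⟨(x, y, s), ⟨hx, hy, b, b', t, v, w', htP, hv, hw',
        ⟨0, by simp only; rw [hbb']; simp⟩, hne, h0⟩, rfl⟩

end Winding

namespace Winding

variable {R : Type*} [TopologicalSpace R] [ChartedSpace (EuclideanHalfSpace 2) R]
  [IsManifold (𝓡∂ 2) ∞ R]

/-! ### Near the boundary -/

lemma mem_interior_iff_of_mem_source {x y : R} (hy : y ∈ (extChartAt (𝓡∂ 2) x).source) :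
    y ∈ (𝓡∂ 2).interior R ↔ 0 < extChartAt (𝓡∂ 2) x y 0 := by
  have hy' : y ∈ (chartAt (EuclideanHalfSpace 2) x).source := by
    rwa [extChartAt_source] at hy
  have : y ∈ (𝓡∂ 2).interior R ↔ _ := ModelWithCorners.isInteriorPoint_iff_of_mem_atlas
    (I := 𝓡∂ 2) (n := ∞) (by simp) (chart_mem_atlas (EuclideanHalfSpace 2) x) hy'
  rw [this]
  have h2 : interior (range (𝓡∂ 2)) = {p : Plane | 0 < p 0} :=
    interior_range_modelWithCornersEuclideanHalfSpace 2
  constructor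
  · intro h
    have h3 := interior_mono (OpenPartialHomeomorph.extend_target_subset_range
      (chartAt (EuclideanHalfSpace 2) x)) h
    rw [h2] at h3
    exact h3
  · intro h
    refine (chartAt (EuclideanHalfSpace 2) x).mem_interior_extend_target
      ((chartAt (EuclideanHalfSpace 2) x).map_source hy') ?_
    rw [h2]
    exact h

lemma exists_ball_target {x : R} {N : Set R} (hN : N ∈ 𝓝 x) :
    ∃ ε > 0, ∀ p ∈ Metric.ball (extChartAt (𝓡∂ 2) x x) ε, 0 ≤ p 0 →
      p ∈ (extChartAt (𝓡∂ 2) x).target ∧ (extChartAt (𝓡∂ 2) x).symm p ∈ N := by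
  have h1 : ∀ᶠ p in 𝓝[range (𝓡∂ 2)] (extChartAt (𝓡∂ 2) x x),
      p ∈ (extChartAt (𝓡∂ 2) x).target ∧ (extChartAt (𝓡∂ 2) x).symm p ∈ N := by
    rw [← map_extChartAt_nhds (I := 𝓡∂ 2) x, eventually_map]
    filter_upwards [extChartAt_source_mem_nhds (I := 𝓡∂ 2) x, hN] with y h1 h2
    refine ⟨(extChartAt (𝓡∂ 2) x).map_source h1, ?_⟩
    rwa [(extChartAt (𝓡∂ 2) x).left_inv h1]
  rw [eventually_nhdsWithin_iff, Metric.eventually_nhds_iff_ball] at h1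
  obtain ⟨ε, hε, h⟩ := h1
  refine ⟨ε, hε, fun p hp hp0 => h p hp ?_⟩
  rw [range_modelWithCornersEuclideanHalfSpace]
  exact hp0

lemma coord_nonneg (x : R) : 0 ≤ extChartAt (𝓡∂ 2) x x 0 := by
  have : extChartAt (𝓡∂ 2) x x ∈ range (𝓡∂ 2) := mem_range_self _
  rw [range_modelWithCornersEuclideanHalfSpace] at this
  exact this

/-- In a chart the interior is the open half-plane, and its intersection with a ball is convex. -/
lemma exists_preconnected_inter_interior {x : R} {N : Set R} (hN : N ∈ 𝓝 x) :
    ∃ N' ∈ 𝓝 x, N' ⊆ N ∧ IsPreconnected (N' ∩ (𝓡∂ 2).interior R) := by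
  obtain ⟨ε, hε, h⟩ := exists_ball_target hN
  set φ := extChartAt (𝓡∂ 2) x with hφ
  have hball : Convex ℝ (Metric.ball (φ x) ε ∩ {p : Plane | 0 < p 0}) := by
    refine (convex_ball _ _).inter ?_
    exact convex_halfSpace_gt (f := fun p : Plane => p 0) ⟨fun _ _ => rfl, fun _ _ => rfl⟩ 0
  refine ⟨φ.source ∩ φ ⁻¹' Metric.ball (φ x) ε, ?_, ?_, ?_⟩
  · exact inter_mem (extChartAt_source_mem_nhds x) ((continuousAt_extChartAt x).preimage_mem_nhds
      (Metric.ball_mem_nhds _ hε))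
  · rintro y ⟨hy, hyb⟩
    have hy0 : 0 ≤ φ y 0 := by
      have : φ y ∈ range (𝓡∂ 2) := mem_range_self _
      rw [range_modelWithCornersEuclideanHalfSpace] at this
      exact this
    have := (h _ hyb hy0).2
    rwa [φ.left_inv hy] at this
  · have : φ.source ∩ φ ⁻¹' Metric.ball (φ x) ε ∩ (𝓡∂ 2).interior R =
        φ.symm '' (Metric.ball (φ x) ε ∩ {p : Plane | 0 < p 0}) := by
      ext y
      constructor
      · rintro ⟨⟨hy, hyb⟩, hyi⟩
        exact ⟨φ y, ⟨hyb, (mem_interior_iff_of_mem_source hy).1 hyi⟩, φ.left_inv hy⟩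
      · rintro ⟨p, ⟨hp, hp0⟩, rfl⟩
        have ht := (h p hp hp0.le).1
        have hs := φ.map_target ht
        refine ⟨⟨hs, ?_⟩, (mem_interior_iff_of_mem_source hs).2 ?_⟩
        · rw [mem_preimage, φ.right_inv ht]; exact hp
        · rw [φ.right_inv ht]; exact hp0
    rw [this]
    refine hball.isPreconnected.image _ fun p hp => ?_
    exact ((continuousOn_extChartAt_symm x) p (h p hp.1 (le_of_lt hp.2)).1).mono fun q hq =>
      (h q hq.1 (le_of_lt hq.2)).1

/-- A direction with `0 < u 0` points into the half-plane, so interior and boundary points need no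
distinction. -/
lemma exists_ray (x : R) {u : Plane} (hu : 0 < u 0) {N : Set R} (hN : N ∈ 𝓝 x) :
    ∃ r₀ > 0, ∀ r ∈ Ioc (0 : ℝ) r₀,
      extChartAt (𝓡∂ 2) x x + r • u ∈ (extChartAt (𝓡∂ 2) x).target ∧
      (extChartAt (𝓡∂ 2) x).symm (extChartAt (𝓡∂ 2) x x + r • u) ∈ N ∩ (𝓡∂ 2).interior R := by
  obtain ⟨ε, hε, h⟩ := exists_ball_target hN
  have h1 : Tendsto (fun r : ℝ => extChartAt (𝓡∂ 2) x x + r • u) (𝓝 0)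
      (𝓝 (extChartAt (𝓡∂ 2) x x)) := by
    have : Continuous fun r : ℝ => extChartAt (𝓡∂ 2) x x + r • u := by fun_prop
    simpa using this.tendsto 0
  obtain ⟨δ, hδ, hb⟩ := Metric.nhds_basis_closedBall.eventually_iff.1
    (h1.eventually (Metric.ball_mem_nhds _ hε))
  refine ⟨δ, hδ, fun r hr => ?_⟩
  have hp := hb (by
    rw [Metric.mem_closedBall, Real.dist_eq, sub_zero, abs_of_pos hr.1]; exact hr.2)
  have hpos : 0 < (extChartAt (𝓡∂ 2) x x + r • u) 0 := by
    simp only [PiLp.add_apply, PiLp.smul_apply, smul_eq_mul]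
    exact add_pos_of_nonneg_of_pos (coord_nonneg x) (mul_pos hr.1 hu)
  obtain ⟨h2, h3⟩ := h _ hp hpos.le
  refine ⟨h2, h3, (mem_interior_iff_of_mem_source ((extChartAt (𝓡∂ 2) x).map_target h2)).2 ?_⟩
  rw [(extChartAt (𝓡∂ 2) x).right_inv h2]
  exact hpos

lemma exists_mem_interior {x : R} {N : Set R} (hN : N ∈ 𝓝 x) :
    (N ∩ (𝓡∂ 2).interior R).Nonempty := by
  obtain ⟨r, hr, h⟩ := exists_ray x (u := !₂[1, 0]) (by simp) hN
  exact ⟨_, (h r ⟨hr, le_rfl⟩).2⟩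

/-- The interior of a connected open set is path connected. -/
theorem isPathConnected_inter_interior {U : Set R} (hU : IsOpen U) (hc : IsConnected U) :
    IsPathConnected (U ∩ (𝓡∂ 2).interior R) := by
  have : LocallyPathConnectedSpace R :=
    ChartedSpace.locallyPathConnectedSpace (EuclideanHalfSpace 2) R
  rw [← (hU.inter isOpen_int).isConnected_iff_isPathConnected]
  refine ⟨?_, ?_⟩
  · obtain ⟨x, hx⟩ := hc.1
    exact exists_mem_interior (hU.mem_nhds hx)
  rw [isPreconnected_iff_subset_of_disjoint]
  intro u v hu hv huv hd
  -- A separation of the interior part extends to `U`: a boundary point joins the side containing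
  -- the interior points near it, all on one side because they include a connected set of such
  -- points around it.
  let u' : Set R := {x | ∀ᶠ y in 𝓝 x, y ∈ (𝓡∂ 2).interior R → y ∈ u}
  let v' : Set R := {x | ∀ᶠ y in 𝓝 x, y ∈ (𝓡∂ 2).interior R → y ∈ v}
  have hopen : ∀ u : Set R, IsOpen {x | ∀ᶠ y in 𝓝 x, y ∈ (𝓡∂ 2).interior R → y ∈ u} := fun u => by
    rw [isOpen_iff_mem_nhds]
    intro x hx
    exact eventually_eventually_nhds.2 hx
  have hcov : U ⊆ u' ∪ v' := by
    intro x hx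
    obtain ⟨N, hN, hNU, hp⟩ := exists_preconnected_inter_interior (hU.mem_nhds hx)
    have hsub : N ∩ (𝓡∂ 2).interior R ⊆ U ∩ (𝓡∂ 2).interior R := inter_subset_inter_left _ hNU
    have := (isPreconnected_iff_subset_of_disjoint.1 hp) u v hu hv (hsub.trans huv) (by
      rw [← subset_empty_iff, ← hd]
      exact inter_subset_inter_left _ hsub)
    rcases this with h | h
    · left; filter_upwards [hN] with y hy hyi using h ⟨hy, hyi⟩
    · right; filter_upwards [hN] with y hy hyi using h ⟨hy, hyi⟩
  have hdis : U ∩ (u' ∩ v') = ∅ := by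
    rw [eq_empty_iff_forall_notMem]
    rintro x ⟨hx, h1, h2⟩
    obtain ⟨y, ⟨⟨k1, k2⟩, k3⟩, k4⟩ := exists_mem_interior
      (inter_mem (inter_mem (hU.mem_nhds hx) h1) h2)
    have : y ∈ U ∩ (𝓡∂ 2).interior R ∩ (u ∩ v) := ⟨⟨k1, k4⟩, k2 k4, k3 k4⟩
    rw [hd] at this
    exact this
  rcases isPreconnected_iff_subset_of_disjoint.1 hc.2 u' v' (hopen u) (hopen v) hcov hdis with h | h
  · left; exact fun x hx => (h hx.1).self_of_nhds hx.2
  · right; exact fun x hx => (h hx.1).self_of_nhds hx.2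

/-- The determinant of `φ (γ t) - φ x` with `u` vanishes when `γ t` lies on the ray. At a parameter
of `x` its derivative is nonzero, so nearby parameters miss the ray; the parameters of other points
are handled by separation, and compactness of `[0,1]` finishes. -/
lemma eventually_ray_notMem_trace [T2Space R] {γ : ℝ → R} (hγ : IsProperCurve γ) {x : R}
    {u : Plane} (hu : 0 < u 0)
    (h : ∀ s ∈ unitI, γ s = x → cross (velIn (extChartAt (𝓡∂ 2) x) γ s) u ≠ 0) :
    ∀ᶠ r in 𝓝[>] (0 : ℝ),
      (extChartAt (𝓡∂ 2) x).symm (extChartAt (𝓡∂ 2) x x + r • u) ∉ trace γ := by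
  set φ := extChartAt (𝓡∂ 2) x with hφ
  have hray : ∀ N ∈ 𝓝 x, ∀ᶠ r in 𝓝[>] (0 : ℝ), φ x + r • u ∈ φ.target ∧
      φ.symm (φ x + r • u) ∈ N := by
    intro N hN
    obtain ⟨r₀, hr₀, h⟩ := exists_ray x hu hN
    filter_upwards [Ioc_mem_nhdsGT hr₀] with r hr
    exact ⟨(h r hr).1, (h r hr).2.1⟩
  have key := isCompact_Icc (a := (0 : ℝ)) (b := 1) |>.induction_on
    (p := fun T => ∀ᶠ r in 𝓝[>] (0 : ℝ), ∀ s ∈ T, γ s ≠ φ.symm (φ x + r • u))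
    (by simp) (fun S T hST h => h.mono fun r hr s hs => hr s (hST hs))
    (fun S T hS hT => by
      filter_upwards [hS, hT] with r h1 h2 s hs
      exact hs.elim (h1 s) (h2 s))
    (fun s hs => by
      have hc : ContinuousWithinAt γ unitI s := hγ.contMDiffOn.continuousOn s hs
      by_cases hsx : γ s = x
      · set v := velIn φ γ s with hv
        have hv0 : v ≠ 0 := by
          intro h0
          apply h s hs hsx
          rw [← hv, h0]
          simp [cross]
        have hd : HasDerivWithinAt (φ ∘ γ) v unitI s := by
          -- `derivWithin` is zero where there is no derivative, so a nonzero velocity implies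
          -- differentiability, also at the boundary.
          have : DifferentiableWithinAt ℝ (φ ∘ γ) unitI s := by
            by_contra hn
            exact hv0 (derivWithin_zero_of_not_differentiableWithinAt hn)
          exact this.hasDerivWithinAt
        have hd0 : HasDerivWithinAt (fun t => φ (γ t) 0) (v 0) unitI s := by
          exact (EuclideanSpace.proj 0 : Plane →L[ℝ] ℝ).hasFDerivAt.comp_hasDerivWithinAt s hd
        have hd1 : HasDerivWithinAt (fun t => φ (γ t) 1) (v 1) unitI s := by
          exact (EuclideanSpace.proj 1 : Plane →L[ℝ] ℝ).hasFDerivAt.comp_hasDerivWithinAt s hd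
        have hcr : HasDerivWithinAt (fun t => (φ (γ t) 0 - φ x 0) * u 1 - (φ (γ t) 1 - φ x 1) * u 0)
            (cross v u) unitI s :=
          ((hd0.sub_const _).mul_const _).sub ((hd1.sub_const _).mul_const _)
        have hne := hcr.eventually_ne (c := 0) (h s hs hsx)
        refine ⟨{t | t ≠ s → (φ (γ t) 0 - φ x 0) * u 1 - (φ (γ t) 1 - φ x 1) * u 0 ≠ 0}, ?_, ?_⟩
        · rw [eventually_nhdsWithin_iff] at hne
          rw [mem_nhdsWithin_iff_eventually]
          filter_upwards [hne] with t ht htI hts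
          exact ht ⟨htI, hts⟩
        · filter_upwards [hray univ univ_mem, self_mem_nhdsWithin] with r hr (hr0 : 0 < r) t ht heq
          have e : φ (γ t) = φ x + r • u := by rw [heq, φ.right_inv hr.1]
          by_cases hts : t = s
          · rw [hts, hsx] at e
            have := congrArg (fun p : Plane => p 0) e
            simp only [PiLp.add_apply, PiLp.smul_apply, smul_eq_mul] at this
            nlinarith [mul_pos hr0 hu]
          · apply ht hts
            rw [e]
            simp only [PiLp.add_apply, PiLp.smul_apply, smul_eq_mul]
            ring
      · obtain ⟨A, B, hA, hB, hsA, hxB, hAB⟩ := t2_separation hsx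
        refine ⟨γ ⁻¹' A, hc.preimage_mem_nhdsWithin (hA.mem_nhds hsA), ?_⟩
        filter_upwards [hray B (hB.mem_nhds hxB)] with r hr t ht heq
        exact hAB.ne_of_mem ht hr.2 heq)
  filter_upwards [key] with r hr
  rintro ⟨s, hs, hsr⟩
  exact hr s hs hsr

/-- Every point can be approached from the interior, off a finite family of curves. -/
theorem exists_ray_off_support [T2Space R] {ι : Type*} [Finite ι] {Γ : ι → ℝ → R}
    (hΓ : ∀ i, IsProperCurve (Γ i)) (x : R) {N : Set R} (hN : N ∈ 𝓝 x) :
    ∃ β : ℝ → R, ContinuousOn β (Ioc 0 1) ∧ Tendsto β (𝓝[>] 0) (𝓝 x) ∧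
      ∀ r ∈ Ioc (0 : ℝ) 1, β r ∈ N ∧ β r ∈ (𝓡∂ 2).interior R ∧ β r ∉ support Γ := by
  set φ := extChartAt (𝓡∂ 2) x with hφ
  let S : ι → Set ℝ := fun i => {s | s ∈ unitI ∧ Γ i s = x}
  have hS : ∀ i, (S i).Finite := by
    intro i
    have : S i ⊆ {s | s ∈ Ico (0 : ℝ) 1 ∧ Γ i s = x} ∪ {1} := by
      rintro s ⟨hs, hsx⟩
      rcases hs.2.lt_or_eq with h | h
      · exact Or.inl ⟨⟨hs.1, h⟩, hsx⟩
      · exact Or.inr h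
    refine (Finite.union (Set.Subsingleton.finite ?_) (finite_singleton 1)).subset this
    rintro s ⟨hs, hsx⟩ t ⟨ht, htx⟩
    exact (hΓ i).injOn_Ico hs ht (hsx.trans htx.symm)
  -- Among the inward directions `(1, a)`, each passage of a curve through `x` excludes at most one
  -- slope.
  let Bad : Set ℝ := ⋃ i, ⋃ s ∈ S i, {a | cross (velIn φ (Γ i) s) !₂[1, a] = 0}
  have hBad : Bad.Finite := by
    refine finite_iUnion fun i => (hS i).biUnion fun s hs => Set.Subsingleton.finite ?_
    intro a ha b hb
    have hv : velIn φ (Γ i) s ≠ 0 := by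
      have := (hΓ i).immersed s hs.1
      rwa [hs.2] at this
    simp only [cross, mem_ofPred_eq, Matrix.cons_val_zero, Matrix.cons_val_one,
      mul_one] at ha hb
    by_contra hab
    have h0 : velIn φ (Γ i) s 0 = 0 := by
      have : velIn φ (Γ i) s 0 * (a - b) = 0 := by linarith
      exact (mul_eq_zero.1 this).resolve_right (sub_ne_zero.2 hab)
    have h1 : velIn φ (Γ i) s 1 = 0 := by rw [h0] at ha; linarith
    apply hv
    ext j
    fin_cases j
    · exact h0
    · exact h1
  obtain ⟨a, ha⟩ := hBad.infinite_compl.nonempty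
  let u : Plane := !₂[1, a]
  have hu : 0 < u 0 := by simp [u]
  have h1 : ∀ᶠ r in 𝓝[>] (0 : ℝ), φ.symm (φ x + r • u) ∉ support Γ := by
    have := Fintype.ofFinite ι
    have : ∀ᶠ r in 𝓝[>] (0 : ℝ), ∀ i, φ.symm (φ x + r • u) ∉ trace (Γ i) := by
      rw [eventually_all]
      intro i
      refine eventually_ray_notMem_trace (hΓ i) hu fun s hs hsx h0 => ha ?_
      exact mem_iUnion.2 ⟨i, mem_iUnion₂.2 ⟨s, ⟨hs, hsx⟩, h0⟩⟩
    filter_upwards [this] with r hr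
    exact notMem_support.2 hr
  obtain ⟨r₁, hr₁, h2⟩ := exists_ray x hu hN
  obtain ⟨r₂, hr₂, h3⟩ := mem_nhdsGT_iff_exists_Ioc_subset.1 h1
  have hr₂' : (0 : ℝ) < r₂ := hr₂
  set r₀ := min r₁ r₂
  have hr₀ : 0 < r₀ := lt_min hr₁ hr₂'
  have hmem : ∀ r ∈ Ioc (0 : ℝ) 1, r * r₀ ∈ Ioc 0 r₁ ∧ r * r₀ ∈ Ioc 0 r₂ := by
    intro r hr
    have h4 : 0 < r * r₀ := mul_pos hr.1 hr₀
    have h5 : r * r₀ ≤ r₀ := by nlinarith [hr.2]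
    exact ⟨⟨h4, h5.trans (min_le_left _ _)⟩, ⟨h4, h5.trans (min_le_right _ _)⟩⟩
  have hlin : Continuous fun r : ℝ => φ x + (r * r₀) • u := by fun_prop
  refine ⟨fun r => φ.symm (φ x + (r * r₀) • u), ?_, ?_, fun r hr => ?_⟩
  · exact (continuousOn_extChartAt_symm x).comp hlin.continuousOn fun r hr =>
      (h2 _ (hmem r hr).1).1
  · rw [tendsto_def]
    intro M hM
    obtain ⟨r₃, hr₃, h4⟩ := exists_ray x hu hM
    have hpos : (0 : ℝ) < r₃ / r₀ := div_pos hr₃ hr₀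
    filter_upwards [Ioc_mem_nhdsGT hpos] with r hr
    exact (h4 (r * r₀) ⟨mul_pos hr.1 hr₀, by
      have := hr.2; rwa [le_div_iff₀ hr₀] at this⟩).2.1
  · obtain ⟨k1, k2⟩ := hmem r hr
    exact ⟨(h2 _ k1).2.1, (h2 _ k1).2.2, h3 k2⟩

end Winding

namespace Winding

variable {R : Type*} [TopologicalSpace R] [ChartedSpace (EuclideanHalfSpace 2) R]
  [IsManifold (𝓡∂ 2) ∞ R] {o : SurfaceOrientation R} {τ : ℝ → R} {V w : Set R} {K : ℝ → ℝ → R}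

/-! ### Compositions of isotopic maps -/

section Composition

variable {ι : Type*} {R : Type*}

/-- The composition of the maps `W i`, for `i` in a list, the last one being applied first. -/
def compList (W : ι → R → R) (l : List ι) : R → R := (l.map W).foldr (· ∘ ·) id

/-- The composition of the maps `S i`, for `i` in a list, the first one being applied first. -/
def compListRev (S : ι → R → R) : List ι → R → R
  | [] => id
  | i :: l => compListRev S l ∘ S i

lemma compList_congr {W W' : ι → R → R} {l : List ι} (h : ∀ i ∈ l, W i = W' i) :
    compList W l = compList W' l := by
  rw [compList, compList, List.map_congr_left h]

lemma compListRev_eq_self {S : ι → R → R} {l : List ι} {x : R} (h : ∀ i ∈ l, S i x = x) :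
    compListRev S l x = x := by
  induction l with
  | nil => rfl
  | cons i l ih =>
    rw [compListRev, comp_apply, h i (by simp), ih fun j hj => h j (by simp [hj])]

end Composition

lemma isIso_compList {ι : Type*} {W S : ι → R → R} {l : List ι}
    (h : ∀ i ∈ l, IsIso o (W i) (S i)) : IsIso o (compList W l) (compListRev S l) := by
  induction l with
  | nil => exact IsIso.refl o
  | cons i l ih => exact (h i (by simp)).comp (ih fun j hj => h j (by simp [hj]))

/-- The turns of a circle valued map along the image of a path under a composition of isotopies
whose final maps fix the endpoints of the path, the starting point never being moved. -/
lemma hasTurn_compListRev {ι : Type*} {G : ι → ℝ → R → R} {Y : Set R}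
    (hG : ∀ i, Continuous fun p : ℝ × R => G i p.1 p.2) (hG0 : ∀ i x, G i 0 x = x)
    (hGY : ∀ i r, MapsTo (G i r) Y Y) {Φ : R → AddCircle (1 : ℝ)}
    (hΦ : ∀ x ∈ Y, ContinuousAt Φ x) (l : List ι) {b : ι → ℝ} :
    ∀ {A : ℝ → R} {m : ℝ}, Continuous A → (∀ t, A t ∈ Y) → HasTurn (fun s => Φ (A s)) m →
      (∀ i ∈ l, ∀ r, G i r (A 0) = A 0) → (∀ i ∈ l, G i 1 (A 1) = A 1) →
      (∀ i ∈ l, HasTurn (fun r => Φ (G i r (A 1))) (b i)) →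
      HasTurn (fun s => Φ (compListRev (fun i => G i 1) l (A s))) (m + (l.map b).sum) := by
  induction l with
  | nil => intro A m _ _ h _ _ _; simpa [compListRev] using h
  | cons i l ih =>
    intro A m hA hAY hm h0 h1 hb
    have hA' : Continuous fun s => G i 1 (A s) :=
      (hG i).comp (continuous_const.prodMk hA)
    have hf : Continuous fun p : ℝ × ℝ => Φ (G i p.2 (A p.1)) := by
      rw [continuous_iff_continuousAt]
      intro p
      have : Continuous fun p : ℝ × ℝ => G i p.2 (A p.1) :=
        (hG i).comp (continuous_snd.prodMk (hA.comp continuous_fst))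
      exact ContinuousAt.comp (g := Φ) (f := fun p : ℝ × ℝ => G i p.2 (A p.1))
        (hΦ _ (hGY _ _ (hAY _))) this.continuousAt
    obtain ⟨m', hm'⟩ := exists_hasTurn (f := fun s => Φ (G i 1 (A s)))
      (hf.comp (continuous_id.prodMk continuous_const))
    -- The square `(s, r) ↦ G i r (A s)`: its sides are the old path, the trail of the endpoint, the
    -- trail of the starting point, which is constant, and the new path. The new path has the old
    -- endpoints, so the induction continues.
    have hsq := hasTurn_square hf (m₁ := m) (m₂ := b i) (m₃ := 0) (m₄ := m')
      (by simpa only [hG0] using hm) (hb i (by simp))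
      (by simpa only [h0 i (by simp)] using hasTurn_const _) hm'
    have h1i : G i 1 (A 1) = A 1 := h1 i (by simp)
    have h0i : G i 1 (A 0) = A 0 := h0 i (by simp) 1
    have := ih hA' (fun t => hGY _ _ (hAY t)) hm'
      (fun j hj r => by rw [h0i]; exact h0 j (by simp [hj]) r)
      (fun j hj => by rw [h1i]; exact h1 j (by simp [hj]))
      (fun j hj => by rw [h1i]; exact hb j (by simp [hj]))
    have e : m + ((i :: l).map b).sum = m' + (l.map b).sum := by
      simp only [List.map_cons, List.sum_cons]; linarith
    rw [e]
    exact this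

/-! ### Winding along a band -/

namespace WindingBand

variable (B : WindingBand τ V w)

lemma levels_subset : B.levels ⊆ Ioo (-1) 1 :=
  union_subset B.posBump_isBump.tsupport_subset B.negBump_isBump.tsupport_subset

lemma isCompact_levels : IsCompact B.levels :=
  isCompact_Icc.of_isClosed_subset ((isClosed_tsupport _).union (isClosed_tsupport _))
    (B.levels_subset.trans Ioo_subset_Icc_self)

lemma posLevel_mem : B.posLevel ∈ tsupport B.posBump :=
  subset_tsupport _ (by rw [Function.mem_support, B.posBump_isBump.peak]; exact one_ne_zero)

lemma negLevel_mem : B.negLevel ∈ tsupport B.negBump :=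
  subset_tsupport _ (by rw [Function.mem_support, B.negBump_isBump.peak]; exact one_ne_zero)

lemma disjoint_strip : Disjoint w (strip B.collar B.levels) := by
  rw [Set.disjoint_left]
  rintro _ hx ⟨a, t, ht | ht, rfl⟩
  · exact B.pos_avoids a t ht hx
  · exact B.neg_avoids a t ht hx

/-- The amplitude of the rotation of a winding band. -/
noncomputable def amplitude (k l : ℕ) (t : ℝ) : ℝ := k * B.posBump t - l * B.negBump t

lemma wind_eq (k l : ℕ) : B.wind k l = rotate B.collar (B.amplitude k l) := rfl

lemma contDiff_amplitude (k l : ℕ) : ContDiff ℝ ∞ (B.amplitude k l) :=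
  (contDiff_const.mul B.posBump_isBump.smooth).sub (contDiff_const.mul B.negBump_isBump.smooth)

lemma support_amplitude (k l : ℕ) : Function.support (B.amplitude k l) ⊆ B.levels := by
  intro t ht
  by_contra h
  rw [levels, mem_union, not_or] at h
  apply ht
  rw [amplitude, image_eq_zero_of_notMem_tsupport h.1, image_eq_zero_of_notMem_tsupport h.2]
  ring

lemma tsupport_amplitude (k l : ℕ) : tsupport (B.amplitude k l) ⊆ B.levels :=
  closure_minimal (B.support_amplitude k l) B.isCompact_levels.isClosed

lemma amplitude_posLevel (k l : ℕ) : B.amplitude k l B.posLevel = k := by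
  rw [amplitude, B.posBump_isBump.peak,
    image_eq_zero_of_notMem_tsupport (Set.disjoint_left.1 B.disjoint B.posLevel_mem)]
  ring

lemma amplitude_negLevel (k l : ℕ) : B.amplitude k l B.negLevel = -l := by
  rw [amplitude, B.negBump_isBump.peak,
    image_eq_zero_of_notMem_tsupport (Set.disjoint_right.1 B.disjoint B.negLevel_mem)]
  ring

/-- The inverse of winding, as the final map of an isotopy. -/
noncomputable def unwind (k l : ℕ) (r : ℝ) : R → R :=
  rotate B.collar fun t => r * -B.amplitude k l t

lemma unwind_zero (k l : ℕ) (x : R) : B.unwind k l 0 x = x := by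
  simp only [unwind, zero_mul]
  exact IsCollar.rotate_zero x

lemma unwind_eq_self (k l : ℕ) (r : ℝ) {x : R} (hx : x ∉ strip B.collar B.levels) :
    B.unwind k l r x = x := by
  refine IsCollar.rotate_eq_self fun h => hx (strip_mono ?_ h)
  rintro t ⟨ht, -⟩
  refine B.support_amplitude k l fun h0 => ht ?_
  simp only [h0, neg_zero, mul_zero]

variable {B}
variable (hB : IsCollar o τ V B.collar)
include hB

lemma unwind_apply (k l : ℕ) (r a : ℝ) {t : ℝ} (ht : t ∈ Ioo (-1 : ℝ) 1) :
    B.unwind k l r (B.collar a t) = B.collar (a + r * -B.amplitude k l t) t :=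
  hB.rotate_apply _ a ht

lemma unwind_mem_interior (k l : ℕ) (r : ℝ) :
    MapsTo (B.unwind k l r) ((𝓡∂ 2).interior R) ((𝓡∂ 2).interior R) := by
  intro x hx
  by_cases h : x ∈ strip B.collar B.levels
  · obtain ⟨a, t, ht, rfl⟩ := h
    rw [unwind_apply hB _ _ _ _ (B.levels_subset ht)]
    exact hB.interior _ _ (B.levels_subset ht)
  · rwa [B.unwind_eq_self k l r h]

lemma continuous_unwind [T2Space R] (k l : ℕ) :
    Continuous fun p : ℝ × R => B.unwind k l p.1 p.2 := by
  have e : tsupport (fun t => -B.amplitude k l t) = tsupport (B.amplitude k l) := tsupport_neg _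
  rw [continuous_iff_continuousAt]
  rintro ⟨r, x⟩
  refine hB.continuousAt_rotate (B.contDiff_amplitude k l).neg ?_ r x
  rw [e]
  exact (B.tsupport_amplitude k l).trans B.levels_subset

lemma isIso_wind [T2Space R] (k l : ℕ) : IsIso o (B.wind k l) (B.unwind k l 1) := by
  have := hB.isIso_rotate (B.contDiff_amplitude k l)
    ((B.tsupport_amplitude k l).trans B.levels_subset)
  rw [wind_eq]
  simpa only [unwind, one_mul] using this

lemma isClosed_strip [T2Space R] : IsClosed (strip B.collar B.levels) :=
  (hB.isCompact_strip B.isCompact_levels B.levels_subset).isClosed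

/-- Parallel copies of `τ` have the turns of `τ`. -/
lemma hasTurn_parallel {Φ : R → AddCircle (1 : ℝ)}
    (hΦ : ∀ x ∈ (𝓡∂ 2).interior R, ContinuousAt Φ x) {d : ℝ} (hd : HasTurn (fun s => Φ (τ s)) d)
    {t : ℝ} (ht : t ∈ Ioo (-1 : ℝ) 1) : HasTurn (fun s => Φ (B.collar s t)) d := by
  -- Keeps the level inside the collar for all real values of the homotopy parameter.
  let clip : ℝ → ℝ := fun r => max 0 (min 1 r)
  have hclip : Continuous clip := by fun_prop
  have hlev : ∀ r, clip r * t ∈ Ioo (-1 : ℝ) 1 := by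
    intro r
    have h0 : 0 ≤ clip r := le_max_left _ _
    have h1 : clip r ≤ 1 := max_le zero_le_one (min_le_left _ _)
    constructor <;> nlinarith [ht.1, ht.2]
  have hf : Continuous fun p : ℝ × ℝ => Φ (B.collar p.2 (clip p.1 * t)) := by
    rw [continuous_iff_continuousAt]
    intro p
    have h1 : ContinuousAt (fun p : ℝ × ℝ => uncurry B.collar (p.2, clip p.1 * t)) p := by
      refine ContinuousAt.comp (g := uncurry B.collar) (hB.smooth _ (hlev p.1)).continuousAt ?_
      have : Continuous fun p : ℝ × ℝ => (p.2, clip p.1 * t) := by fun_prop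
      exact this.continuousAt
    exact ContinuousAt.comp (g := Φ) (f := fun p : ℝ × ℝ => uncurry B.collar (p.2, clip p.1 * t))
      (hΦ _ (hB.interior _ _ (hlev _))) h1
  have h := hasTurn_homotopy hf (fun r s => by simp only [hB.periodic]) (r := 0) (r' := 1)
    (m := d) (by simpa [clip, hB.core] using hd)
  simpa [clip] using h

/-- At a level of `n` whole turns, unwinding moves the point `-n` times around a parallel copy of
`τ`. -/
lemma hasTurn_unwind {Φ : R → AddCircle (1 : ℝ)}
    (hΦ : ∀ x ∈ (𝓡∂ 2).interior R, ContinuousAt Φ x) {d : ℝ} (hd : HasTurn (fun s => Φ (τ s)) d)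
    {k l : ℕ} {t : ℝ} (ht : t ∈ Ioo (-1 : ℝ) 1) {n : ℤ} (hn : B.amplitude k l t = n) (a : ℝ) :
    HasTurn (fun r => Φ (B.unwind k l r (B.collar a t))) (-n * d) := by
  have := (hasTurn_parallel hB hΦ hd ht).multiple (fun s => by simp only [hB.periodic]) a (-n)
  simp only [unwind_apply hB _ _ _ _ ht, hn]
  refine (congrArg₂ HasTurn ?_ ?_).mp this
  · funext r
    congr 2
    push_cast; ring
  · push_cast; ring

lemma unwind_one_eq_self {k l : ℕ} {t : ℝ} (ht : t ∈ Ioo (-1 : ℝ) 1) {n : ℤ}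
    (hn : B.amplitude k l t = n) (a : ℝ) :
    B.unwind k l 1 (B.collar a t) = B.collar a t := by
  rw [unwind_apply hB _ _ _ _ ht, hn, one_mul]
  simpa using hB.add_int a t (-n)

end WindingBand

end Winding

namespace Winding

variable {R : Type*} [TopologicalSpace R] [ChartedSpace (EuclideanHalfSpace 2) R]
  [IsManifold (𝓡∂ 2) ∞ R] [T2Space R] {o : SurfaceOrientation R} {w U : Set R}

/-! ### Multiplicities along paths -/

lemma IsPotential.continuousAt {γ : ℝ → R} {Φ : R → ℝ} (hΦ : IsPotential o γ Φ) {x : R}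
    (hx : x ∈ (𝓡∂ 2).interior R) (hxγ : x ∉ trace γ) : ContinuousAt Φ x := by
  obtain ⟨ψ, h, h1, h2, -, h4⟩ := hΦ x hx
  rcases h2.self_of_nhds with ⟨-, h5⟩ | ⟨s, hs, rfl, -⟩
  · refine (h1.self_of_nhds.add (continuousAt_const (y := h x))).congr ?_
    filter_upwards [h4, h5] with y h6 h7
    rw [h6, h7]
    rfl
  · exact absurd hs.mem_trace hxγ

/-- Along a path off the curve, a potential is its own lift. -/
lemma IsPotential.sub_lift_eq {γ : ℝ → R} {Φ : R → ℝ} (hΦ : IsPotential o γ Φ) {A : ℝ → R}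
    (hA : Continuous A) (hAi : ∀ t, A t ∈ (𝓡∂ 2).interior R) (hAγ : ∀ t, A t ∉ trace γ) {L : ℝ → ℝ}
    (hL : Continuous L) (hLΦ : ∀ t, (L t : AddCircle (1 : ℝ)) = Φ (A t)) (s t : ℝ) :
    Φ (A s) - L s = Φ (A t) - L t := by
  refine lift_sub_eq (L := fun t => Φ (A t)) ?_ hL (fun t => (hLΦ t).symm) s t
  exact continuous_iff_continuousAt.2 fun t =>
    ContinuousAt.comp (g := Φ) (hΦ.continuousAt (hAi t) (hAγ t)) hA.continuousAt

/-- Near a basepoint there is a point at which the domains avoiding it have multiplicity zero. -/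
lemma exists_mult_eq_zero {ι : Type*} [Finite ι] {Γ : ι → ℝ → R} (hΓ : ∀ i, IsProperCurve (Γ i))
    {x : R} (hx : x ∈ w) {N : Set R} (hN : N ∈ 𝓝 x) :
    ∃ y ∈ N, y ∈ (𝓡∂ 2).interior R ∧ y ∉ support Γ ∧ ∀ (C : Set R) (D : R → ℚ),
      IsRelativeDomain C D → Avoids C w D → (∀ z ∈ N, z ∉ support Γ → z ∉ C) → D y = 0 := by
  -- The basepoint may lie on the boundary or on a curve; a path off the curves links it to the
  -- interior point `β 1`. This point is chosen before `C` and `D`, so that it serves all wound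
  -- families at once.
  obtain ⟨β, h1, h2, h3⟩ := exists_ray_off_support hΓ x hN
  obtain ⟨k1, k2, k3⟩ := h3 1 ⟨one_pos, le_rfl⟩
  refine ⟨β 1, k1, k2, k3, fun C D hD ha hC => ?_⟩
  have hβ : ∀ r ∈ Ioc (0 : ℝ) 1, β r ∉ C := fun r hr => hC _ (h3 r hr).1 (h3 r hr).2.2
  obtain ⟨r, h4, hr⟩ := ((h2.eventually (ha x hx)).and (Ioc_mem_nhdsGT one_pos)).exists
  rw [← h4 (hβ r hr)]
  exact constant_of_locally isPreconnected_Ioc (f := fun r => D (β r))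
    (fun r hr => (h1 r hr).eventually (hD _ (hβ r hr))) ⟨one_pos, le_rfl⟩ hr

variable {n m : ℕ} {ξ : Fin n → ℝ → R} {θ : Fin m → ℝ → R} {τ : Fin n → ℝ → R} {V : Fin n → Set R}

/-- The curves `ξ j`, wound along the circles of the list `L j`, and the curves `θ j`. -/
noncomputable def woundFamily (B : ∀ i, WindingBand (τ i) (V i) w) (k l : Fin n → ℕ)
    (L : Fin n → List (Fin n)) (ξ : Fin n → ℝ → R) (θ : Fin m → ℝ → R) : Fin n ⊕ Fin m → ℝ → R :=
  Sum.elim (fun j => compList (fun i => (B i).wind (k i) (l i)) (L j) ∘ ξ j) θ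

variable {B : ∀ i, WindingBand (τ i) (V i) w} {L : Fin n → List (Fin n)}

/-- A point fixed by all unwinding maps that lies on a wound curve also lies on the original one. -/
lemma notMem_support_woundFamily (hB : ∀ i, IsCollar o (τ i) (V i) (B i).collar)
    {k l : Fin n → ℕ} {x : R} (hx : x ∉ support (Sum.elim ξ θ))
    (h : ∀ i, (B i).unwind (k i) (l i) 1 x = x) : x ∉ support (woundFamily B k l L ξ θ) := by
  rw [notMem_support] at hx ⊢
  rintro (j | j)
  · rintro ⟨s, hs, hsx⟩
    refine hx (Sum.inl j) ⟨s, hs, ?_⟩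
    have h1 := (isIso_compList (l := L j) fun i _ => (B i).isIso_wind (hB i) (k i) (l i)).left_inv (ξ j s)
    have h2 : compList (fun i => (B i).wind (k i) (l i)) (L j) (ξ j s) = x := hsx
    rw [h2, compListRev_eq_self fun i _ => h i] at h1
    exact h1.symm
  · exact hx (Sum.inr j)

/-- The multiplicity of a domain of the wound curves at a point of one of the bands. -/
lemma exists_multiplicity_formula (hU : IsOpen U) (hUc : IsConnected U)
    (hθU : ∀ j, Disjoint (trace (θ j)) U)
    (hB : ∀ i, IsCollar o (τ i) (V i) (B i).collar)
    (hL : ∀ j, (L j).Nodup) (hLj : ∀ j, j ∈ L j)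
    {Φ : Fin n ⊕ Fin m → R → ℝ} (hΦ : ∀ x, IsPotential o (Sum.elim ξ θ x) (Φ x))
    {d : Fin n → ℝ} (hd : ∀ i, HasTurn (fun s => (Φ (Sum.inl i) (τ i s) : AddCircle (1 : ℝ))) (d i))
    (hd0 : ∀ i j, i ∈ L j → i ≠ j →
      HasTurn (fun s => (Φ (Sum.inl j) (τ i s) : AddCircle (1 : ℝ))) 0)
    {y : R} (hyU : y ∈ U) (hyi : y ∈ (𝓡∂ 2).interior R) (hyΓ : y ∉ support (Sum.elim ξ θ))
    (hys : ∀ i, y ∉ strip (B i).collar (B i).levels) (i : Fin n) {a t : ℝ}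
    (ht : t ∈ Ioo (-1 : ℝ) 1) (hqU : (B i).collar a t ∈ U)
    (hqΓ : (B i).collar a t ∉ support (Sum.elim ξ θ))
    (hqs : ∀ j, j ≠ i → (B i).collar a t ∉ strip (B j).collar (B j).levels) :
    ∃ C : Fin n → ℝ, ∀ (k l : Fin n → ℕ) (N : ℤ), (B i).amplitude (k i) (l i) t = N →
      (B i).collar a t ∉ support (woundFamily B k l L ξ θ) ∧
      (IsCurveSystem (woundFamily B k l L ξ θ) → ∀ (D : R → ℚ) (c : Fin n ⊕ Fin m → ℚ),
        IsRelativeDomain (support (woundFamily B k l L ξ θ)) D →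
        HasBoundary o (woundFamily B k l L ξ θ) D c → D y = 0 →
        (D ((B i).collar a t) : ℝ) =
          ∑ j, (c (Sum.inl j) : ℝ) * C j + N * (d i * c (Sum.inl i))) := by
  set q := (B i).collar a t with hq
  have hqi : q ∈ (𝓡∂ 2).interior R := (hB i).interior a t ht
  obtain ⟨P, hP⟩ := (isPathConnected_inter_interior hU hUc).joinedIn y ⟨hyU, hyi⟩ q ⟨hqU, hqi⟩
  set A : ℝ → R := ⇑P.extend with hA
  have hAc : Continuous A := P.continuous_extend
  have hA0 : A 0 = y := P.extend_zero
  have hA1 : A 1 = q := P.extend_one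
  have hAU : ∀ s, A s ∈ U ∩ (𝓡∂ 2).interior R := by
    intro s
    have : A s ∈ range P := P.extend_range ▸ mem_range_self s
    obtain ⟨r, hr⟩ := this
    rw [← hr]
    exact hP r
  have hAi := fun s => (hAU s).2
  choose base hbase using fun j => exists_hasTurn ((hΦ (Sum.inl j)).continuous_coe_comp hAc hAi)
  -- The jump of the potential of the unwound curve `ξ j` along the path; winding enters only
  -- through `N`.
  refine ⟨fun j => Φ (Sum.inl j) q - Φ (Sum.inl j) y - base j, fun k l N hN => ?_⟩
  have hSy : ∀ j r, (B j).unwind (k j) (l j) r y = y := fun j r => (B j).unwind_eq_self _ _ r (hys j)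
  have hSq : ∀ j, (B j).unwind (k j) (l j) 1 q = q := by
    intro j
    by_cases hj : j = i
    · subst hj; exact WindingBand.unwind_one_eq_self (hB j) ht hN a
    · exact (B j).unwind_eq_self _ _ _ (hqs j hj)
  have hqΓ' := notMem_support_woundFamily (L := L) hB hqΓ hSq
  refine ⟨hqΓ', fun hΓ' D c hD hb hDy => ?_⟩
  have hyΓ' := notMem_support_woundFamily (L := L) hB hyΓ fun j => hSy j 1
  have hiso := fun j => isIso_compList (l := L j) fun i _ =>
    (B i).isIso_wind (hB i) (k i) (l i)
  set S : Fin n → R → R := fun j => compListRev (fun i => (B i).unwind (k i) (l i) 1) (L j) with hS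
  -- Only band `i` can move `q`, and it drags `q` around `-N` times. For `j = i` this counts once,
  -- as `i` occurs exactly once in `L i`; for `j ≠ i` the turns vanish by `hd0`.
  have hturn : ∀ j, HasTurn (fun s => (Φ (Sum.inl j) (S j (A s)) : AddCircle (1 : ℝ)))
      (base j - if j = i then N * d i else 0) := by
    intro j
    have hcont : ∀ x ∈ (𝓡∂ 2).interior R,
        ContinuousAt (fun x => (Φ (Sum.inl j) x : AddCircle (1 : ℝ))) x :=
      fun x hx => (hΦ (Sum.inl j)).continuousAt_coe hx
    have hb : ∀ p ∈ L j, HasTurn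
        (fun r => (Φ (Sum.inl j) ((B p).unwind (k p) (l p) r (A 1)) : AddCircle (1 : ℝ)))
        (if p = i then (if j = i then -N * d i else 0) else 0) := by
      intro p hp
      rw [hA1]
      by_cases hpi : p = i
      · subst hpi
        rw [if_pos rfl]
        by_cases hjp : j = p
        · subst hjp
          rw [if_pos rfl]
          exact WindingBand.hasTurn_unwind (hB j) hcont (hd j) ht hN a
        · rw [if_neg hjp]
          simpa using WindingBand.hasTurn_unwind (hB p) hcont (hd0 p j hp (Ne.symm hjp)) ht hN a
      · rw [if_neg hpi]
        simp only [(B p).unwind_eq_self _ _ _ (hqs p hpi)]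
        exact hasTurn_const _
    have := hasTurn_compListRev (G := fun p r => (B p).unwind (k p) (l p) r)
      (Y := (𝓡∂ 2).interior R) (fun p => WindingBand.continuous_unwind (hB p) _ _)
      (fun p x => (B p).unwind_zero _ _ x) (fun p r => WindingBand.unwind_mem_interior (hB p) _ _ r)
      hcont (L j) hAc hAi (hbase j) (fun p _ r => by rw [hA0]; exact hSy p r)
      (fun p _ => by rw [hA1]; exact hSq p) hb
    convert this using 1
    by_cases hji : j = i
    · subst hji
      rw [List.sum_map_ite_eq, List.count_eq_one_of_mem (hL j) (hLj j)]
      simp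
      ring
    · simp [hji]
  have hturnθ : ∀ j, ∃ m, HasTurn (fun s => (Φ (Sum.inr j) (A s) : AddCircle (1 : ℝ))) m :=
    fun j => exists_hasTurn ((hΦ (Sum.inr j)).continuous_coe_comp hAc hAi)
  choose Λ hΛc hΛ hΛ1 using hturn
  choose mθ Λθ hΛθc hΛθ _ using hturnθ
  have hpot : ∀ x, IsPotential o (woundFamily B k l L ξ θ x)
      (Sum.elim (fun j => Φ (Sum.inl j) ∘ S j) (fun j => Φ (Sum.inr j)) x) := by
    rintro (j | j)
    · exact (hΦ (Sum.inl j)).transport (hiso j).left_inv (hiso j).right_inv (hiso j).preserves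
        (hiso j).preserves_inv (hΓ'.proper (Sum.inl j))
    · exact hΦ (Sum.inr j)
  have key := domain_sub_eq hΓ' hD hb hpot hAc hAi (L := Sum.elim Λ Λθ)
    (by rintro (j | j) <;> simp [hΛc, hΛθc])
    (by rintro (j | j) s <;> simp [hΛ, hΛθ]) (by rw [hA0]; exact hyΓ') (by rw [hA1]; exact hqΓ')
  -- The path stays in `U` and never meets these curves, so they contribute no jump.
  have hθ0 : ∀ j, (Φ (Sum.inr j) (A 1) - Λθ j 1) - (Φ (Sum.inr j) (A 0) - Λθ j 0) = 0 := by
    intro j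
    rw [sub_eq_zero]
    refine (hΦ (Sum.inr j)).sub_lift_eq hAc hAi (fun s hs => ?_) (hΛθc j) (hΛθ j) 1 0
    exact Set.disjoint_left.1 (hθU j) hs (hAU s).1
  have hSA1 : ∀ j, S j (A 1) = q := fun j => by
    rw [hA1]; exact compListRev_eq_self fun p _ => hSq p
  have hSA0 : ∀ j, S j (A 0) = y := fun j => by
    rw [hA0]; exact compListRev_eq_self fun p _ => hSy p 1
  rw [Fintype.sum_sum_type] at key
  simp only [Sum.elim_inl, Sum.elim_inr, comp_apply, hθ0, mul_zero, Finset.sum_const_zero, add_zero,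
    hSA1, hSA0] at key
  rw [hA0, hA1, hDy, Rat.cast_zero, sub_zero] at key
  rw [key]
  have : ∀ j, (c (Sum.inl j) : ℝ) * (Φ (Sum.inl j) q - Λ j 1 - (Φ (Sum.inl j) y - Λ j 0)) =
      c (Sum.inl j) * (Φ (Sum.inl j) q - Φ (Sum.inl j) y - base j) +
        if j = i then N * (d i * c (Sum.inl i)) else 0 := by
    intro j
    have h := hΛ1 j
    by_cases hji : j = i
    · subst hji
      simp only [if_true] at h ⊢
      linear_combination -(c (Sum.inl j) : ℝ) * h
    · simp only [if_neg hji] at h ⊢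
      linear_combination -(c (Sum.inl j) : ℝ) * h
  rw [Finset.sum_congr rfl fun j _ => this j, Finset.sum_add_distrib, Finset.sum_ite_eq' Finset.univ]
  simp

/-- The error `|∑ c j * C j|` is at most `|c i| * ∑ |C j|`, which is less than `N * |c i|`. The
condition on `N` does not involve `c`. -/
lemma mul_pos_of_dominant {ι : Type*} [Fintype ι] {c C : ι → ℝ} {i : ι} (hi : ∀ j, |c j| ≤ |c i|)
    (hi0 : c i ≠ 0) {N d : ℝ} (hd : |d| = 1) (hN : ∑ j, |C j| < N) :
    0 < (∑ j, c j * C j + N * (d * c i)) * (d * c i) := by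
  have h1 : |∑ j, c j * C j| ≤ |c i| * ∑ j, |C j| := by
    refine (Finset.abs_sum_le_sum_abs _ _).trans ?_
    rw [Finset.mul_sum]
    refine Finset.sum_le_sum fun j _ => ?_
    rw [abs_mul]
    exact mul_le_mul_of_nonneg_right (hi j) (abs_nonneg _)
  have h2 : 0 < |c i| := abs_pos.2 hi0
  have h3 : |d * c i| = |c i| := by rw [abs_mul, hd, one_mul]
  have h4 : (d * c i) * (d * c i) = |c i| * |c i| := by
    rw [← h3, abs_mul_abs_self]
  have h5 : -((|c i| * ∑ j, |C j|) * |c i|) ≤ (∑ j, c j * C j) * (d * c i) := by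
    refine le_trans (neg_le_neg ?_) (neg_abs_le _)
    rw [abs_mul, h3]
    exact mul_le_mul_of_nonneg_right h1 h2.le
  have h6 : 0 < (|c i| * |c i|) * (N - ∑ j, |C j|) := mul_pos (mul_pos h2 h2) (sub_pos.2 hN)
  rw [add_mul, mul_assoc N, h4]
  linarith

/-- Sufficiently wound curves bound no nonnegative domains. -/
theorem exists_bound_hasBothSigns [CompactSpace R] (hw : w.Nonempty) (hU : IsOpen U)
    (hUc : IsConnected U) (hwU : w ⊆ U) (hΓ : ∀ x, IsProperCurve (Sum.elim ξ θ x))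
    (hθU : ∀ j, Disjoint (trace (θ j)) U) (hτ : ∀ i, IsCircle (τ i))
    (hτξ : ∀ i, MeetOnce (τ i) (ξ i)) (hB : ∀ i, IsCollar o (τ i) (V i) (B i).collar)
    (hL : ∀ j, (L j).Nodup) (hLj : ∀ j, j ∈ L j)
    (hint : ∀ i j, i ∈ L j → i ≠ j → HasIntersectionNumber o (τ i) (ξ j) 0)
    {a a' : Fin n → ℝ} (hqU : ∀ i, (B i).collar (a i) (B i).posLevel ∈ U)
    (hqΓ : ∀ i, (B i).collar (a i) (B i).posLevel ∉ support (Sum.elim ξ θ))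
    (hqs : ∀ i j, j ≠ i → (B i).collar (a i) (B i).posLevel ∉ strip (B j).collar (B j).levels)
    (hqU' : ∀ i, (B i).collar (a' i) (B i).negLevel ∈ U)
    (hqΓ' : ∀ i, (B i).collar (a' i) (B i).negLevel ∉ support (Sum.elim ξ θ))
    (hqs' : ∀ i j, j ≠ i → (B i).collar (a' i) (B i).negLevel ∉ strip (B j).collar (B j).levels) :
    ∃ N : ℕ, ∀ k l : Fin n → ℕ, (∀ i, N ≤ k i ∧ N ≤ l i) →
      IsCurveSystem (woundFamily B k l L ξ θ) → ∀ (D : R → ℚ) (c : Fin n ⊕ Fin m → ℚ),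
        IsRelativePeriodicDomain o w (woundFamily B k l L ξ θ) D c → (∃ i, c (Sum.inl i) ≠ 0) →
          HasBothSigns (support (woundFamily B k l L ξ θ)) D ∧
          ¬ IsNonnegative (support (woundFamily B k l L ξ θ)) D := by
  choose Φ hΦ using fun x => exists_isPotential o (hΓ x)
  choose d hd1 hd using fun i => hasTurn_of_meetOnce (hτ i) (hΓ (Sum.inl i)) (hτξ i)
    (hΦ (Sum.inl i))
  have hd0 : ∀ i j, i ∈ L j → i ≠ j →
      HasTurn (fun s => (Φ (Sum.inl j) (τ i s) : AddCircle (1 : ℝ))) 0 := fun i j hij hne => by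
    simpa using hasTurn_of_hasIntersectionNumber (hΓ (Sum.inl j)) (hint i j hij hne)
      (hΦ (Sum.inl j))
  -- a point near a basepoint
  obtain ⟨x₀, hx₀⟩ := hw
  have hN : U ∩ ⋂ i, (strip (B i).collar (B i).levels)ᶜ ∈ 𝓝 x₀ := by
    refine inter_mem (hU.mem_nhds (hwU hx₀)) ?_
    rw [Filter.iInter_mem]
    exact fun i => ((B i).isClosed_strip (hB i)).isOpen_compl.mem_nhds
      (Set.disjoint_left.1 (B i).disjoint_strip hx₀)
  obtain ⟨y, ⟨hyU, hys⟩, hyi, hyΓ, hy0⟩ := exists_mult_eq_zero hΓ hx₀ hN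
  rw [mem_iInter] at hys
  have hlev := fun i => (B i).levels_subset (Or.inl (B i).posLevel_mem)
  have hlev' := fun i => (B i).levels_subset (Or.inr (B i).negLevel_mem)
  choose C hC using fun i => exists_multiplicity_formula hU hUc hθU hB hL hLj hΦ hd hd0 hyU hyi hyΓ
    hys i (hlev i) (hqU i) (hqΓ i) (hqs i)
  choose C' hC' using fun i => exists_multiplicity_formula hU hUc hθU hB hL hLj hΦ hd hd0 hyU hyi
    hyΓ hys i (hlev' i) (hqU' i) (hqΓ' i) (hqs' i)
  -- Which index has the largest coefficient depends on the domain, so the bound must cover all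
  -- bands and both peaks.
  obtain ⟨N, hN⟩ := exists_nat_gt (∑ i, (∑ j, |C i j| + ∑ j, |C' i j|))
  refine ⟨N, fun k l hkl hΓ' D c hD hc => ?_⟩
  have hDy : D y = 0 := by
    refine hy0 _ D hD.domain hD.avoids fun z hz hzΓ => notMem_support_woundFamily hB hzΓ fun i => ?_
    exact (B i).unwind_eq_self _ _ _ (mem_iInter.1 hz.2 i)
  obtain ⟨i, -, hi⟩ := Finset.exists_max_image Finset.univ (fun i => |(c (Sum.inl i) : ℝ)|)
    ⟨hc.choose, Finset.mem_univ _⟩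
  have hi0 : (c (Sum.inl i) : ℝ) ≠ 0 := by
    obtain ⟨j, hj⟩ := hc
    have h1 : 0 < |(c (Sum.inl j) : ℝ)| := abs_pos.2 (by exact_mod_cast hj)
    exact abs_pos.1 (h1.trans_le (hi j (Finset.mem_univ _)))
  have hsum : ∑ j, |C i j| + ∑ j, |C' i j| < N := by
    refine lt_of_le_of_lt ?_ hN
    exact Finset.single_le_sum (f := fun i => ∑ j, |C i j| + ∑ j, |C' i j|)
      (fun i _ => add_nonneg (Finset.sum_nonneg fun _ _ => abs_nonneg _)
        (Finset.sum_nonneg fun _ _ => abs_nonneg _)) (Finset.mem_univ i)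
  have hs1 : 0 ≤ ∑ j, |C i j| := Finset.sum_nonneg fun _ _ => abs_nonneg _
  have hs2 : 0 ≤ ∑ j, |C' i j| := Finset.sum_nonneg fun _ _ => abs_nonneg _
  have hki : (N : ℝ) ≤ k i := by exact_mod_cast (hkl i).1
  have hli : (N : ℝ) ≤ l i := by exact_mod_cast (hkl i).2
  obtain ⟨p1, p2⟩ := hC i k l (k i) (by rw [(B i).amplitude_posLevel]; simp)
  obtain ⟨p1', p2'⟩ := hC' i k l (-l i) (by rw [(B i).amplitude_negLevel]; simp)
  have e1 := p2 hΓ' D c hD.domain hD.boundary hDy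
  have e2 := p2' hΓ' D c hD.domain hD.boundary hDy
  have m1 := mul_pos_of_dominant (c := fun j => (c (Sum.inl j) : ℝ)) (C := C i)
    (fun j => hi j (Finset.mem_univ _)) hi0 (hd1 i) (N := k i) (by linarith)
  -- At the other peak the rotation is by `-l i` turns; the sign is moved to `d i`.
  have m2 := mul_pos_of_dominant (c := fun j => (c (Sum.inl j) : ℝ)) (C := C' i)
    (fun j => hi j (Finset.mem_univ _)) hi0 (d := -d i) (by rw [abs_neg, hd1 i]) (N := l i)
    (by linarith)
  rw [Int.cast_natCast] at e1
  rw [Int.cast_neg, Int.cast_natCast] at e2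
  rw [← e1] at m1
  have m2 : 0 < (D ((B i).collar (a' i) (B i).negLevel) : ℝ) * -(d i * c (Sum.inl i)) := by
    rw [e2]
    refine m2.trans_eq ?_
    ring
  set q := (B i).collar (a i) (B i).posLevel
  set q' := (B i).collar (a' i) (B i).negLevel
  have both : HasBothSigns (support (woundFamily B k l L ξ θ)) D := by
    rcases lt_trichotomy (d i * (c (Sum.inl i) : ℝ)) 0 with h | h | h
    · refine ⟨⟨q', p1', ?_⟩, ⟨q, p1, ?_⟩⟩
      · have : (0 : ℝ) < D q' := by nlinarith
        exact_mod_cast this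
      · have : (D q : ℝ) < 0 := by nlinarith
        exact_mod_cast this
    · rw [h, mul_zero] at m1
      exact absurd m1 (lt_irrefl _)
    · refine ⟨⟨q, p1, ?_⟩, ⟨q', p1', ?_⟩⟩
      · have : (0 : ℝ) < D q := by nlinarith
        exact_mod_cast this
      · have : (D q' : ℝ) < 0 := by nlinarith
        exact_mod_cast this
  refine ⟨both, fun hn => ?_⟩
  obtain ⟨x, hx, hx0⟩ := both.2
  exact absurd (hn x hx) (not_le.2 hx0)

end Winding

/-! ### Simultaneous choice of the bands. -/

namespace Winding

/-- Choices over `Fin n`, from the last index to the first, each depending on the previous ones. -/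
lemma exists_forall_of_descending {n : ℕ} {β : Fin n → Type*} [∀ i, Nonempty (β i)]
    {P : ∀ i, (∀ j, β j) → β i → Prop}
    (hP : ∀ i B B' b, (∀ j, i < j → B j = B' j) → P i B b → P i B' b)
    (hex : ∀ i B, (∀ j, i < j → P j B (B j)) → ∃ b, P i B b) : ∃ B, ∀ i, P i B (B i) := by
  -- After `m` rounds the last `m` choices are settled. A change at an earlier index does not
  -- disturb them, since `P i` depends only on choices after `i`.
  have key : ∀ m : ℕ, ∃ B : ∀ j, β j, ∀ i : Fin n, n ≤ i + m → P i B (B i) := by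
    intro m
    induction m with
    | zero => exact ⟨fun i => Classical.arbitrary _, fun i hi => absurd i.2 (by omega)⟩
    | succ m ih =>
      obtain ⟨B, hB⟩ := ih
      by_cases hm : m < n
      · let i₀ : Fin n := ⟨n - 1 - m, by omega⟩
        have hi₀ : (i₀ : ℕ) = n - 1 - m := rfl
        obtain ⟨b, hb⟩ := hex i₀ B fun j hj => hB j (by
          have : (i₀ : ℕ) < j := hj
          omega)
        have hup : ∀ j, i₀ < j → B j = update B i₀ b j := fun j hj => by
          rw [update_of_ne hj.ne']
        refine ⟨update B i₀ b, fun i hi => ?_⟩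
        by_cases hii : i = i₀
        · subst hii
          rw [update_self]
          exact hP _ _ _ _ hup hb
        · have hlt : i₀ < i := by
            have : (i : ℕ) ≠ i₀ := fun h => hii (Fin.ext h)
            change (i₀ : ℕ) < i
            omega
          rw [← hup i hlt]
          exact hP _ _ _ _ (fun j hj => hup j (hlt.trans hj)) (hB i (by
            have : (i₀ : ℕ) < i := hlt
            omega))
      · exact ⟨B, fun i _ => hB i (by omega)⟩
  obtain ⟨B, hB⟩ := key n
  exact ⟨B, fun i => hB i (by omega)⟩

variable {R : Type*} [TopologicalSpace R] [ChartedSpace (EuclideanHalfSpace 2) R]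
  [IsManifold (𝓡∂ 2) ∞ R] [T2Space R] {w U : Set R}

lemma Transverse.symm {γ δ : ℝ → R} (h : Transverse γ δ) : Transverse δ γ := by
  intro s hs t ht hst
  have := h t ht s hs hst.symm
  rw [← hst] at this
  intro h0
  apply this
  unfold cross at h0 ⊢
  linarith

variable {n m : ℕ} {τ : Fin n → ℝ → R} {V : Fin n → Set R}

/-- The composition of the windings along a list of bands. -/
noncomputable def windList (B : ∀ i, WindingBand (τ i) (V i) w) (k l : Fin n → ℕ)
    (L : List (Fin n)) : R → R :=
  compList (fun i => (B i).wind (k i) (l i)) L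

/-- Bands along several circles, in general position with respect to each other and to a family
of curves: any of the curves can be wound along any of the bands without losing transversality to
another one, as long as only one of the two has been wound along some of the later bands. -/
theorem exists_windingBands (o : SurfaceOrientation R) (hw : w.Finite) (hτ : ∀ i, IsCircle (τ i))
    (hV : ∀ i, IsOpen (V i)) (hτV : ∀ i, trace (τ i) ⊆ V i) {X : Type*} [Finite X]
    {Γ : X → ℝ → R} (hΓ : ∀ x, IsProperCurve (Γ x)) (hU : IsOpen U)
    (hτU : ∀ i, (trace (τ i) ∩ U).Nonempty) :
    ∃ (B : ∀ i, WindingBand (τ i) (V i) w) (a a' : Fin n → ℝ),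
      (∀ i, IsCollar o (τ i) (V i) (B i).collar) ∧
      (∀ i, (B i).collar (a i) (B i).posLevel ∈ U) ∧
      (∀ i, (B i).collar (a i) (B i).posLevel ∉ support Γ) ∧
      (∀ i j, j ≠ i → (B i).collar (a i) (B i).posLevel ∉ strip (B j).collar (B j).levels) ∧
      (∀ i, (B i).collar (a' i) (B i).negLevel ∈ U) ∧
      (∀ i, (B i).collar (a' i) (B i).negLevel ∉ support Γ) ∧
      (∀ i j, j ≠ i → (B i).collar (a' i) (B i).negLevel ∉ strip (B j).collar (B j).levels) ∧
      ∀ i k l (L L' : List (Fin n)) x y, (∀ j ∈ L, i < j) → (∀ j ∈ L', i < j) →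
        (L = [] ∨ L' = []) → Transverse (windList B k l L ∘ Γ x) (windList B k l L' ∘ Γ y) →
        Transverse (windList B k l (i :: L) ∘ Γ x) (windList B k l L' ∘ Γ y) := by
  choose z hzτ hzU using hτU
  -- A band together with the angles of its two marked points.
  let β : Fin n → Type _ := fun i => WindingBand (τ i) (V i) w × ℝ × ℝ
  let q : ∀ i, β i → R := fun i b => b.1.collar b.2.1 b.1.posLevel
  let q' : ∀ i, β i → R := fun i b => b.1.collar b.2.2 b.1.negLevel
  let st : ∀ i, β i → Set R := fun i b => strip b.1.collar b.1.levels
  let W : (∀ j, β j) → (Fin n → ℕ) → (Fin n → ℕ) → List (Fin n) → R → R := fun B k l L =>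
    windList (fun j => (B j).1) k l L
  -- Besides general position, every band avoids all points `z j`. So when the turn of band `i`
  -- comes, `z i` still has a neighbourhood in `U` off the later bands, where the marked points can
  -- be placed. Band `i` also avoids the marked points of the later bands.
  let P : ∀ i, (∀ j, β j) → β i → Prop := fun i B b =>
    IsCollar o (τ i) (V i) b.1.collar ∧
    (q i b ∈ U ∧ q i b ∉ support Γ ∧ ∀ j, i < j → q i b ∉ st j (B j)) ∧
    (q' i b ∈ U ∧ q' i b ∉ support Γ ∧ ∀ j, i < j → q' i b ∉ st j (B j)) ∧
    (∀ j, z j ∉ st i b) ∧ (∀ j, i < j → q j (B j) ∉ st i b ∧ q' j (B j) ∉ st i b) ∧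
    ∀ k l (L L' : List (Fin n)) x y, (∀ j ∈ L, i < j) → (∀ j ∈ L', i < j) →
      (L = [] ∨ L' = []) → Transverse (W B k l L ∘ Γ x) (W B k l L' ∘ Γ y) →
      Transverse (b.1.wind (k i) (l i) ∘ W B k l L ∘ Γ x) (W B k l L' ∘ Γ y)
  have hPcongr : ∀ i B B' b, (∀ j, i < j → B j = B' j) → P i B b → P i B' b := by
    rintro i B B' b h ⟨h1, ⟨h2, h3, h4⟩, ⟨h5, h6, h7⟩, h8, h9, h10⟩
    refine ⟨h1, ⟨h2, h3, fun j hj => ?_⟩, ⟨h5, h6, fun j hj => ?_⟩, h8, fun j hj => ?_,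
      fun k l L L' x y hL hL' => ?_⟩
    · rw [← h j hj]; exact h4 j hj
    · rw [← h j hj]; exact h7 j hj
    · rw [← h j hj]; exact h9 j hj
    · have hW : ∀ L : List (Fin n), (∀ j ∈ L, i < j) → W B k l L = W B' k l L := fun L hL =>
        compList_congr fun j hj => by beta_reduce; rw [h j (hL j hj)]
      rw [← hW L hL, ← hW L' hL']
      exact h10 k l L L' x y hL hL'
  have hne : ∀ i, Nonempty (β i) := by
    intro i
    obtain ⟨b, -⟩ := exists_windingBand o (hτ i) (hV i) (hτV i) hw finite_empty hΓ hU (hzτ i)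
      (hzU i) (A := Empty) (γ := Empty.elim) (δ := Empty.elim) (by simp) (by simp) (by simp)
      (by simp)
    exact ⟨b, 0, 0⟩
  obtain ⟨B, hB⟩ := exists_forall_of_descending hPcongr (fun i B hprev => by
    let W' := fun (kl : (Fin n → ℕ) × (Fin n → ℕ)) (L : List (Fin n)) => W B kl.1 kl.2 L
    -- All pairs of curves wound along later bands which band `i` must keep transverse. There are
    -- only countably many, and one curve of each pair is unwound, as `exists_windingBand` requires.
    let A := {p : ((Fin n → ℕ) × (Fin n → ℕ)) × (List (Fin n) × List (Fin n)) × X × X //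
      (∀ j ∈ p.2.1.1, i < j) ∧ (∀ j ∈ p.2.1.2, i < j) ∧ (p.2.1.1 = [] ∨ p.2.1.2 = []) ∧
        Transverse (W' p.1 p.2.1.1 ∘ Γ p.2.2.1) (W' p.1 p.2.1.2 ∘ Γ p.2.2.2)}
    have : Countable A := inferInstance
    have hprop : ∀ kl (L : List (Fin n)) x, (∀ j ∈ L, i < j) →
        IsProperCurve (W' kl L ∘ Γ x) := fun kl L x hL =>
      (isIso_compList fun j hj => WindingBand.isIso_wind (hprev j (hL j hj)).1 _ _).isProperCurve
        (hΓ x)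
    have hcl : IsClosed (⋃ j : {j // i < j}, st j (B j)) :=
      isClosed_iUnion_of_finite fun j => WindingBand.isClosed_strip (hprev j j.2).1
    have hmem : ∀ x, x ∉ (⋃ j : {j // i < j}, st j (B j)) ↔ ∀ j, i < j → x ∉ st j (B j) := by
      intro x
      simp
    obtain ⟨b, h1, ⟨a, h2, h3⟩, ⟨a', h4, h5⟩, h6, h7⟩ := exists_windingBand o (hτ i) (hV i)
      (hτV i) hw (Z := range z ∪ range (fun j => q j (B j)) ∪ range fun j => q' j (B j))
      (((finite_range _).union (finite_range _)).union (finite_range _)) hΓ (hU.sdiff hcl) (hzτ i)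
      ⟨hzU i, (hmem _).2 fun j hj => (hprev j hj).2.2.2.1 i⟩
      (A := A) (γ := fun p => W' p.1.1 p.1.2.1.1 ∘ Γ p.1.2.2.1)
      (δ := fun p => W' p.1.1 p.1.2.1.2 ∘ Γ p.1.2.2.2)
      (fun p => hprop _ _ _ p.2.1) (fun p => hprop _ _ _ p.2.2.1) (fun p => p.2.2.2.2)
      (fun p => by
        rcases p.2.2.2.1 with h | h
        · exact Or.inl ⟨p.1.2.2.1, by rw [h]; rfl⟩
        · exact Or.inr ⟨p.1.2.2.2, by rw [h]; rfl⟩)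
    rw [Set.disjoint_left] at h6
    refine ⟨(b, a, a'), h1, ⟨h2.1, h3, (hmem _).1 h2.2⟩, ⟨h4.1, h5, (hmem _).1 h4.2⟩,
      fun j => h6 (Or.inl (Or.inl (mem_range_self j))), fun j _ =>
        ⟨h6 (Or.inl (Or.inr ⟨j, rfl⟩)), h6 (Or.inr ⟨j, rfl⟩)⟩,
      fun k l L L' x y hL hL' hLL htr => ?_⟩
    exact h7 (k i) (l i) ⟨((k, l), (L, L'), x, y), hL, hL', hLL, htr⟩)
  refine ⟨fun i => (B i).1, fun i => (B i).2.1, fun i => (B i).2.2, fun i => (hB i).1,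
    fun i => (hB i).2.1.1, fun i => (hB i).2.1.2.1, fun i j hij => ?_, fun i => (hB i).2.2.1.1,
    fun i => (hB i).2.2.1.2.1, fun i j hij => ?_,
    fun i k l L L' x y => (hB i).2.2.2.2.2 k l L L' x y⟩
  · rcases lt_or_gt_of_ne hij with h | h
    · exact ((hB j).2.2.2.2.1 i h).1
    · exact (hB i).2.1.2.2 j h
  · rcases lt_or_gt_of_ne hij with h | h
    · exact ((hB j).2.2.2.2.1 i h).2
    · exact (hB i).2.2.1.2.2 j h

end Winding

/-! ### The theorem: both parts from one choice of bands. -/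

theorem lemma3p1 {R : Type*} [TopologicalSpace R] [ChartedSpace (EuclideanHalfSpace 2) R]
    [IsManifold (𝓡∂ 2) ∞ R] [CompactSpace R] [ConnectedSpace R] [T2Space R]
    (o : Winding.SurfaceOrientation R)
    -- the basepoints
    (w : Set R) (hw_fin : w.Finite) (hw : w.Nonempty)
    -- the curves `Γ = Ξ ⊔ Θ`
    {n m : ℕ} (ξ : Fin n → ℝ → R) (θ : Fin m → ℝ → R)
    (hΓ : Winding.IsCurveSystem (Sum.elim ξ θ))
    -- the circles
    (τ : Fin n → ℝ → R) (hτ : ∀ i, Winding.IsCircle (τ i))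
    (hτξ : ∀ i, Winding.MeetOnce (τ i) (ξ i))
    -- the region
    (U : Set R) (hU_open : IsOpen U) (hU_conn : IsConnected U) (hwU : w ⊆ U)
    (hτξU : ∀ i, Winding.trace (τ i) ∩ Winding.trace (ξ i) ⊆ U)
    (hθU : ∀ j, Disjoint (Winding.trace (θ j)) U)
    -- winding takes place in prescribed, arbitrarily small neighbourhoods of the circles
    (V : Fin n → Set R) (hV_open : ∀ i, IsOpen (V i)) (hτV : ∀ i, Winding.trace (τ i) ⊆ V i) :
    -- each `ξ i` is wound along `τ i`
    (∃ (B : ∀ i, Winding.WindingBand (τ i) (V i) w) (N : ℕ),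
      ∀ k l : Fin n → ℕ, (∀ i, N ≤ k i ∧ N ≤ l i) →
        ∀ Γ' : Fin n ⊕ Fin m → ℝ → R,
          Γ' = Sum.elim (fun i => (B i).wind (k i) (l i) ∘ ξ i) θ →
          Winding.IsCurveSystem Γ' ∧
          ∀ (D : R → ℚ) (c : Fin n ⊕ Fin m → ℚ),
            Winding.IsRelativePeriodicDomain o w Γ' D c → (∃ i, c (Sum.inl i) ≠ 0) →
              Winding.HasBothSigns (Winding.support Γ') D ∧
              ¬ Winding.IsNonnegative (Winding.support Γ') D) ∧
    -- all the `ξ j` are wound simultaneously along every `τ i`, and remain disjoint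
    ((∀ i j, i ≠ j → Winding.HasIntersectionNumber o (τ i) (ξ j) 0) →
      (∀ i j, i ≠ j → Disjoint (Winding.trace (ξ i)) (Winding.trace (ξ j))) →
      ∃ (B : ∀ i, Winding.WindingBand (τ i) (V i) w) (N : ℕ),
        ∀ k l : Fin n → ℕ, (∀ i, N ≤ k i ∧ N ≤ l i) →
          ∀ Γ' : Fin n ⊕ Fin m → ℝ → R,
            Γ' = Sum.elim (fun j => Winding.windAll B k l ∘ ξ j) θ →
            Winding.IsCurveSystem Γ' ∧
            (∀ i j : Fin n, i ≠ j →
              Disjoint (Winding.trace (Γ' (Sum.inl i))) (Winding.trace (Γ' (Sum.inl j)))) ∧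
            ∀ (D : R → ℚ) (c : Fin n ⊕ Fin m → ℚ),
              Winding.IsRelativePeriodicDomain o w Γ' D c → (∃ i, c (Sum.inl i) ≠ 0) →
                Winding.HasBothSigns (Winding.support Γ') D ∧
                ¬ Winding.IsNonnegative (Winding.support Γ') D) := by
  open Winding in
  have hproper : ∀ x, IsProperCurve (Sum.elim ξ θ x) := hΓ.proper
  obtain ⟨B, a, a', hB, hq, hqΓ, hqs, hq', hqΓ', hqs', htr⟩ := exists_windingBands o hw_fin hτ
    hV_open hτV hproper hU_open (fun i => by
      obtain ⟨p, hp⟩ := (hτξ i).1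
      have hp' : p ∈ trace (τ i) ∩ trace (ξ i) := by rw [hp]; rfl
      exact ⟨p, hp'.1, hτξU i hp'⟩)
  have hiso : ∀ (k l : Fin n → ℕ) (L : List (Fin n)), ∃ S, IsIso o (windList B k l L) S :=
    fun k l L => ⟨_, isIso_compList fun i _ => (B i).isIso_wind (hB i) (k i) (l i)⟩
  -- The windings are added from the end of the list; each one is in general position to the curve
  -- obtained so far and the unwound `θ j`.
  have hwθ : ∀ (k l : Fin n → ℕ) (L : List (Fin n)), L.Pairwise (· < ·) → ∀ i j,
      Transverse (windList B k l L ∘ ξ i) (θ j) := by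
    intro k l L hL i j
    induction L with
    | nil => exact hΓ.transverse (Sum.inl i) (Sum.inr j) (by simp)
    | cons p L ih =>
      rw [List.pairwise_cons] at hL
      exact htr p k l L [] (Sum.inl i) (Sum.inr j) hL.1 (by simp) (Or.inr rfl) (ih hL.2)
  have hsys : ∀ (L : Fin n → List (Fin n)) (k l : Fin n → ℕ), (∀ j, (L j).Pairwise (· < ·)) →
      (∀ i j, i < j → Transverse (windList B k l (L i) ∘ ξ i) (windList B k l (L j) ∘ ξ j)) →
      IsCurveSystem (woundFamily B k l L ξ θ) := by
    intro L k l hL h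
    refine ⟨?_, ?_⟩
    · rintro (j | j)
      · obtain ⟨S, hS⟩ := hiso k l (L j)
        exact hS.isProperCurve (hproper (Sum.inl j))
      · exact hproper (Sum.inr j)
    · rintro (i | i) (j | j) hij
      · rcases lt_or_gt_of_ne (fun e => hij (congrArg Sum.inl e)) with h' | h'
        · exact h i j h'
        · exact (h j i h').symm
      · exact hwθ k l _ (hL i) i j
      · exact (hwθ k l _ (hL j) j i).symm
      · exact hΓ.transverse (Sum.inr i) (Sum.inr j) hij
  constructor
  · obtain ⟨N, hN⟩ := exists_bound_hasBothSigns (L := fun j => [j]) hw hU_open hU_conn hwU hproper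
      hθU hτ hτξ hB (by simp) (by simp) (by
        intro i j hij hne
        exact absurd (List.mem_singleton.1 hij) hne) hq hqΓ hqs hq' hqΓ' hqs'
    refine ⟨B, N, fun k l hkl Γ' hΓ' => ?_⟩
    have e : Γ' = woundFamily B k l (fun j => [j]) ξ θ := hΓ'
    rw [e]
    -- For `i < j`, first `ξ j` is wound against the unwound `ξ i`, then `ξ i` against the wound `ξ
    -- j`. This is the order in which the bands were made generic.
    have hs := hsys (fun j => [j]) k l (by simp) (fun i j hij => by
      have h1 : Transverse (ξ i) (windList B k l [j] ∘ ξ j) :=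
        (htr j k l [] [] (Sum.inl j) (Sum.inl i) (by simp) (by simp) (Or.inl rfl)
          (hΓ.transverse (Sum.inl j) (Sum.inl i) (by simpa using hij.ne'))).symm
      exact htr i k l [] [j] (Sum.inl i) (Sum.inl j) (by simp) (by simpa using hij) (Or.inl rfl) h1)
    exact ⟨hs, hN k l hkl hs⟩
  · intro hint hdisj
    obtain ⟨N, hN⟩ := exists_bound_hasBothSigns (L := fun _ => List.finRange n) hw hU_open hU_conn
      hwU hproper hθU hτ hτξ hB (fun _ => List.nodup_finRange n) (fun j => List.mem_finRange j)
      (fun i j _ hne => hint i j hne) hq hqΓ hqs hq' hqΓ' hqs'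
    refine ⟨B, N, fun k l hkl Γ' hΓ' => ?_⟩
    have e : Γ' = woundFamily B k l (fun _ => List.finRange n) ξ θ := by
      rw [hΓ']
      unfold windAll woundFamily compList
      rw [List.ofFn_eq_map]
    rw [e]
    obtain ⟨S, hS⟩ := hiso k l (List.finRange n)
    -- All `ξ j` are moved by the same diffeomorphism, which preserves their mutual transversality;
    -- its injectivity preserves disjointness.
    have hs := hsys (fun _ => List.finRange n) k l (fun _ => List.pairwise_lt_finRange n)
      (fun i j hij => hS.transverse (hproper (Sum.inl i)) (hproper (Sum.inl j))
        (hΓ.transverse (Sum.inl i) (Sum.inl j) (by simpa using hij.ne)))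
    refine ⟨hs, fun i j hij => ?_, hN k l hkl hs⟩
    rw [Set.disjoint_left]
    rintro x ⟨s, hs, hsx⟩ ⟨t, ht, htx⟩
    have h1 : ξ i s = ξ j t := hS.injective (hsx.trans htx.symm)
    exact Set.disjoint_left.1 (hdisj i j hij) ⟨s, hs, rfl⟩ ⟨t, ht, h1.symm⟩
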